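/- Let $R$ be a discrete valuation ring with uniformizer $t$ and residue field $K=R/(t)$, and let $S^1=\mathbb R/2\pi\mathbb Z$. **The category $\mathcal C_\pi$.** Its indecomposable objects are the ordered pairs $(x_0,x_1)$ of distinct points of $S^1$, labelled by real numbers $x_0<x_1<x_0+2\pi$ up to simultaneous translation by $2\pi\mathbb Z$. For $X=(x_0,x_1)$, $Y=(y_0,y_1)$ the space $\mathcal C_\pi(X,Y)$ is $K\,b_+^{XY}$ if the coordinates can be chosen with $x_0\le y_0<x_1\le y_1<x_0+2\pi$, it is $K\,b_-^{XY}$ if they can be chosen with $x_0\le y_1<x_1\le y_0+2\pi<x_0+2\pi$, and $0$ otherwise; $b_{\varepsilon'}^{YZ}b_{\varepsilon}^{XY}=b_{\varepsilon\varepsilon'}^{XZ}$ if the latter exists, and $0$ otherwise. $\mathcal C_\pi$ is the category of formal finite direct sums of these objects, with matrices as morphisms; matrix entries are recorded as scalars in $K$ with respect to the basic morphisms $b_\varepsilon$. The shift is $\Sigma(x_0,x_1)=(x_1,x_0+2\pi)$. **Triangles.** A representation of $S^1$ over $R$ consists of $R$-modules $V[x]$ ($[x]\in S^1$) and functorial maps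 $V[x]\to V[x-\alpha]$ ($\alpha\ge 0$) such that rotation by $2\pi n$ is multiplication by $t^n$; $P_{[x]}$ is the projective representation freely generated by an element $e_x$ at $x$, and $e_x^\alpha$ is the image of $e_x$ at $x-\alpha$. $\mathcal F_\pi$ is the Frobenius category of pairs $(V,d)$, where $V$ is a finitely generated projective representation and $d$ is an endomorphism of $V$ with $d^2=t$, with the sequences that are exact as sequences of representations as exact sequences. For $x\le y\le x+2\pi$, $E(x,y)=P_{[x]}\oplus P_{[y]}$ with $d(e_x)=e_y^{y-x}$, $d(e_y)=e_x^{x+2\pi-y}$. The stable category of $\mathcal F_\pi$ is identified with $\mathcal C_\pi$ by $(x,y)\leftrightarrow E(x,y)$, where $b_+$ corresponds to the basic diagonal map ($e_{x_0}\mapsto e_{y_0}^{y_0-x_0}$, $e_{x_1}\mapsto e_{y_1}^{y_1-x_1}$) and $b_-$ to the basic counter-diagonal map ($e_{x_0}\mapsto e_{y_1}^{y_1-x_0}$, $e_{x_1}\mapsto e_{y_0}^{y_0+2\pi-x_1}$). For $E(x,y)$ one chooses the exact sequence $$E(x,y)\xrightarrow{\binom{1}{-1}}E(y,y)\oplus E(x,x+2\pi)\xrightarrow{(1,1)}E(y,x+2\pi)=\Sigma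 E(x,y)$$ of multiples of basic diagonal maps, and for direct sums the direct sum of these sequences. The distinguished triangles $X\to Y\to Z\to\Sigma X$ starting with $\underline f:X\to Y$ are those obtained, up to isomorphism of the third object in the stable category, by lifting $\underline f$ to $\mathcal F_\pi$ and taking the pushout $Y\to C\to\Sigma X$ of the chosen sequence of $X$ along the lift. **Statement.** Let $a<b<c<x<y<z<a+2\pi$ be real numbers, $X=(a,x)$ and $Y=Y_1\oplus Y_2=(b,z)\oplus(c,y)$, and let $\underline f=(f_1,f_2):X\to Y$ be a morphism in $\mathcal C_\pi$ both of whose components are nonzero. 1. For every object $Z$ of $\mathcal C_\pi$, there are morphisms $\underline g:Y\to Z$, $\underline h:Z\to\Sigma X$ such that $X\xrightarrow{\underline f}Y\xrightarrow{\underline g}Z\xrightarrow{\underline h}\Sigma X$ is a distinguished triangle if and only if $Z\cong(b,a+2\pi)\oplus(c,z)\oplus(x,y)$. 2. Let $Z=Z_1\oplus Z_2\oplus Z_3=(b,a+2\pi)\oplus(c,z)\oplus(x,y)$, and let $\underline g=(g_{ji}):Y\to Z$ and $\underline h=(h_j):Z\to\Sigma X$ be morphisms, where $g_{ji}$ is the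 scalar of the component $Y_i\to Z_j$ and $h_j$ that of $Z_j\to\Sigma X$. Then $X\xrightarrow{\underline f}Y\xrightarrow{\underline g}Z\xrightarrow{\underline h}\Sigma X$ is a distinguished triangle if and only if $$h_1g_{11}f_1=-1,\quad h_2g_{21}f_1=1,\quad h_2g_{22}f_2=-1,\quad h_3g_{32}f_2=1,\quad g_{12}=0,\quad g_{31}=0.$$ -/

import Mathlib

open CategoryTheory CategoryTheory.Limits

universe u

noncomputable section

/-- The circle `S¹ = ℝ / 2πℤ`. -/
abbrev Circ : Type := AddCircle (2 * Real.pi)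

instance fact_two_pi_pos : Fact ((0 : ℝ) < 2 * Real.pi) := ⟨Real.two_pi_pos⟩

/-- Two real numbers have the same class in `S¹` iff they differ by a multiple of `2π`. -/
theorem Circ.coe_eq_coe {x y : ℝ} (h : (x : Circ) = (y : Circ)) :
    ∃ n : ℤ, x = y + n * (2 * Real.pi) := by
  obtain ⟨n, hn⟩ := (AddCircle.coe_eq_zero_iff (2 * Real.pi)).1
    (show ((x - y : ℝ) : Circ) = 0 by rw [AddCircle.coe_sub, h, sub_self])
  exact ⟨n, by rw [zsmul_eq_mul] at hn; linarith⟩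

theorem Circ.coe_add_int (x : ℝ) (n : ℤ) : ((x + n * (2 * Real.pi) : ℝ) : Circ) = x := by
  rw [AddCircle.coe_add, ← zsmul_eq_mul, AddCircle.coe_zsmul, AddCircle.coe_period, smul_zero,
    add_zero]

theorem Circ.coe_add_two_pi (x : ℝ) : ((x + 2 * Real.pi : ℝ) : Circ) = x := by
  simp

theorem Circ.eq_of_close {x y : ℝ} (h : (x : Circ) = (y : Circ)) (h1 : x < y + 2 * Real.pi)
    (h2 : y < x + 2 * Real.pi) : x = y := by
  obtain ⟨n, hn⟩ := Circ.coe_eq_coe h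
  have hp := Real.two_pi_pos
  have h3 : (n : ℝ) < 1 := by
    by_contra hc
    nlinarith [mul_le_mul_of_nonneg_right (not_lt.1 hc) hp.le]
  have h4 : (-1 : ℝ) < n := by
    by_contra hc
    nlinarith [mul_le_mul_of_nonneg_right (not_lt.1 hc) hp.le]
  have h5 : n < 1 := by exact_mod_cast h3
  have h6 : -1 < n := by exact_mod_cast h4
  have : n = 0 := by omega
  subst this
  simpa using hn

/-! ### The continuous cluster category `C_π` -/

/-- The indecomposable objects `(x, y)` of `C_π` (over `K`): ordered pairs of distinct points
of the circle. -/
structure IndC (K : Type*) where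
  fst : Circ
  snd : Circ
  ne : fst ≠ snd

namespace IndC

section
variable {K : Type*}

/-- The object `(x, y)` given by real numbers `x < y < x + 2π`. -/
def mk' (x y : ℝ) (h : x < y) (h' : y < x + 2 * Real.pi) : IndC K where
  fst := x
  snd := y
  ne e := h.ne (Circ.eq_of_close e (by linarith [Real.two_pi_pos]) h')

/-- `Σ (x, y) = (y, x)`. -/
def swap (X : IndC K) : IndC K := ⟨X.snd, X.fst, X.ne.symm⟩

@[simp] theorem swap_swap (X : IndC K) : X.swap.swap = X := rfl

/-- The coordinates of `X = (x₀, x₁)` and `Y = (y₀, y₁)` can be chosen such that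
`x₀ ≤ y₀ < x₁ ≤ y₁ < x₀ + 2π`. -/
def Linked (X Y : IndC K) : Prop :=
  ∃ x₀ x₁ y₀ y₁ : ℝ, (x₀ : Circ) = X.fst ∧ (x₁ : Circ) = X.snd ∧ (y₀ : Circ) = Y.fst ∧
    (y₁ : Circ) = Y.snd ∧ x₀ ≤ y₀ ∧ y₀ < x₁ ∧ x₁ ≤ y₁ ∧ y₁ < x₀ + 2 * Real.pi

/-- The coordinates of `X = (x₀, x₁)` and `Y = (y₀, y₁)` can be chosen such that
`x₀ ≤ y₁ < x₁ ≤ y₀ + 2π < x₀ + 2π`. -/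
def CounterLinked (X Y : IndC K) : Prop :=
  ∃ x₀ x₁ y₀ y₁ : ℝ, (x₀ : Circ) = X.fst ∧ (x₁ : Circ) = X.snd ∧ (y₀ : Circ) = Y.fst ∧
    (y₁ : Circ) = Y.snd ∧ x₀ ≤ y₁ ∧ y₁ < x₁ ∧ x₁ ≤ y₀ + 2 * Real.pi ∧
    y₀ + 2 * Real.pi < x₀ + 2 * Real.pi

theorem counterLinked_iff {X Y : IndC K} : CounterLinked X Y ↔ Linked X Y.swap := by
  constructor
  · rintro ⟨x₀, x₁, y₀, y₁, a, b, c, d, h⟩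
    exact ⟨x₀, x₁, y₁, y₀ + 2 * Real.pi, a, b, d, (Circ.coe_add_two_pi _).trans c, h⟩
  · rintro ⟨x₀, x₁, y₁, y₀, a, b, c, d, h1, h2, h3, h4⟩
    refine ⟨x₀, x₁, y₀ - 2 * Real.pi, y₁, a, b, ?_, c, h1, h2, by linarith, by linarith⟩
    rw [← Circ.coe_add_two_pi, sub_add_cancel]; exact d

theorem Linked.refl (X : IndC K) : Linked X X := by
  obtain ⟨x, hx⟩ : ∃ x : ℝ, (x : Circ) = X.fst := ⟨_, AddCircle.coe_equivIco (a := 0)⟩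
  have hy := AddCircle.coe_equivIco (p := 2 * Real.pi) (a := x) (y := X.snd)
  obtain ⟨h1, h2⟩ := (AddCircle.equivIco (2 * Real.pi) x X.snd).2
  set y : ℝ := (AddCircle.equivIco (2 * Real.pi) x X.snd : ℝ)
  have : x < y := lt_of_le_of_ne h1 fun e => X.ne (by rw [← hx, ← hy, e])
  exact ⟨x, y, x, y, hx, hy, hx, hy, le_rfl, this, le_rfl, h2⟩

theorem Linked.swap {X Y : IndC K} (h : Linked X Y) : Linked X.swap Y.swap := by
  obtain ⟨x₀, x₁, y₀, y₁, a, b, c, d, h1, h2, h3, h4⟩ := h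
  exact ⟨x₁, x₀ + 2 * Real.pi, y₁, y₀ + 2 * Real.pi, b, (Circ.coe_add_two_pi _).trans a, d,
    (Circ.coe_add_two_pi _).trans c, h3, h4, by linarith, by linarith⟩

theorem linked_swap_iff {X Y : IndC K} : Linked X.swap Y.swap ↔ Linked X Y :=
  ⟨fun h => by simpa using h.swap, Linked.swap⟩

/-- Once lifts of `X` are fixed, lifts of `Y` can be adapted to them. -/
theorem Linked.exists_lift {X Y : IndC K} (h : Linked X Y) {x₀ x₁ : ℝ}
    (h₀ : (x₀ : Circ) = X.fst) (h₁ : (x₁ : Circ) = X.snd) (hl : x₀ < x₁)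
    (hl' : x₁ < x₀ + 2 * Real.pi) : ∃ y₀ y₁ : ℝ, (y₀ : Circ) = Y.fst ∧ (y₁ : Circ) = Y.snd ∧
      x₀ ≤ y₀ ∧ y₀ < x₁ ∧ x₁ ≤ y₁ ∧ y₁ < x₀ + 2 * Real.pi := by
  obtain ⟨u₀, u₁, v₀, v₁, a, b, c, d, h1, h2, h3, h4⟩ := h
  obtain ⟨n, hn⟩ := Circ.coe_eq_coe (h₀.trans a.symm)
  have e : u₁ + n * (2 * Real.pi) = x₁ :=
    Circ.eq_of_close ((Circ.coe_add_int _ _).trans (b.trans h₁.symm)) (by linarith) (by linarith)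
  exact ⟨v₀ + n * (2 * Real.pi), v₁ + n * (2 * Real.pi), (Circ.coe_add_int _ _).trans c,
    (Circ.coe_add_int _ _).trans d, by linarith, by linarith, by linarith, by linarith⟩

theorem not_linked_and_counter {X Y : IndC K} (h : Linked X Y) (h' : Linked X Y.swap) : False := by
  obtain ⟨x₀, x₁, y₀, y₁, a, b, c, d, h1, h2, h3, h4⟩ := h
  obtain ⟨v₀, v₁, c', d', k1, k2, k3, k4⟩ :=
    h'.exists_lift a b (by linarith) (by linarith)
  have : y₀ = v₁ := Circ.eq_of_close (c.trans d'.symm) (by linarith) (by linarith)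
  linarith

/-- Along adapted lifts, being linked is decided by inequalities. -/
theorem linked_iff_of_lift {X Z : IndC K} {x₀ x₁ z₀ z₁ : ℝ}
    (a : (x₀ : Circ) = X.fst) (b : (x₁ : Circ) = X.snd)
    (c : (z₀ : Circ) = Z.fst) (d : (z₁ : Circ) = Z.snd) (hl : x₀ < x₁)
    (hl' : x₁ < x₀ + 2 * Real.pi) (h1 : x₀ ≤ z₀) (h2 : z₀ < x₀ + 2 * Real.pi) (h3 : x₁ ≤ z₁)
    (h4 : z₁ < x₁ + 2 * Real.pi) : Linked X Z ↔ z₀ < x₁ ∧ z₁ < x₀ + 2 * Real.pi := by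
  constructor
  · intro h
    obtain ⟨v₀, v₁, c', d', k1, k2, k3, k4⟩ := h.exists_lift a b hl hl'
    have e : z₀ = v₀ := Circ.eq_of_close (c.trans c'.symm) (by linarith) (by linarith)
    have e' : z₁ = v₁ := Circ.eq_of_close (d.trans d'.symm) (by linarith) (by linarith)
    exact ⟨by linarith, by linarith⟩
  · rintro ⟨k1, k2⟩
    exact ⟨x₀, x₁, z₀, z₁, a, b, c, d, h1, k1, h3, k2⟩

theorem linked_assoc {X Y Z W : IndC K} (h1 : Linked X Y) (h2 : Linked Y Z) (h3 : Linked Z W)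
    (h4 : Linked X W) : Linked X Z ↔ Linked Y W := by
  obtain ⟨x₀, x₁, y₀, y₁, a, b, c, d, k1, k2, k3, k4⟩ := h1
  obtain ⟨z₀, z₁, e, f, l1, l2, l3, l4⟩ := h2.exists_lift c d (by linarith) (by linarith)
  obtain ⟨w₀, w₁, g, i, m1, m2, m3, m4⟩ := h3.exists_lift e f (by linarith) (by linarith)
  rw [linked_iff_of_lift a b e f (by linarith) (by linarith) (by linarith) (by linarith)
    (by linarith) (by linarith), linked_iff_of_lift c d g i (by linarith) (by linarith)
    (by linarith) (by linarith) (by linarith) (by linarith)]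
  constructor
  · rintro ⟨n1, n2⟩
    rw [linked_iff_of_lift a b g i (by linarith) (by linarith) (by linarith) (by linarith)
      (by linarith) (by linarith)] at h4
    exact ⟨by linarith, by linarith⟩
  · rintro ⟨n1, n2⟩
    rw [linked_iff_of_lift a b g i (by linarith) (by linarith) (by linarith) (by linarith)
      (by linarith) (by linarith)] at h4
    exact ⟨by linarith, by linarith⟩

open Classical in
/-- The sign `ε` of the basic morphism `b_ε^{XY}`, and `0` if `C_π(X, Y) = 0`. -/
def sgn (X Y : IndC K) : SignType :=
  if Linked X Y then 1 else if CounterLinked X Y then -1 else 0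

/-- Reversing the orientation of an object when the sign is negative. -/
def orient (s : SignType) (X : IndC K) : IndC K := if s = -1 then X.swap else X

theorem sgn_eq_iff {s : SignType} (hs : s ≠ 0) {X Y : IndC K} :
    sgn X Y = s ↔ Linked X (Y.orient s) := by
  have hx := @not_linked_and_counter K X Y
  unfold sgn
  rw [counterLinked_iff]
  rcases s with _ | _ | _
  · exact absurd rfl hs
  · by_cases h : Linked X Y <;> by_cases h' : Linked X Y.swap <;> simp_all [orient]
  · by_cases h : Linked X Y <;> by_cases h' : Linked X Y.swap <;> simp_all [orient]

theorem linked_orient_iff {s s' : SignType} (hs : s ≠ 0) (hs' : s' ≠ 0) {X Y : IndC K} :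
    Linked (X.orient s) (Y.orient (s * s')) ↔ Linked X (Y.orient s') := by
  rcases s with _ | _ | _
  · exact absurd rfl hs
  · rcases s' with _ | _ | _
    · exact absurd rfl hs'
    · exact linked_swap_iff (X := X) (Y := Y.swap)
    · simpa [orient] using linked_swap_iff (X := X) (Y := Y)
  · simp [orient]

theorem sgn_self (X : IndC K) : sgn X X = 1 := by
  simp [sgn, Linked.refl]

/-- The combinatorial content of associativity of the composition. -/
theorem sgn_assoc {X Y Z W : IndC K} (h1 : sgn X Y ≠ 0) (h2 : sgn Y Z ≠ 0) (h3 : sgn Z W ≠ 0)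
    (h4 : sgn X Y * sgn Y Z * sgn Z W = sgn X W) :
    sgn X Y * sgn Y Z = sgn X Z ↔ sgn Y Z * sgn Z W = sgn Y W := by
  have a := (sgn_eq_iff h1).1 rfl
  have b := (sgn_eq_iff h2).1 rfl
  have c := (sgn_eq_iff h3).1 rfl
  have h12 : sgn X Y * sgn Y Z ≠ 0 := mul_ne_zero h1 h2
  have h23 : sgn Y Z * sgn Z W ≠ 0 := mul_ne_zero h2 h3
  have h123 : sgn X Y * sgn Y Z * sgn Z W ≠ 0 := mul_ne_zero h12 h3
  have d := (sgn_eq_iff h123).1 h4.symm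
  rw [eq_comm, sgn_eq_iff h12, eq_comm, sgn_eq_iff h23, ← linked_orient_iff h1 h23, ← mul_assoc]
  exact linked_assoc a ((linked_orient_iff h1 h2).2 b) ((linked_orient_iff h12 h3).2 c) d

end

variable {K : Type*} [Field K]

/-- Morphisms `X ⟶ Y` between indecomposables: multiples `r b_ε^{XY}` of the basic morphism,
recorded by the scalar `r`, which has to vanish if there is no basic morphism. -/
@[ext]
structure Hom (X Y : IndC K) where
  coeff : K
  zero : sgn X Y = 0 → coeff = 0

/-- `r b_ε^{XY}` followed by `s b_{ε'}^{YZ}` is `r s b_{εε'}^{XZ}` if this exists, and `0`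
otherwise. -/
def comp {X Y Z : IndC K} (f : Hom X Y) (g : Hom Y Z) : Hom X Z where
  coeff := if sgn X Y * sgn Y Z = sgn X Z then f.coeff * g.coeff else 0
  zero h := by
    split_ifs with h'
    · rw [h, mul_eq_zero] at h'
      rcases h' with h' | h'
      · rw [f.zero h', zero_mul]
      · rw [g.zero h', mul_zero]
    · rfl

instance : Category (IndC K) where
  Hom := Hom
  id X := ⟨1, fun h => by simp [sgn_self] at h⟩
  comp := comp
  id_comp f := Hom.ext (by simp [comp, sgn_self])
  comp_id f := Hom.ext (by simp [comp, sgn_self])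
  assoc {X Y Z W} f g h := Hom.ext <| by
    simp only [comp]
    by_cases h1 : sgn X Y = 0
    · simp [f.zero h1]
    by_cases h2 : sgn Y Z = 0
    · simp [g.zero h2]
    by_cases h3 : sgn Z W = 0
    · simp [h.zero h3]
    by_cases h4 : sgn X Y * sgn Y Z * sgn Z W = sgn X W
    · have key := sgn_assoc h1 h2 h3 h4
      by_cases h5 : sgn X Y * sgn Y Z = sgn X Z
      · have h6 := key.1 h5
        rw [if_pos h5, if_pos h6, ← h5, ← h6, if_pos h4, if_pos (by rw [← mul_assoc, h4]),
          mul_assoc]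
      · have h6 := fun e => h5 (key.2 e)
        rw [if_neg h5, if_neg h6]
        simp
    · have e1 : (if sgn X Z * sgn Z W = sgn X W then
          (if sgn X Y * sgn Y Z = sgn X Z then f.coeff * g.coeff else 0) * h.coeff else 0) = 0 := by
        split_ifs with k1 k2
        · exact absurd (k2 ▸ k1) h4
        all_goals simp
      have e2 : (if sgn X Y * sgn Y W = sgn X W then
          f.coeff * (if sgn Y Z * sgn Z W = sgn Y W then g.coeff * h.coeff else 0) else 0) = 0 := by
        split_ifs with k1 k2
        · rw [← k2, ← mul_assoc] at k1
          exact absurd k1 h4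
        all_goals simp
      rw [e1, e2]

theorem hom_ext {X Y : IndC K} {f g : X ⟶ Y} (h : f.coeff = g.coeff) : f = g := Hom.ext h

instance (X Y : IndC K) : Zero (X ⟶ Y) := ⟨⟨0, fun _ => rfl⟩⟩
instance (X Y : IndC K) : Add (X ⟶ Y) :=
  ⟨fun f g => ⟨f.coeff + g.coeff, fun h => by rw [f.zero h, g.zero h, add_zero]⟩⟩
instance (X Y : IndC K) : Neg (X ⟶ Y) := ⟨fun f => ⟨-f.coeff, fun h => by rw [f.zero h, neg_zero]⟩⟩
instance (X Y : IndC K) : Sub (X ⟶ Y) :=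
  ⟨fun f g => ⟨f.coeff - g.coeff, fun h => by rw [f.zero h, g.zero h, sub_zero]⟩⟩
instance (X Y : IndC K) : SMul ℕ (X ⟶ Y) :=
  ⟨fun n f => ⟨n • f.coeff, fun h => by rw [f.zero h, smul_zero]⟩⟩
instance (X Y : IndC K) : SMul ℤ (X ⟶ Y) :=
  ⟨fun n f => ⟨n • f.coeff, fun h => by rw [f.zero h, smul_zero]⟩⟩

instance (X Y : IndC K) : AddCommGroup (X ⟶ Y) :=
  Function.Injective.addCommGroup (fun f : X ⟶ Y => f.coeff) (fun _ _ h => hom_ext h) rfl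
    (fun _ _ => rfl) (fun _ => rfl) (fun _ _ => rfl) (fun _ _ => rfl) (fun _ _ => rfl)

instance : Preadditive (IndC K) where
  add_comp X Y Z f f' g := hom_ext <| by
    change (if _ then _ else _) = (if _ then _ else _) + (if _ then _ else _)
    split_ifs
    · exact add_mul _ _ _
    · simp
  comp_add X Y Z f g g' := hom_ext <| by
    change (if _ then _ else _) = (if _ then _ else _) + (if _ then _ else _)
    split_ifs
    · exact mul_add _ _ _
    · simp

end IndC

/-- The continuous cluster category `C_π` over the field `K`: formal finite direct sums of
indecomposables, with matrices as morphisms. The entry `f i j` of a morphism goes from the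
`i`-th summand of the source to the `j`-th summand of the target. -/
abbrev CPi (K : Type*) [Field K] := Mat_ (IndC K)

namespace CPi
variable {K : Type*} [Field K]

/-- The formal direct sum of a finite list of indecomposable objects. -/
def sum {n : ℕ} (X : Fin n → IndC K) : CPi K := ⟨Fin n, X⟩

/-- The shift on objects, `Σ (x, y) = (y, x)` on each summand. -/
abbrev shift (X : CPi K) : CPi K := ⟨X.ι, fun i => (X.X i).swap⟩

end CPi

/-! ### Representations of the circle -/

/-- The circle as a category: a morphism `x ⟶ y` is a rotation by a real angle `α ≥ 0` with
`y = x - α`. -/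
structure RotCirc where
  pt : Circ

/-- A rotation from `x` to `y = x - α`. -/
@[ext]
structure RotCirc.Hom (x y : RotCirc) where
  angle : ℝ
  nonneg : 0 ≤ angle
  eq : x.pt - (angle : Circ) = y.pt

instance : Category RotCirc where
  Hom x y := RotCirc.Hom x y
  id x := ⟨0, le_rfl, by simp⟩
  comp f g := ⟨f.angle + g.angle, add_nonneg f.nonneg g.nonneg, by
    rw [AddCircle.coe_add, ← sub_sub, f.eq, g.eq]⟩
  id_comp f := RotCirc.Hom.ext (zero_add _)
  comp_id f := RotCirc.Hom.ext (add_zero _)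
  assoc f g h := RotCirc.Hom.ext (add_assoc _ _ _)

@[simp] theorem RotCirc.comp_angle {x y z : RotCirc} (f : x ⟶ y) (g : y ⟶ z) :
    (f ≫ g).angle = f.angle + g.angle := rfl

@[simp] theorem RotCirc.id_angle (x : RotCirc) : (𝟙 x : x ⟶ x).angle = 0 := rfl

theorem RotCirc.hom_ext {x y : RotCirc} {f g : x ⟶ y} (h : f.angle = g.angle) : f = g :=
  RotCirc.Hom.ext h

theorem RotCirc.coe_angle {x y : RotCirc} (f : x ⟶ y) : (f.angle : Circ) = x.pt - y.pt := by
  rw [← f.eq]; abel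

/-- The full rotation by `2πn` at `x`. -/
def RotCirc.loop (x : RotCirc) (n : ℕ) : x ⟶ x where
  angle := n * (2 * Real.pi)
  nonneg := by positivity
  eq := by
    have := Circ.coe_add_int 0 n
    simp only [zero_add, Int.cast_natCast] at this
    rw [this]; simp

/-- The unique real number `α` in `[0, 2π)` with `z = x - α`. -/
def dep (x z : Circ) : ℝ := (AddCircle.equivIco (2 * Real.pi) 0 (x - z) : ℝ)

theorem dep_nonneg (x z : Circ) : 0 ≤ dep x z := (AddCircle.equivIco (2 * Real.pi) 0 (x - z)).2.1

theorem dep_lt (x z : Circ) : dep x z < 2 * Real.pi := by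
  have := (AddCircle.equivIco (2 * Real.pi) 0 (x - z)).2.2
  exact this.trans_eq (zero_add _)

theorem coe_dep (x z : Circ) : (dep x z : Circ) = x - z := AddCircle.coe_equivIco

theorem dep_eq {x z : Circ} {c : ℝ} (hc : 0 ≤ c) (hc' : c < 2 * Real.pi)
    (h : (c : Circ) = x - z) : dep x z = c :=
  Circ.eq_of_close ((coe_dep x z).trans h.symm) (by linarith [dep_lt x z])
    (by linarith [dep_nonneg x z])

@[simp] theorem dep_self (x : Circ) : dep x x = 0 := dep_eq le_rfl Real.two_pi_pos (by simp)

/-- The shortest rotation from `x` to `z`. -/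
def RotCirc.short (x z : RotCirc) : x ⟶ z where
  angle := dep x.pt z.pt
  nonneg := dep_nonneg _ _
  eq := by rw [coe_dep]; abel

/-- The number of full turns in an angle `c ≥ 0`. -/
def turns (c : ℝ) : ℕ := ⌊c / (2 * Real.pi)⌋₊

theorem eq_dep_add_turns {x z : Circ} {c : ℝ} (hc : 0 ≤ c) (h : (c : Circ) = x - z) :
    c = dep x z + turns c * (2 * Real.pi) := by
  have hp := Real.two_pi_pos
  have h1 : (turns c : ℝ) ≤ c / (2 * Real.pi) := Nat.floor_le (by positivity)
  have h2 : c / (2 * Real.pi) < turns c + 1 := Nat.lt_floor_add_one _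
  rw [le_div_iff₀ hp] at h1
  rw [div_lt_iff₀ hp] at h2
  have := Circ.eq_of_close (x := c) (y := dep x z + turns c * (2 * Real.pi)) ?_
    (by have := dep_nonneg x z; linarith) (by have := dep_lt x z; linarith)
  · exact this
  · have e := Circ.coe_add_int (dep x z) (turns c)
    simp only [Int.cast_natCast] at e
    rw [e, coe_dep, h]

theorem turns_unique {x z : Circ} {c : ℝ} (hc : 0 ≤ c) (h : (c : Circ) = x - z) {n : ℕ}
    (hn : c = dep x z + n * (2 * Real.pi)) : turns c = n := by
  have := eq_dep_add_turns hc h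
  have hp := Real.two_pi_pos
  have : (turns c : ℝ) * (2 * Real.pi) = n * (2 * Real.pi) := by linarith
  exact_mod_cast mul_right_cancel₀ hp.ne' this

theorem dep_add_angle (x : Circ) {z z' : RotCirc} (β : z ⟶ z') :
    dep x z.pt + β.angle = dep x z'.pt + turns (dep x z.pt + β.angle) * (2 * Real.pi) :=
  eq_dep_add_turns (add_nonneg (dep_nonneg _ _) β.nonneg) (by
    rw [AddCircle.coe_add, coe_dep, RotCirc.coe_angle]; abel)

theorem turns_dep_add_angle (x : Circ) {z z' : RotCirc} (β : z ⟶ z') {n : ℕ}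
    (h : dep x z.pt + β.angle = dep x z'.pt + n * (2 * Real.pi)) :
    turns (dep x z.pt + β.angle) = n :=
  turns_unique (add_nonneg (dep_nonneg _ _) β.nonneg) (by
    rw [AddCircle.coe_add, coe_dep, RotCirc.coe_angle]; abel) h

section Rep

variable {R : Type u} [CommRing R] (t : R)

/-- A functor `V` from the circle to `R`-modules is a representation of `S¹` over `R` if the
rotation by `2πn` acts as multiplication by `tⁿ`. -/
def IsCircRep (V : RotCirc ⥤ ModuleCat.{u} R) : Prop :=
  ∀ (x : RotCirc) (n : ℕ), V.map (x.loop n) = t ^ n • 𝟙 (V.obj x)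

/-- A morphism of representations that is surjective at every point of the circle. -/
def IsPointwiseSurj {V W : RotCirc ⥤ ModuleCat.{u} R} (f : V ⟶ W) : Prop :=
  ∀ x, Function.Surjective (f.app x)

/-- Projectivity in the category of representations of `S¹` over `R`. -/
def IsRepProjective (P : RotCirc ⥤ ModuleCat.{u} R) : Prop :=
  ∀ ⦃V W : RotCirc ⥤ ModuleCat.{u} R⦄, IsCircRep t V → IsCircRep t W →
    ∀ (p : V ⟶ W), IsPointwiseSurj p → ∀ f : P ⟶ W, ∃ g : P ⟶ V, g ≫ p = f

/-- The representation `P_[x]`. The module at `x - α`, `0 ≤ α < 2π`, is free on the generator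
`e_x^α`, and the rotation by `β` sends `e_x^α` to `e_x^(α+β)`, where `e_x^(γ+2πn) = tⁿ e_x^γ`. -/
def projRep (x : Circ) : RotCirc ⥤ ModuleCat.{u} R where
  obj _ := ModuleCat.of R R
  map {z _} β := ModuleCat.ofHom (t ^ turns (dep x z.pt + β.angle) • LinearMap.id)
  map_id z := by
    rw [turns_dep_add_angle x (𝟙 z) (n := 0) (by simp)]; ext; simp
  map_comp {z z' z''} β β' := by
    have h1 := dep_add_angle x β
    have h2 := dep_add_angle x β'
    rw [turns_dep_add_angle x (β ≫ β')
      (n := turns (dep x z.pt + β.angle) + turns (dep x z'.pt + β'.angle))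
      (by push_cast; simp only [RotCirc.comp_angle]; linarith), pow_add]
    ext
    simp [mul_comm]

theorem isCircRep_projRep (x : Circ) : IsCircRep t (projRep t x) := by
  intro z n
  change ModuleCat.ofHom (t ^ turns (dep x z.pt + (z.loop n).angle) • LinearMap.id) = _
  rw [turns_dep_add_angle x (z.loop n) (n := n) rfl]
  rfl

/-- `V` is a quotient of a finite direct sum of representations `P_[x_i]`, that is, there is a
finite jointly surjective family of morphisms `P_[x_i] ⟶ V`. -/
def IsRepFG (V : RotCirc ⥤ ModuleCat.{u} R) : Prop :=
  ∃ (ι : Type) (_ : Fintype ι) (x : ι → Circ) (φ : ∀ i, projRep t (x i) ⟶ V),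
    ∀ (z : RotCirc) (v : V.obj z), ∃ r : ∀ i, (projRep t (x i)).obj z, ∑ i, (φ i).app z (r i) = v

/-- The finitely generated projective representations of `S¹` over `R`. -/
def IsFGProjRep : ObjectProperty (RotCirc ⥤ ModuleCat.{u} R) :=
  fun V => IsCircRep t V ∧ IsRepFG t V ∧ IsRepProjective t V

/-- The morphism `P_[x] ⟶ V` sending `e_x` to `v`. -/
def projRepHom {V : RotCirc ⥤ ModuleCat.{u} R} (hV : IsCircRep t V) (x : RotCirc) (v : V.obj x) :
    projRep t x.pt ⟶ V where
  app z := ModuleCat.ofHom (LinearMap.toSpanSingleton R (V.obj z) (V.map (x.short z) v))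
  naturality z z' β := by
    have h2 : x.short z ≫ β = x.short z' ≫ z'.loop (turns (dep x.pt z.pt + β.angle)) :=
      RotCirc.hom_ext (dep_add_angle x.pt β)
    have h3 := congrArg (fun k => V.map k v) h2
    simp only [Functor.map_comp, hV z'] at h3
    ext
    simp [projRep] at h3 ⊢
    exact h3.symm

theorem isFGProjRep_projRep (x : Circ) : IsFGProjRep t (projRep t x) := by
  refine ⟨isCircRep_projRep t x, ⟨Unit, inferInstance, fun _ => x, fun _ => 𝟙 _, fun z v =>
    ⟨fun _ => v, by simp⟩⟩, ?_⟩
  intro V W hV hW p hp f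
  let e : (projRep t x).obj ⟨x⟩ := (1 : R)
  obtain ⟨v, hv⟩ := hp ⟨x⟩ (f.app ⟨x⟩ e)
  refine ⟨projRepHom t hV ⟨x⟩ v, ?_⟩
  ext z
  have key : (projRep t x).map (RotCirc.short ⟨x⟩ z) e = (1 : R) := by
    change t ^ turns (dep x x + (RotCirc.short ⟨x⟩ z).angle) • (1 : R) = 1
    rw [turns_dep_add_angle x (z := ⟨x⟩) (RotCirc.short ⟨x⟩ z) (n := 0)
      (by simp [RotCirc.short])]
    simp
  have n1 := NatTrans.naturality_apply p (RotCirc.short ⟨x⟩ z) v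
  have n2 := NatTrans.naturality_apply f (RotCirc.short ⟨x⟩ z) e
  rw [key] at n2
  rw [hv, ← n2] at n1
  change p.app z ((1 : R) • V.map (RotCirc.short ⟨x⟩ z) v) = f.app z (1 : R)
  rw [one_smul]
  exact n1

/-- The morphism `P_[x] ⟶ P_[y]` sending `e_x` to `e_y^α`, where `α ≥ 0` and `y = x + α`. -/
def starRep {x y : Circ} (α : ℝ) (h : 0 ≤ α) (hxy : x + (α : Circ) = y) :
    projRep t x ⟶ projRep t y where
  app z := ModuleCat.ofHom (t ^ turns (dep x z.pt + α) • LinearMap.id)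
  naturality z z' β := by
    have a (w : RotCirc) : dep x w.pt + α = dep y w.pt + turns (dep x w.pt + α) * (2 * Real.pi) :=
      eq_dep_add_turns (add_nonneg (dep_nonneg _ _) h)
        (by rw [AddCircle.coe_add, coe_dep, ← hxy]; abel)
    have h1 := dep_add_angle x β
    have h2 := dep_add_angle y β
    have h3 := a z
    have h4 := a z'
    have e : ((turns (dep x z.pt + β.angle) + turns (dep x z'.pt + α) : ℕ) : ℝ) *
        (2 * Real.pi) = ((turns (dep x z.pt + α) + turns (dep y z.pt + β.angle) : ℕ) : ℝ) *
        (2 * Real.pi) := by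
      push_cast; linarith
    have e' : turns (dep x z.pt + β.angle) + turns (dep x z'.pt + α) =
        turns (dep x z.pt + α) + turns (dep y z.pt + β.angle) := by
      exact_mod_cast mul_right_cancel₀ Real.two_pi_pos.ne' e
    ext
    change t ^ turns (dep x z'.pt + α) * (t ^ turns (dep x z.pt + β.angle) * 1) =
      t ^ turns (dep y z.pt + β.angle) * (t ^ turns (dep x z.pt + α) * 1)
    rw [mul_one, mul_one, ← pow_add, ← pow_add, add_comm, e', add_comm]

/-- The category `P_{S¹}` of finitely generated projective representations of `S¹` over `R`. -/
abbrev PS1 := (IsFGProjRep t).FullSubcategory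

/-- `P_[x]` as an object of `P_{S¹}`. -/
def PS1.P (x : Circ) : PS1 t := ⟨projRep t x, isFGProjRep_projRep t x⟩

/-- The morphism `P_[x] ⟶ P_[y]` sending `e_x` to `e_y^α`, where `α ≥ 0` and `y = x + α`. -/
def PS1.star {x y : Circ} (α : ℝ) (h : 0 ≤ α) (hxy : x + (α : Circ) = y) :
    PS1.P t x ⟶ PS1.P t y :=
  ObjectProperty.homMk (starRep t α h hxy)

theorem starRep_comp {x y z : Circ} {α β : ℝ} (hα : 0 ≤ α) (hβ : 0 ≤ β)
    (hxy : x + (α : Circ) = y) (hyz : y + (β : Circ) = z) (hxz : x + ((α + β : ℝ) : Circ) = z) :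
    starRep t α hα hxy ≫ starRep t β hβ hyz = starRep t (α + β) (add_nonneg hα hβ) hxz := by
  ext w
  have h1 := eq_dep_add_turns (x := y) (z := w.pt) (c := dep x w.pt + α)
    (add_nonneg (dep_nonneg _ _) hα) (by rw [AddCircle.coe_add, coe_dep, ← hxy]; abel)
  have h2 := eq_dep_add_turns (x := z) (z := w.pt) (c := dep y w.pt + β)
    (add_nonneg (dep_nonneg _ _) hβ) (by rw [AddCircle.coe_add, coe_dep, ← hyz]; abel)
  have h3 : turns (dep x w.pt + (α + β)) = turns (dep x w.pt + α) + turns (dep y w.pt + β) :=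
    turns_unique (x := z) (z := w.pt) (add_nonneg (dep_nonneg _ _) (add_nonneg hα hβ))
      (by rw [AddCircle.coe_add, coe_dep, ← hxz]; abel) (by push_cast; linarith)
  change t ^ turns (dep y w.pt + β) * (t ^ turns (dep x w.pt + α) * 1) =
    t ^ turns (dep x w.pt + (α + β)) * 1
  rw [h3, pow_add]; ring

theorem starRep_two_pi (x : Circ) (h : x + ((2 * Real.pi : ℝ) : Circ) = x) :
    starRep t (2 * Real.pi) Real.two_pi_pos.le h = t • 𝟙 (projRep t x) := by
  ext w
  have h3 : turns (dep x w.pt + 2 * Real.pi) = 1 :=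
    turns_unique (x := x) (z := w.pt) (add_nonneg (dep_nonneg _ _) Real.two_pi_pos.le)
      (by rw [AddCircle.coe_add, coe_dep, AddCircle.coe_period, add_zero]) (by simp)
  change t ^ turns (dep x w.pt + 2 * Real.pi) * 1 = t * 1
  rw [h3, pow_one]

theorem PS1.star_comp {x y z : Circ} {α β : ℝ} (hα : 0 ≤ α) (hβ : 0 ≤ β)
    (hxy : x + (α : Circ) = y) (hyz : y + (β : Circ) = z) (hxz : x + ((α + β : ℝ) : Circ) = z) :
    PS1.star t α hα hxy ≫ PS1.star t β hβ hyz = PS1.star t (α + β) (add_nonneg hα hβ) hxz :=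
  ObjectProperty.hom_ext _ (starRep_comp t hα hβ hxy hyz hxz)

theorem PS1.star_square {x y y' z : Circ} {α β α' β' : ℝ} (hα : 0 ≤ α) (hβ : 0 ≤ β)
    (hα' : 0 ≤ α') (hβ' : 0 ≤ β') (hxy : x + (α : Circ) = y) (hyz : y + (β : Circ) = z)
    (hxy' : x + (α' : Circ) = y') (hyz' : y' + (β' : Circ) = z) (e : α + β = α' + β') :
    PS1.star t α hα hxy ≫ PS1.star t β hβ hyz = PS1.star t α' hα' hxy' ≫ PS1.star t β' hβ' hyz' := by
  have h : x + ((α + β : ℝ) : Circ) = z := by rw [AddCircle.coe_add, ← add_assoc, hxy, hyz]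
  rw [PS1.star_comp t hα hβ hxy hyz h, PS1.star_comp t hα' hβ' hxy' hyz' (e ▸ h)]
  congr 1

theorem PS1.star_two_pi {x : Circ} {α : ℝ} (hα : 0 ≤ α) (h : x + (α : Circ) = x)
    (e : α = 2 * Real.pi) : PS1.star t α hα h = t • 𝟙 (PS1.P t x) := by
  subst e
  exact ObjectProperty.hom_ext _ (starRep_two_pi t x h)

theorem PS1.star_loop {x y : Circ} {α β : ℝ} (hα : 0 ≤ α) (hβ : 0 ≤ β) (hxy : x + (α : Circ) = y)
    (hyx : y + (β : Circ) = x) (e : α + β = 2 * Real.pi) :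
    PS1.star t α hα hxy ≫ PS1.star t β hβ hyx = t • 𝟙 (PS1.P t x) := by
  have h : x + ((α + β : ℝ) : Circ) = x := by rw [e, AddCircle.coe_period, add_zero]
  rw [PS1.star_comp t hα hβ hxy hyx h, PS1.star_two_pi t _ h e]

/-- Finite direct sums of finitely generated projective representations are such. -/
theorem isFGProjRep_of_total {J : Type} [Fintype J] {F : J → RotCirc ⥤ ModuleCat.{u} R}
    (hF : ∀ j, IsFGProjRep t (F j)) {B : RotCirc ⥤ ModuleCat.{u} R} (i : ∀ j, F j ⟶ B)
    (p : ∀ j, B ⟶ F j) (tot : ∑ j, p j ≫ i j = 𝟙 B) : IsFGProjRep t B := by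
  have tot' (z : RotCirc) (v : B.obj z) : ∑ j, (i j).app z ((p j).app z v) = v := by
    have := congrArg (fun k : B ⟶ B => k.app z v) tot
    simpa [NatTrans.app_sum] using this
  refine ⟨?_, ?_, ?_⟩
  · intro x n
    have h1 : B.map (x.loop n) = ∑ j, (p j).app x ≫ (F j).map (x.loop n) ≫ (i j).app x := by
      have := congrArg (fun k : B ⟶ B => k.app x ≫ B.map (x.loop n)) tot
      simp only [NatTrans.id_app, Category.id_comp] at this
      rw [← this, NatTrans.app_sum, Preadditive.sum_comp]
      simp
    have h2 := congrArg (fun k : B ⟶ B => k.app x) tot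
    simp only [NatTrans.app_sum, NatTrans.comp_app, NatTrans.id_app] at h2
    rw [h1, ← h2, Finset.smul_sum]
    refine Finset.sum_congr rfl fun j _ => ?_
    rw [(hF j).1 x n]
    simp
  · choose I hI x φ hφ using fun j => (hF j).2.1
    refine ⟨Σ j, I j, inferInstance, fun k => x k.1 k.2, fun k => φ k.1 k.2 ≫ i k.1,
      fun z v => ?_⟩
    choose r hr using fun j => hφ j z ((p j).app z v)
    refine ⟨fun k => r k.1 k.2, ?_⟩
    rw [Fintype.sum_sigma]
    conv_rhs => rw [← tot' z v]
    refine Finset.sum_congr rfl fun j _ => ?_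
    rw [← hr j, map_sum]
    rfl
  · intro V W hV hW q hq f
    choose g hg using fun j => (hF j).2.2 hV hW q hq (i j ≫ f)
    refine ⟨∑ j, p j ≫ g j, ?_⟩
    simp only [Preadditive.sum_comp, Category.assoc, hg]
    simp only [← Category.assoc, ← Preadditive.sum_comp]
    rw [tot, Category.id_comp]

instance : HasFiniteBiproducts (PS1 t) := by
  have : HasFiniteBiproducts (RotCirc ⥤ ModuleCat.{u} R) :=
    HasFiniteBiproducts.of_hasFiniteProducts
  refine ⟨fun n => ⟨fun F => ?_⟩⟩
  let G : Fin n → RotCirc ⥤ ModuleCat.{u} R := fun j => (F j).obj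
  let B : PS1 t := ⟨⨁ G, isFGProjRep_of_total t (fun j => (F j).property) (biproduct.ι G)
    (biproduct.π G) biproduct.total⟩
  let p (j : Fin n) : B ⟶ F j := ObjectProperty.homMk (biproduct.π G j)
  let i (j : Fin n) : F j ⟶ B := ObjectProperty.homMk (biproduct.ι G j)
  refine hasBiproduct_of_total { pt := B, π := p, ι := i, ι_π := fun j j' => ?_ } ?_
  · split_ifs with h
    · subst h
      exact ObjectProperty.hom_ext _ (biproduct.ι_π_self G j)
    · exact ObjectProperty.hom_ext _ (biproduct.ι_π_ne G h)
  · apply ObjectProperty.hom_ext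
    change (IsFGProjRep t).ι.map (∑ j, p j ≫ i j) = 𝟙 (⨁ G)
    rw [Functor.map_sum]
    exact biproduct.total

instance : HasBinaryBiproducts (PS1 t) := hasBinaryBiproducts_of_finite_biproducts _

end Rep

/-! ### The Frobenius category `F_π` -/

section Frobenius

variable {R : Type u} [CommRing R] (t : R)

/-- Objects of `F_π`: pairs `(V, d)` with `V` in `P_{S¹}` and `d` an endomorphism of `V` whose
square is multiplication by `t`. -/
structure FPi where
  V : PS1 t
  d : V ⟶ V
  sq : d ≫ d = t • 𝟙 V

namespace FPi

variable {t}

/-- Morphisms of `F_π`: morphisms in `P_{S¹}` commuting with `d`. -/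
@[ext]
structure Hom (X Y : FPi t) where
  f : X.V ⟶ Y.V
  comm : X.d ≫ f = f ≫ Y.d

instance : Category (FPi t) where
  Hom := Hom
  id X := ⟨𝟙 _, by simp⟩
  comp f g := ⟨f.f ≫ g.f, by rw [← Category.assoc, f.comm, Category.assoc, g.comm, Category.assoc]⟩
  id_comp f := Hom.ext (Category.id_comp _)
  comp_id f := Hom.ext (Category.comp_id _)
  assoc f g h := Hom.ext (Category.assoc _ _ _)

@[ext]
theorem hom_ext {X Y : FPi t} {f g : X ⟶ Y} (h : f.f = g.f) : f = g := Hom.ext h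

instance (X Y : FPi t) : Zero (X ⟶ Y) := ⟨⟨0, by simp⟩⟩
instance (X Y : FPi t) : Add (X ⟶ Y) :=
  ⟨fun f g => ⟨f.f + g.f, by rw [Preadditive.comp_add, Preadditive.add_comp, f.comm, g.comm]⟩⟩
instance (X Y : FPi t) : Neg (X ⟶ Y) :=
  ⟨fun f => ⟨-f.f, by rw [Preadditive.comp_neg, Preadditive.neg_comp, f.comm]⟩⟩
instance (X Y : FPi t) : Sub (X ⟶ Y) :=
  ⟨fun f g => ⟨f.f - g.f, by rw [Preadditive.comp_sub, Preadditive.sub_comp, f.comm, g.comm]⟩⟩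
instance (X Y : FPi t) : SMul ℕ (X ⟶ Y) :=
  ⟨fun n f => ⟨n • f.f, by rw [Preadditive.comp_nsmul, Preadditive.nsmul_comp, f.comm]⟩⟩
instance (X Y : FPi t) : SMul ℤ (X ⟶ Y) :=
  ⟨fun n f => ⟨n • f.f, by rw [Preadditive.comp_zsmul, Preadditive.zsmul_comp, f.comm]⟩⟩

instance (X Y : FPi t) : AddCommGroup (X ⟶ Y) :=
  Function.Injective.addCommGroup (fun f : X ⟶ Y => f.f) (fun _ _ h => hom_ext h) rfl
    (fun _ _ => rfl) (fun _ => rfl) (fun _ _ => rfl) (fun _ _ => rfl) (fun _ _ => rfl)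

instance : Preadditive (FPi t) where
  add_comp _ _ _ _ _ _ := hom_ext (Preadditive.add_comp _ _ _ _ _ _)
  comp_add _ _ _ _ _ _ := hom_ext (Preadditive.comp_add _ _ _ _ _ _)

/-- The functor forgetting `d`. -/
def forget : FPi t ⥤ PS1 t where
  obj X := X.V
  map f := f.f

instance : (forget (t := t)).Additive where
  map_add := rfl

instance : HasFiniteBiproducts (FPi t) := by
  refine ⟨fun n => ⟨fun F => ?_⟩⟩
  let G : Fin n → PS1 t := fun j => (F j).V
  let B : FPi t := ⟨⨁ G, biproduct.map fun j => (F j).d, by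
    ext1 j
    rw [Category.assoc, biproduct.map_π, biproduct.map_π_assoc, (F j).sq, Linear.comp_smul,
      Category.comp_id, Linear.smul_comp, Category.id_comp]⟩
  let p (j : Fin n) : B ⟶ F j := ⟨biproduct.π G j, biproduct.map_π (fun j => (F j).d) j⟩
  let i (j : Fin n) : F j ⟶ B := ⟨biproduct.ι G j, (biproduct.ι_map (fun j => (F j).d) j).symm⟩
  refine hasBiproduct_of_total { pt := B, π := p, ι := i, ι_π := fun j j' => ?_ } ?_
  · split_ifs with h
    · subst h
      exact hom_ext (biproduct.ι_π_self G j)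
    · exact hom_ext (biproduct.ι_π_ne G h)
  · apply hom_ext
    change forget.map (∑ j, p j ≫ i j) = 𝟙 (⨁ G)
    rw [Functor.map_sum]
    exact biproduct.total

/-- Exact sequences of `F_π`: sequences `A ⟶ B ⟶ C` such that `0 → A → B → C → 0` is an exact
sequence of representations of `S¹`. -/
def IsExactSeq {A B C : FPi t} (f : A ⟶ B) (g : B ⟶ C) : Prop :=
  ∀ x : RotCirc, Function.Injective (f.f.hom.app x) ∧
    Function.Exact (f.f.hom.app x) (g.f.hom.app x) ∧ Function.Surjective (g.f.hom.app x)

/-- Projective-injective objects with respect to the exact sequences of `F_π`. -/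
def IsProjInj (Q : FPi t) : Prop :=
  ∀ ⦃A B C : FPi t⦄ (f : A ⟶ B) (g : B ⟶ C), IsExactSeq f g →
    (∀ q : Q ⟶ C, ∃ q' : Q ⟶ B, q' ≫ g = q) ∧ (∀ q : A ⟶ Q, ∃ q' : B ⟶ Q, f ≫ q' = q)

variable (t) in
/-- Two morphisms of `F_π` are stably equal if their difference factors through a
projective-injective object. -/
def stableRel : HomRel (FPi t) :=
  fun X Y f g => ∃ (Q : FPi t) (_ : IsProjInj Q) (p : X ⟶ Q) (q : Q ⟶ Y), f - g = p ≫ q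

variable (t) in
/-- The stable category of `F_π`. -/
abbrev Stable := CategoryTheory.Quotient (stableRel t)

variable (t) in
/-- The projection of `F_π` to its stable category. -/
abbrev stab : FPi t ⥤ Stable t := CategoryTheory.Quotient.functor (stableRel t)

end FPi

/-- An arc on the circle: a starting point `[x]` and a length `y - x`, where `x ≤ y ≤ x + 2π`.
It is the class of the pair `(x, y)` modulo simultaneous translation by `2πn`. -/
structure Arc where
  start : Circ
  len : ℝ
  nonneg : 0 ≤ len
  le : len ≤ 2 * Real.pi

/-- The end point `[y]` of an arc. -/
def Arc.finish (A : Arc) : Circ := A.start + (A.len : Circ)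

theorem Arc.start_add (A : Arc) : A.start + (A.len : Circ) = A.finish := rfl

theorem Arc.finish_add (A : Arc) : A.finish + ((2 * Real.pi - A.len : ℝ) : Circ) = A.start := by
  rw [Arc.finish, AddCircle.coe_sub, AddCircle.coe_period]; abel

namespace FPi

/-- The object `E(x, y)`: `P_[x] ⊕ P_[y]`, where `d` has the components
`α_* : P_[x] ⟶ P_[y]`, `α = y - x`, and `β_* : P_[y] ⟶ P_[x]`, `β = x + 2π - y`. -/
def E (A : Arc) : FPi t where
  V := PS1.P t A.start ⊞ PS1.P t A.finish
  d := biprod.desc (PS1.star t A.len A.nonneg A.start_add ≫ biprod.inr)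
    (PS1.star t (2 * Real.pi - A.len) (by linarith [A.le]) A.finish_add ≫ biprod.inl)
  sq := by
    apply biprod.hom_ext'
    · rw [biprod.inl_desc_assoc, Category.assoc, biprod.inr_desc, ← Category.assoc,
        PS1.star_loop t _ _ _ _ (by ring)]
      simp
    · rw [biprod.inr_desc_assoc, Category.assoc, biprod.inl_desc, ← Category.assoc,
        PS1.star_loop t _ _ _ _ (by ring)]
      simp

/-- `r` times the basic diagonal morphism `E(x₀, x₁) ⟶ E(y₀, y₁)`, where `x₀ ≤ y₀`, `x₁ ≤ y₁`
and `y₀ - x₀ = u`: it sends `e_{x₀}` to `r e_{y₀}^(y₀-x₀)` and `e_{x₁}` to `r e_{y₁}^(y₁-x₁)`. -/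
def diag (r : R) {A B : Arc} (u : ℝ) (hu : 0 ≤ u) (h : A.start + (u : Circ) = B.start)
    (hv : A.len ≤ u + B.len) : E t A ⟶ E t B where
  f := biprod.map (r • PS1.star t u hu h)
    (r • PS1.star t (u + B.len - A.len) (by linarith) (by
      rw [Arc.finish, Arc.finish, ← h, AddCircle.coe_sub, AddCircle.coe_add]; abel))
  comm := by
    dsimp only [E]
    apply biprod.hom_ext'
    · rw [biprod.inl_desc_assoc, Category.assoc, biprod.inr_map, biprod.inl_map_assoc,
        biprod.inl_desc, Linear.smul_comp, Linear.comp_smul, Linear.smul_comp,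
        ← Category.assoc, ← Category.assoc]
      congr 2
      exact PS1.star_square t _ _ _ _ _ _ _ _ (by ring)
    · rw [biprod.inr_desc_assoc, Category.assoc, biprod.inl_map, biprod.inr_map_assoc,
        biprod.inr_desc, Linear.smul_comp, Linear.comp_smul, Linear.smul_comp,
        ← Category.assoc, ← Category.assoc]
      congr 2
      exact PS1.star_square t _ _ _ _ _ _ _ _ (by ring)

/-- `r` times the basic counter-diagonal morphism `E(x₀, x₁) ⟶ E(y₀, y₁)`, where `x₀ ≤ y₁`,
`x₁ ≤ y₀ + 2π` and `y₁ - x₀ = u`: it sends `e_{x₀}` to `r e_{y₁}^(y₁-x₀)` and `e_{x₁}` to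
`r e_{y₀}^(y₀+2π-x₁)`. -/
def counterDiag (r : R) {A B : Arc} (u : ℝ) (hu : 0 ≤ u) (h : A.start + (u : Circ) = B.finish)
    (hv : A.len + B.len ≤ u + 2 * Real.pi) : E t A ⟶ E t B where
  f := biprod.desc ((r • PS1.star t u hu h) ≫ biprod.inr)
    ((r • PS1.star t (u - B.len + 2 * Real.pi - A.len) (by linarith) (by
      have : A.start = B.start + (B.len : Circ) - (u : Circ) := by
        rw [eq_sub_iff_add_eq, h, Arc.finish]
      rw [Arc.finish, this]
      simp only [AddCircle.coe_add, AddCircle.coe_sub, AddCircle.coe_period]; abel)) ≫ biprod.inl)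
  comm := by
    dsimp only [E]
    apply biprod.hom_ext'
    · rw [biprod.inl_desc_assoc, Category.assoc, biprod.inr_desc, biprod.inl_desc_assoc,
        Category.assoc, biprod.inr_desc, Linear.smul_comp, Linear.smul_comp, Linear.comp_smul,
        ← Category.assoc, ← Category.assoc]
      congr 2
      exact PS1.star_square t _ _ _ _ _ _ _ _ (by ring)
    · rw [biprod.inr_desc_assoc, Category.assoc, biprod.inl_desc, biprod.inr_desc_assoc,
        Category.assoc, biprod.inl_desc, Linear.smul_comp, Linear.smul_comp, Linear.comp_smul,
        ← Category.assoc, ← Category.assoc]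
      congr 2
      exact PS1.star_square t _ _ _ _ _ _ _ _ (by ring)

end FPi

/-! ### The equivalence of `C_π` with the stable category of `F_π` -/

/-- The arc from `x` to `y` for `X = (x, y)`. -/
def IndC.arc {K : Type*} (X : IndC K) : Arc where
  start := X.fst
  len := dep X.snd X.fst
  nonneg := dep_nonneg _ _
  le := (dep_lt _ _).le

theorem IndC.arc_finish {K : Type*} (X : IndC K) : X.arc.finish = X.snd := by
  rw [Arc.finish, arc, coe_dep]; abel

theorem IndC.arc_len_add {K : Type*} (X : IndC K) :
    X.arc.len + X.swap.arc.len = 2 * Real.pi := by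
  obtain ⟨x₀, x₁, _, _, a, b, _, _, h1, h2, h3, h4⟩ := Linked.refl X
  have e1 : X.arc.len = x₁ - x₀ :=
    dep_eq (by linarith) (by linarith) (by rw [AddCircle.coe_sub, a, b])
  have e2 : X.swap.arc.len = x₀ + 2 * Real.pi - x₁ :=
    dep_eq (by linarith) (by linarith)
      (by rw [AddCircle.coe_sub, Circ.coe_add_two_pi, a, b]; rfl)
  rw [e1, e2]; ring

theorem IndC.Linked.arc_len_le {K : Type*} {X Y : IndC K} (h : Linked X Y) :
    X.arc.len ≤ dep Y.fst X.fst + Y.arc.len := by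
  obtain ⟨x₀, x₁, y₀, y₁, a, b, c, d, h1, h2, h3, h4⟩ := h
  have e1 : X.arc.len = x₁ - x₀ :=
    dep_eq (by linarith) (by linarith) (by rw [AddCircle.coe_sub, a, b])
  have e2 : Y.arc.len = y₁ - y₀ :=
    dep_eq (by linarith) (by linarith) (by rw [AddCircle.coe_sub, c, d])
  have e3 : dep Y.fst X.fst = y₀ - x₀ :=
    dep_eq (by linarith) (by linarith) (by rw [AddCircle.coe_sub, c, a])
  linarith

theorem IndC.CounterLinked.arc_len_le {K : Type*} {X Y : IndC K} (h : CounterLinked X Y) :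
    X.arc.len + Y.arc.len ≤ dep Y.snd X.fst + 2 * Real.pi := by
  obtain ⟨x₀, x₁, y₀, y₁, a, b, c, d, h1, h2, h3, h4⟩ := h
  have e1 : X.arc.len = x₁ - x₀ :=
    dep_eq (by linarith) (by linarith) (by rw [AddCircle.coe_sub, a, b])
  have e2 : Y.arc.len = y₁ - y₀ :=
    dep_eq (by linarith) (by linarith) (by rw [AddCircle.coe_sub, c, d])
  have e3 : dep Y.snd X.fst = y₁ - x₀ :=
    dep_eq (by linarith) (by linarith) (by rw [AddCircle.coe_sub, d, a])
  linarith

open Classical in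
/-- `r` times the basic morphism `E(X) ⟶ E(Y)` in `F_π` which corresponds to `b_ε^{XY}`: diagonal
for `ε = +`, counter-diagonal for `ε = -`, and zero if there is no basic morphism `X ⟶ Y`. -/
def FPi.basic {K : Type*} (r : R) (X Y : IndC K) : E t X.arc ⟶ E t Y.arc :=
  if h : IndC.Linked X Y then
    diag t r (dep Y.fst X.fst) (dep_nonneg _ _) (by rw [coe_dep]; simp [IndC.arc]) h.arc_len_le
  else if h : IndC.CounterLinked X Y then
    counterDiag t r (dep Y.snd X.fst) (dep_nonneg _ _)
      (by rw [coe_dep, IndC.arc_finish]; simp [IndC.arc]) h.arc_len_le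
  else 0

section Chosen

variable {K : Type*} (X : IndC K)

/-- The degenerate arc `(y, y)` for `X = (x, y)`. -/
def IndC.finishArc : Arc := ⟨X.snd, 0, le_rfl, Real.two_pi_pos.le⟩

/-- The full arc `(x, x + 2π)` for `X = (x, y)`. -/
def IndC.fullArc : Arc := ⟨X.fst, 2 * Real.pi, Real.two_pi_pos.le, le_rfl⟩

instance : HasBinaryBiproducts (FPi t) := hasBinaryBiproducts_of_finite_biproducts _

/-- The projective-injective object `E(y, y) ⊕ E(x, x + 2π)`. -/
def FPi.hull : FPi t := E t X.finishArc ⊞ E t X.fullArc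

/-- The first map `(1, -1) : E(x, y) ⟶ E(y, y) ⊕ E(x, x + 2π)` of the chosen exact sequence. -/
def FPi.hullIn : E t X.arc ⟶ hull t X :=
  biprod.lift
    (diag t 1 X.arc.len X.arc.nonneg X.arc_finish (by simp [IndC.finishArc]))
    (diag t (-1) 0 le_rfl (by simp [IndC.arc, IndC.fullArc])
      (by simpa [IndC.fullArc] using X.arc.le))

/-- The second map `(1, 1) : E(y, y) ⊕ E(x, x + 2π) ⟶ E(y, x + 2π)` of the chosen exact
sequence. -/
def FPi.hullOut : hull t X ⟶ E t X.swap.arc :=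
  biprod.desc
    (diag t 1 0 le_rfl (by simp [IndC.arc, IndC.finishArc, IndC.swap])
      (by simpa [IndC.finishArc] using X.swap.arc.nonneg))
    (diag t 1 X.arc.len X.arc.nonneg X.arc_finish
      (by simpa [IndC.fullArc] using X.arc_len_add.ge))

end Chosen

end Frobenius

section Triangles

variable {R : Type u} [CommRing R] [IsLocalRing R] (t : R)

/-- The residue field `K = R / 𝔪`. -/
local notation "𝕂" => IsLocalRing.ResidueField

namespace FPi

/-- The object of `F_π` corresponding to an object of `C_π`: the direct sum of the `E(x, y)`. -/
def ofCPi (X : CPi (𝕂 R)) : FPi t := ⨁ fun i => E t (X.X i).arc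

/-- A morphism `f'` of `F_π` represents (is a lifting of) the morphism `f` of `C_π` if, for all
`i, j`, its `(i, j)` component is stably equal to `r` times the basic morphism for some
`r ∈ R` whose residue class is the `(i, j)` entry of `f`. -/
def Represents {X Y : CPi (𝕂 R)} (f' : ofCPi t X ⟶ ofCPi t Y) (f : X ⟶ Y) : Prop :=
  ∀ i j, ∃ r : R, IsLocalRing.residue R r = (f i j).coeff ∧
    (stab t).map (biproduct.ι (fun i => E t (X.X i).arc) i ≫ f' ≫
      biproduct.π (fun j => E t (Y.X j).arc) j) = (stab t).map (basic t r (X.X i) (Y.X j))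

/-- The middle term of the chosen exact sequence of an object of `C_π`. -/
def sumHull (X : CPi (𝕂 R)) : FPi t := ⨁ fun i => hull t (X.X i)

/-- The first map of the chosen exact sequence, a direct sum of the maps `(1, -1)`. -/
def sumHullIn (X : CPi (𝕂 R)) : ofCPi t X ⟶ sumHull t X :=
  biproduct.map fun i => hullIn t (X.X i)

/-- The second map of the chosen exact sequence, a direct sum of the maps `(1, 1)`. -/
def sumHullOut (X : CPi (𝕂 R)) : sumHull t X ⟶ ofCPi t X.shift :=
  biproduct.map fun i => hullOut t (X.X i)

end FPi

open FPi in
/-- Distinguished triangles `X ⟶ Y ⟶ Z ⟶ ΣX` of `C_π`, starting with `f : X ⟶ Y`. One lifts `f`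
to a morphism `f'` of `F_π` and takes a pushout of the chosen exact sequence of `X`,
```
  X --> Q --> ΣX
  |f'   |u     ‖
  v     v      ‖
  Y --> C --> ΣX
     m     q
```
The triangle is distinguished if, in the stable category of `F_π`, it is isomorphic over `f`
to the one given by `m` and `q` for such a diagram. -/
def IsDistinguished {X Y Z : CPi (𝕂 R)} (f : X ⟶ Y) (g : Y ⟶ Z) (h : Z ⟶ X.shift) : Prop :=
  ∃ (f' : ofCPi t X ⟶ ofCPi t Y) (g' : ofCPi t Y ⟶ ofCPi t Z)
    (h' : ofCPi t Z ⟶ ofCPi t X.shift),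
    Represents t f' f ∧ Represents t g' g ∧ Represents t h' h ∧
    ∃ (C : FPi t) (m : ofCPi t Y ⟶ C) (u : sumHull t X ⟶ C) (q : C ⟶ ofCPi t X.shift)
      (φ : (stab t).obj (ofCPi t Z) ≅ (stab t).obj C),
      IsPushout (sumHullIn t X) f' u m ∧ u ≫ q = sumHullOut t X ∧ m ≫ q = 0 ∧
      (stab t).map g' ≫ φ.hom = (stab t).map m ∧ φ.hom ≫ (stab t).map q = (stab t).map h'

end Triangles

end

/-
A morphism of `F_π` is zero in the stable category if and only if it has the form `sd + ds`, and
every morphism `E(X) ⟶ E(Y)` is the sum of a multiple of a diagonal and a multiple of a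
counter-diagonal morphism. Hence the stable category is `C_π`.

The pushout of a conflation along two homotopic lifts of `f` is the same up to a stable isomorphism
that respects the maps from `Y` and to `ΣX`, so all distinguished triangles over `f` are isomorphic,
with `X` and `Y` fixed, to a single explicit pushout. Its third object is `E(b, a + 2π) ⊕ E(c, z) ⊕
E(x, y)`; to see that the square is a pushout, one splits the sequence on the generators `e_x`,
forgetting `d`.

The three arcs of this object are strictly nested, so there are no nonzero morphisms between
different summands and its automorphisms are diagonal. The triangles over `f` with this third object
are therefore the rescalings of one of them by three nonzero scalars, and eliminating these scalars
gives the equations.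
-/

/-! ### Homotopies -/

namespace FPi

section Homotopy

variable {R : Type u} [CommRing R] {t : R}

@[simp] theorem id_f (X : FPi t) : (𝟙 X : X ⟶ X).f = 𝟙 X.V := rfl
@[simp] theorem comp_f {X Y Z : FPi t} (f : X ⟶ Y) (g : Y ⟶ Z) : (f ≫ g).f = f.f ≫ g.f := rfl
@[simp] theorem add_f {X Y : FPi t} (f g : X ⟶ Y) : (f + g).f = f.f + g.f := rfl
@[simp] theorem zero_f (X Y : FPi t) : (0 : X ⟶ Y).f = 0 := rfl

/-- The morphism `sd + ds` of `F_π` bounded by a homotopy `s`, which need not commute with `d`.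
A morphism is called null-homotopic if it lies in the range of `boundary`. -/
def boundary (X Y : FPi t) : (X.V ⟶ Y.V) →+ (X ⟶ Y) where
  toFun s := ⟨s ≫ Y.d + X.d ≫ s, by simp [reassoc_of% X.sq, Y.sq, add_comm]⟩
  map_zero' := by ext : 1; simp
  map_add' s s' := by ext : 1; simp; abel

@[simp] theorem boundary_f {X Y : FPi t} (s : X.V ⟶ Y.V) :
    (boundary X Y s).f = s ≫ Y.d + X.d ≫ s := rfl

theorem boundary_comp {X Y Z : FPi t} (s : X.V ⟶ Y.V) (g : Y ⟶ Z) :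
    boundary X Y s ≫ g = boundary X Z (s ≫ g.f) := by
  ext : 1; simp [g.comm]

theorem comp_boundary {X Y Z : FPi t} (f : X ⟶ Y) (s : Y.V ⟶ Z.V) :
    f ≫ boundary Y Z s = boundary X Z (f.f ≫ s) := by
  ext : 1; simp [reassoc_of% f.comm]

theorem IsExactSeq.of_splitting {A B C : FPi t} {f : A ⟶ B} {g : B ⟶ C} {r : B.V ⟶ A.V}
    {s : C.V ⟶ B.V} (zero : f.f ≫ g.f = 0) (f_r : f.f ≫ r = 𝟙 A.V) (s_g : s ≫ g.f = 𝟙 C.V)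
    (total : r ≫ f.f + g.f ≫ s = 𝟙 B.V) : IsExactSeq f g := by
  intro x
  have zero_apply (v) : g.f.hom.app x (f.f.hom.app x v) = 0 :=
    congrArg (fun k : A.V ⟶ C.V => k.hom.app x v) zero
  have f_r_apply (v) : r.hom.app x (f.f.hom.app x v) = v :=
    congrArg (fun k : A.V ⟶ A.V => k.hom.app x v) f_r
  have s_g_apply (v) : g.f.hom.app x (s.hom.app x v) = v :=
    congrArg (fun k : C.V ⟶ C.V => k.hom.app x v) s_g
  have total_apply (v) : f.f.hom.app x (r.hom.app x v) + s.hom.app x (g.f.hom.app x v) = v :=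
    congrArg (fun k : B.V ⟶ B.V => k.hom.app x v) total
  refine ⟨Function.LeftInverse.injective f_r_apply, fun v => ⟨fun hv => ⟨r.hom.app x v, ?_⟩, ?_⟩,
    Function.RightInverse.surjective s_g_apply⟩
  · simpa only [hv, map_zero, add_zero] using total_apply v
  · rintro ⟨w, rfl⟩
    exact zero_apply w

theorem IsExactSeq.exists_lift {A B C : FPi t} {f : A ⟶ B} {g : B ⟶ C} (h : IsExactSeq f g)
    {P : PS1 t} (k : P ⟶ C.V) : ∃ k' : P ⟶ B.V, k' ≫ g.f = k := by
  obtain ⟨k', hk'⟩ :=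
    P.property.2.2 B.V.property.1 C.V.property.1 g.f.hom (fun x => (h x).2.2) k.hom
  exact ⟨ObjectProperty.homMk k', ObjectProperty.hom_ext _ hk'⟩

theorem exists_factor_of_injective {U V W : PS1 t} {m : V ⟶ W} {k : U ⟶ W}
    (m_injective : ∀ x, Function.Injective (m.hom.app x))
    (h : ∀ x u, ∃ v, m.hom.app x v = k.hom.app x u) : ∃ k' : U ⟶ V, k' ≫ m = k := by
  choose r hr using h
  refine ⟨ObjectProperty.homMk
    { app := fun x => ModuleCat.ofHom
        { toFun := r x
          map_add' := fun u u' => m_injective x (by simp only [map_add, hr])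
          map_smul' := fun c u => m_injective x (by simp only [map_smul, hr, RingHom.id_apply]) }
      naturality := fun x y α => ?_ }, ?_⟩
  · ext u
    apply m_injective y
    change m.hom.app y (r y (U.obj.map α u)) = m.hom.app y (V.obj.map α (r x u))
    rw [hr, NatTrans.naturality_apply, NatTrans.naturality_apply, hr]
  · apply ObjectProperty.hom_ext
    ext x u
    exact hr x u

theorem IsExactSeq.comp_eq_zero {A B C : FPi t} {f : A ⟶ B} {g : B ⟶ C} (h : IsExactSeq f g) :
    f.f ≫ g.f = 0 := by
  apply ObjectProperty.hom_ext
  ext x a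
  exact ((h x).2.1 _).2 ⟨a, rfl⟩

theorem IsExactSeq.exists_retraction {A B C : FPi t} {f : A ⟶ B} {g : B ⟶ C}
    (h : IsExactSeq f g) : ∃ ρ : B.V ⟶ A.V, f.f ≫ ρ = 𝟙 A.V := by
  obtain ⟨σ, hσ⟩ := h.exists_lift (𝟙 C.V)
  have g_vanishes : (𝟙 B.V - g.f ≫ σ) ≫ g.f = 0 := by
    rw [Preadditive.sub_comp, Category.assoc, hσ, Category.id_comp, Category.comp_id, sub_self]
  obtain ⟨ρ, hρ⟩ := exists_factor_of_injective (fun x => (h x).1) fun x b =>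
    ((h x).2.1 _).1 (congrArg (fun k : B.V ⟶ C.V => k.hom.app x b) g_vanishes)
  have f_ρ_f : (f.f ≫ ρ) ≫ f.f = f.f := by
    rw [Category.assoc, hρ, Preadditive.comp_sub, reassoc_of% h.comp_eq_zero, zero_comp,
      Category.comp_id, sub_zero]
  refine ⟨ρ, ObjectProperty.hom_ext _ ?_⟩
  ext x a
  exact (h x).1 (congrArg (fun k : A.V ⟶ B.V => k.hom.app x a) f_ρ_f)

/-- The free object on `V`: two copies of `V`, where `d` sends the first one identically to the
second one. -/
noncomputable abbrev free (V : PS1 t) : FPi t where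
  V := V ⊞ V
  d := biprod.desc biprod.inr (t • biprod.inl)
  sq := by apply biprod.hom_ext' <;> simp

/-- The morphism from the free object on `V` given by a morphism `V ⟶ X`. -/
noncomputable def free.desc {V : PS1 t} {X : FPi t} (k : V ⟶ X.V) : free V ⟶ X where
  f := biprod.desc k (k ≫ X.d)
  comm := by apply biprod.hom_ext' <;> simp [X.sq]

/-- The morphism to the free object on `V` given by a morphism `X ⟶ V`. -/
noncomputable def free.lift {V : PS1 t} {X : FPi t} (k : X.V ⟶ V) : X ⟶ free V where
  f := biprod.lift (X.d ≫ k) k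
  comm := by apply biprod.hom_ext <;> simp [biprod.lift_desc, reassoc_of% X.sq]

theorem free.exists_lift_of_isExactSeq (V : PS1 t) {A B C : FPi t} {f : A ⟶ B} {g : B ⟶ C}
    (h : IsExactSeq f g) (q : free V ⟶ C) : ∃ q' : free V ⟶ B, q' ≫ g = q := by
  obtain ⟨k, hk⟩ := h.exists_lift (biprod.inl ≫ q.f : V ⟶ C.V)
  have inl_d : (biprod.inl ≫ (free V).d : V ⟶ V ⊞ V) = biprod.inr := biprod.inl_desc _ _
  refine ⟨free.desc k, hom_ext (biprod.hom_ext' _ _ ?_ ?_)⟩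
  · simp [free.desc, hk]
  · simp only [comp_f, free.desc, biprod.inr_desc_assoc, Category.assoc]
    rw [g.comm, reassoc_of% hk, ← q.comm, reassoc_of% inl_d]

theorem free.exists_extension_of_isExactSeq (V : PS1 t) {A B C : FPi t} {f : A ⟶ B} {g : B ⟶ C}
    (h : IsExactSeq f g) (q : A ⟶ free V) : ∃ q' : B ⟶ free V, f ≫ q' = q := by
  obtain ⟨ρ, hρ⟩ := h.exists_retraction
  have d_snd : ((free V).d ≫ biprod.snd : V ⊞ V ⟶ V) = biprod.fst := by
    apply biprod.hom_ext' <;> simp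
  refine ⟨free.lift (ρ ≫ q.f ≫ biprod.snd), hom_ext (biprod.hom_ext _ _ ?_ ?_)⟩
  · simp only [comp_f, free.lift, Category.assoc, biprod.lift_fst]
    rw [← reassoc_of% f.comm, reassoc_of% hρ, reassoc_of% q.comm, d_snd]
  · simp [free.lift, reassoc_of% hρ]

theorem isProjInj_free (V : PS1 t) : IsProjInj (free V) := fun _ _ _ _ _ h =>
  ⟨free.exists_lift_of_isExactSeq V h, free.exists_extension_of_isExactSeq V h⟩

theorem boundary_snd_comp_inl (V : PS1 t) :
    boundary (free V) (free V) (biprod.snd ≫ biprod.inl : V ⊞ V ⟶ V ⊞ V) = 𝟙 (free V) := by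
  ext : 1
  rw [boundary_f]
  apply biprod.hom_ext' <;> simp

/-- The object `(V, -d)`. It is the kernel of the canonical morphism from the free object on `V`
to `(V, d)`. -/
abbrev negD (X : FPi t) : FPi t := ⟨X.V, -X.d, by simp [X.sq]⟩

theorem isExactSeq_negD_free (X : FPi t) :
    IsExactSeq (free.lift (𝟙 X.V) : X.negD ⟶ free X.V) (free.desc (𝟙 X.V) : free X.V ⟶ X) := by
  refine .of_splitting (r := biprod.snd) (s := biprod.inl) ?_ (biprod.lift_snd _ _)
    (biprod.inl_desc _ _) ?_
  · simp [free.lift, free.desc, biprod.lift_desc]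
  · dsimp only [free.lift, free.desc, negD, free]
    apply biprod.hom_ext' <;> apply biprod.hom_ext <;> simp

theorem IsProjInj.id_mem_range_boundary {Q : FPi t} (hQ : IsProjInj Q) :
    𝟙 Q ∈ (boundary Q Q).range := by
  obtain ⟨q, hq⟩ := (hQ _ _ (isExactSeq_negD_free Q)).1 (𝟙 Q)
  rw [← hq, ← Category.id_comp (free.desc _), ← boundary_snd_comp_inl, boundary_comp,
    comp_boundary]
  exact ⟨_, rfl⟩

theorem stableRel_iff {X Y : FPi t} {f g : X ⟶ Y} :
    stableRel t f g ↔ f - g ∈ (boundary X Y).range := by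
  constructor
  · rintro ⟨Q, hQ, p, q, hpq⟩
    obtain ⟨s, hs⟩ := hQ.id_mem_range_boundary
    rw [hpq, ← Category.id_comp q, ← hs, boundary_comp, comp_boundary]
    exact ⟨_, rfl⟩
  · rintro ⟨s, hs⟩
    refine ⟨free Y.V, isProjInj_free _, free.lift s, free.desc (𝟙 _), ?_⟩
    rw [← hs]
    ext : 1
    simp [free.lift, free.desc, biprod.lift_desc, add_comm]

instance : Congruence (stableRel t) where
  equivalence :=
    { refl := fun f => stableRel_iff.2 (by rw [sub_self]; exact zero_mem _)
      symm := fun h => stableRel_iff.2 (by rw [← neg_sub]; exact neg_mem (stableRel_iff.1 h))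
      trans := fun h h' => stableRel_iff.2 (by
        rw [← sub_add_sub_cancel]; exact add_mem (stableRel_iff.1 h) (stableRel_iff.1 h')) }
  comp_left f _ _ h := by
    obtain ⟨s, hs⟩ := stableRel_iff.1 h
    exact stableRel_iff.2 ⟨_, by rw [← Preadditive.comp_sub, ← hs, comp_boundary]⟩
  comp_right g h := by
    obtain ⟨s, hs⟩ := stableRel_iff.1 h
    exact stableRel_iff.2 ⟨_, by rw [← Preadditive.sub_comp, ← hs, boundary_comp]⟩

theorem stableRel_add_add {X Y : FPi t} (f f' g g' : X ⟶ Y) (h : stableRel t f f')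
    (h' : stableRel t g g') : stableRel t (f + g) (f' + g') := by
  rw [stableRel_iff, add_sub_add_comm]
  exact add_mem (stableRel_iff.1 h) (stableRel_iff.1 h')

instance : Preadditive (Stable t) := Quotient.preadditive _ fun _ _ => stableRel_add_add

instance : (stab t).Additive := Quotient.functor_additive _ fun _ _ => stableRel_add_add

theorem stab_map_eq_zero_iff {X Y : FPi t} {f : X ⟶ Y} :
    (stab t).map f = 0 ↔ ∃ s : X.V ⟶ Y.V, f.f = s ≫ Y.d + X.d ≫ s := by
  rw [← (stab t).map_zero X Y, Quotient.functor_map_eq_iff, stableRel_iff, sub_zero]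
  exact exists_congr fun s => ⟨fun h => by rw [← h, boundary_f], fun h => hom_ext h.symm⟩

end Homotopy

end FPi

/-! ### Morphisms between the representations `P_[x]` -/

namespace PS1

variable {R : Type u} [CommRing R] {t : R}

theorem star_congr {x y : Circ} {α β : ℝ} (e : α = β) {hα : 0 ≤ α} {hβ : 0 ≤ β}
    {h : x + (α : Circ) = y} {h' : x + (β : Circ) = y} : star t α hα h = star t β hβ h' := by
  subst e; rfl

theorem star_comp_star {x y z : Circ} {α β : ℝ} (hα : 0 ≤ α) (hβ : 0 ≤ β)
    (hxy : x + (α : Circ) = y) (hyz : y + (β : Circ) = z) :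
    star t α hα hxy ≫ star t β hβ hyz = star t (α + β) (add_nonneg hα hβ)
      (by rw [AddCircle.coe_add, ← add_assoc, hxy, hyz]) :=
  star_comp t hα hβ hxy hyz _

theorem star_comp_star_assoc {x y z : Circ} {α β : ℝ} (hα : 0 ≤ α) (hβ : 0 ≤ β)
    (hxy : x + (α : Circ) = y) (hyz : y + (β : Circ) = z) {W : PS1 t} (k : P t z ⟶ W) :
    star t α hα hxy ≫ star t β hβ hyz ≫ k = star t (α + β) (add_nonneg hα hβ)
      (by rw [AddCircle.coe_add, ← add_assoc, hxy, hyz]) ≫ k := by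
  rw [← star_comp_star hα hβ hxy hyz, Category.assoc]

theorem star_zero {x : Circ} {α : ℝ} (e : α = 0) (hα : 0 ≤ α) (h : x + (α : Circ) = x) :
    star t α hα h = 𝟙 (P t x) := by
  subst e
  apply ObjectProperty.hom_ext
  ext w
  have turns_eq : turns (dep x w.pt + 0) = 0 :=
    turns_unique (x := x) (z := w.pt) (add_nonneg (dep_nonneg _ _) le_rfl)
      (by rw [add_zero, coe_dep]) (by simp)
  change t ^ turns (dep x w.pt + 0) * 1 = 1
  rw [turns_eq, pow_zero, mul_one]

theorem star_add_two_pi {x y : Circ} {α : ℝ} (hα : 0 ≤ α) (h : x + (α : Circ) = y)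
    (hα' : 0 ≤ α + 2 * Real.pi) (h' : x + ((α + 2 * Real.pi : ℝ) : Circ) = y) :
    star t (α + 2 * Real.pi) hα' h' = t • star t α hα h := by
  have hy : y + ((2 * Real.pi : ℝ) : Circ) = y := by simp
  rw [← star_comp t hα Real.two_pi_pos.le h hy, star_two_pi t _ hy rfl, Linear.comp_smul,
    Category.comp_id]

theorem exists_eq_smul_star {x y : Circ} (k : P t x ⟶ P t y) {α : ℝ} (hα : 0 ≤ α)
    (hα' : α < 2 * Real.pi) (h : x + (α : Circ) = y) : ∃ r : R, k = r • star t α hα h := by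
  have dep_eq_α : dep y x = α := dep_eq hα hα' (by rw [← h]; abel)
  refine ⟨k.hom.app ⟨x⟩ (1 : R), ObjectProperty.hom_ext _ ?_⟩
  ext z
  have map_generator : (P t x).obj.map (RotCirc.short ⟨x⟩ z) (1 : R) = (1 : R) := by
    change t ^ turns (dep x x + (RotCirc.short ⟨x⟩ z).angle) • (1 : R) = 1
    rw [turns_dep_add_angle x (z := ⟨x⟩) (RotCirc.short ⟨x⟩ z) (n := 0) (by simp [RotCirc.short])]
    simp
  have naturality := NatTrans.naturality_apply k.hom (RotCirc.short ⟨x⟩ z) (1 : R)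
  rw [map_generator] at naturality
  change k.hom.app z (1 : R) =
    (show R from k.hom.app ⟨x⟩ (1 : R)) * (t ^ turns (dep x z.pt + α) * 1)
  rw [naturality]
  change t ^ turns (dep y x + dep x z.pt) * _ = _
  rw [dep_eq_α, add_comm α, mul_one, mul_comm]
  rfl

section IsDomain

variable [IsDomain R] (ht : t ≠ 0)
include ht

theorem smul_star_eq_zero {x y : Circ} {α : ℝ} {hα : 0 ≤ α} {h : x + (α : Circ) = y} {r : R}
    (e : r • star t α hα h = 0) : r = 0 := by
  have : r * (t ^ turns (dep x x + α) * 1) = 0 :=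
    congrArg (fun k : P t x ⟶ P t y => k.hom.app ⟨x⟩ (1 : R)) e
  rw [mul_one] at this
  exact (mul_eq_zero.1 this).resolve_right (pow_ne_zero _ ht)

theorem smul_star_inj {x y : Circ} {α : ℝ} {hα : 0 ≤ α} {h : x + (α : Circ) = y} {r s : R}
    (e : r • star t α hα h = s • star t α hα h) : r = s := by
  rw [← sub_eq_zero, ← sub_smul] at e
  exact sub_eq_zero.1 (smul_star_eq_zero ht e)

theorem star_cancel_right {x y z : Circ} {k l : P t x ⟶ P t y} {α : ℝ} {hα : 0 ≤ α}
    {h : y + (α : Circ) = z} (e : k ≫ star t α hα h = l ≫ star t α hα h) : k = l := by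
  obtain ⟨r, hr⟩ := exists_eq_smul_star (k - l) (dep_nonneg y x) (dep_lt y x)
    (by rw [coe_dep]; abel)
  rw [← sub_eq_zero, ← Preadditive.sub_comp, hr, Linear.smul_comp, star_comp_star] at e
  rw [← sub_eq_zero, hr, smul_star_eq_zero ht e, zero_smul]

theorem star_cancel_left {x y z : Circ} {k l : P t y ⟶ P t z} {α : ℝ} {hα : 0 ≤ α}
    {h : x + (α : Circ) = y} (e : star t α hα h ≫ k = star t α hα h ≫ l) : k = l := by
  obtain ⟨r, hr⟩ := exists_eq_smul_star (k - l) (dep_nonneg z y) (dep_lt z y)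
    (by rw [coe_dep]; abel)
  rw [← sub_eq_zero, ← Preadditive.comp_sub, hr, Linear.comp_smul, star_comp_star] at e
  rw [← sub_eq_zero, hr, smul_star_eq_zero ht e, zero_smul]

theorem exists_eq_smul_star_of_comm {x x' y y' : Circ} {a b : ℝ} {ha : 0 ≤ a} {hb : 0 ≤ b}
    {hx : x + (a : Circ) = x'} {hy : y + (b : Circ) = y'} {k : P t x ⟶ P t y}
    {k' : P t x' ⟶ P t y'} (e : star t a ha hx ≫ k' = k ≫ star t b hb hy) :
    ∃ (r : R) (u v : ℝ) (hu : 0 ≤ u) (hv : 0 ≤ v) (h : x + (u : Circ) = y)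
      (h' : x' + (v : Circ) = y'), a + v = u + b ∧ (u < 2 * Real.pi ∨ v < 2 * Real.pi) ∧
      k = r • star t u hu h ∧ k' = r • star t v hv h' := by
  have hdep : x + (dep y x : Circ) = y := by rw [coe_dep]; abel
  have hdep' : x' + (dep y' x' : Circ) = y' := by rw [coe_dep]; abel
  obtain ⟨r, hr⟩ := exists_eq_smul_star k (dep_nonneg y x) (dep_lt y x) hdep
  obtain ⟨r', hr'⟩ := exists_eq_smul_star k' (dep_nonneg y' x') (dep_lt y' x') hdep'
  rcases le_total (dep y x + b) (a + dep y' x') with hle | hle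
  · have h : x + ((a + dep y' x' - b : ℝ) : Circ) = y := by
      rw [AddCircle.coe_sub, AddCircle.coe_add, ← add_sub_assoc, ← add_assoc, hx, hdep', ← hy]
      abel
    refine ⟨r', a + dep y' x' - b, dep y' x', by linarith [dep_nonneg y x], dep_nonneg y' x', h,
      hdep', by ring, .inr (dep_lt _ _), ?_, hr'⟩
    apply star_cancel_right ht
    rw [← e, hr', Linear.comp_smul, Linear.smul_comp, star_comp_star, star_comp_star]
    exact congrArg (r' • ·) (star_congr (by ring))
  · have h : x' + ((dep y x + b - a : ℝ) : Circ) = y' := by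
      rw [AddCircle.coe_sub, AddCircle.coe_add, coe_dep, ← hx, ← hy]
      abel
    refine ⟨r, dep y x, dep y x + b - a, dep_nonneg y x, by linarith [dep_nonneg y' x'], hdep, h,
      by ring, .inl (dep_lt _ _), hr, ?_⟩
    apply star_cancel_left ht
    rw [e, hr, Linear.comp_smul, Linear.smul_comp, star_comp_star, star_comp_star]
    exact congrArg (r • ·) (star_congr (by ring))

end IsDomain

end PS1

namespace FPi

open PS1

namespace E

section

variable {R : Type u} [CommRing R] (t : R) (A : Arc)

/-- The inclusion `P_[x] ⟶ E(x, y)`. It is `biprod.inl`, retyped because `(E t A).V` does not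
unfold to a biproduct at reducible transparency; likewise for `i₁`, `p₀` and `p₁`. -/
noncomputable def i₀ : P t A.start ⟶ (E t A).V :=
  (biprod.inl : P t A.start ⟶ P t A.start ⊞ P t A.finish)

/-- The inclusion `P_[y] ⟶ E(x, y)`. -/
noncomputable def i₁ : P t A.finish ⟶ (E t A).V :=
  (biprod.inr : P t A.finish ⟶ P t A.start ⊞ P t A.finish)

/-- The projection `E(x, y) ⟶ P_[x]`. -/
noncomputable def p₀ : (E t A).V ⟶ P t A.start :=
  (biprod.fst : P t A.start ⊞ P t A.finish ⟶ P t A.start)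

/-- The projection `E(x, y) ⟶ P_[y]`. -/
noncomputable def p₁ : (E t A).V ⟶ P t A.finish :=
  (biprod.snd : P t A.start ⊞ P t A.finish ⟶ P t A.finish)

end

variable {R : Type u} [CommRing R] {t : R} {A : Arc} {W : PS1 t}

@[simp] theorem i₀_p₀ : i₀ t A ≫ p₀ t A = 𝟙 _ := biprod.inl_fst
@[simp] theorem i₀_p₁ : i₀ t A ≫ p₁ t A = 0 := biprod.inl_snd
@[simp] theorem i₁_p₀ : i₁ t A ≫ p₀ t A = 0 := biprod.inr_fst
@[simp] theorem i₁_p₁ : i₁ t A ≫ p₁ t A = 𝟙 _ := biprod.inr_snd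
@[simp] theorem i₀_p₀_assoc (k : P t A.start ⟶ W) : i₀ t A ≫ p₀ t A ≫ k = k :=
  (reassoc_of% i₀_p₀ (t := t) (A := A)) k
@[simp] theorem i₀_p₁_assoc (k : P t A.finish ⟶ W) : i₀ t A ≫ p₁ t A ≫ k = 0 :=
  ((reassoc_of% i₀_p₁ (t := t) (A := A)) k).trans zero_comp
@[simp] theorem i₁_p₀_assoc (k : P t A.start ⟶ W) : i₁ t A ≫ p₀ t A ≫ k = 0 :=
  ((reassoc_of% i₁_p₀ (t := t) (A := A)) k).trans zero_comp
@[simp] theorem i₁_p₁_assoc (k : P t A.finish ⟶ W) : i₁ t A ≫ p₁ t A ≫ k = k :=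
  (reassoc_of% i₁_p₁ (t := t) (A := A)) k

theorem total : p₀ t A ≫ i₀ t A + p₁ t A ≫ i₁ t A = 𝟙 (E t A).V :=
  biprod.total (X := P t A.start) (Y := P t A.finish)

theorem hom_ext' {f g : (E t A).V ⟶ W} (h₀ : i₀ t A ≫ f = i₀ t A ≫ g)
    (h₁ : i₁ t A ≫ f = i₁ t A ≫ g) : f = g := biprod.hom_ext' (f := f) (g := g) h₀ h₁

@[simp] theorem i₀_d : i₀ t A ≫ (E t A).d = star t A.len A.nonneg A.start_add ≫ i₁ t A :=
  biprod.inl_desc _ _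

@[simp] theorem i₁_d : i₁ t A ≫ (E t A).d =
    star t (2 * Real.pi - A.len) (by linarith [A.le]) A.finish_add ≫ i₀ t A :=
  biprod.inr_desc _ _

@[simp] theorem d_p₀ : (E t A).d ≫ p₀ t A =
    p₁ t A ≫ star t (2 * Real.pi - A.len) (by linarith [A.le]) A.finish_add := by
  apply hom_ext'
  · rw [reassoc_of% i₀_d (t := t) (A := A)]; simp
  · rw [reassoc_of% i₁_d (t := t) (A := A)]; simp

@[simp] theorem d_p₁ : (E t A).d ≫ p₁ t A = p₀ t A ≫ star t A.len A.nonneg A.start_add := by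
  apply hom_ext'
  · rw [reassoc_of% i₀_d (t := t) (A := A)]; simp
  · rw [reassoc_of% i₁_d (t := t) (A := A)]; simp

end E

end FPi

/-! ### Diagonal and counter-diagonal morphisms -/

namespace FPi

open PS1 E IndC

section Basic

variable {R : Type u} [CommRing R] {t : R} {A B C : Arc}

theorem diag_finish {u : ℝ} (h : A.start + (u : Circ) = B.start) :
    A.finish + ((u + B.len - A.len : ℝ) : Circ) = B.finish := by
  rw [Arc.finish, Arc.finish, ← h, AddCircle.coe_sub, AddCircle.coe_add]; abel

theorem counterDiag_finish {u : ℝ} (h : A.start + (u : Circ) = B.finish) :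
    A.finish + ((u - B.len + 2 * Real.pi - A.len : ℝ) : Circ) = B.start := by
  have : A.start = B.start + (B.len : Circ) - (u : Circ) := by
    rw [eq_sub_iff_add_eq, h, Arc.finish]
  rw [Arc.finish, this]
  simp only [AddCircle.coe_add, AddCircle.coe_sub, AddCircle.coe_period]; abel

section
variable (r : R) {u : ℝ} (hu : 0 ≤ u) (h : A.start + (u : Circ) = B.start)
  (hv : A.len ≤ u + B.len)

@[simp] theorem i₀_diag : i₀ t A ≫ (diag t r u hu h hv).f = r • star t u hu h ≫ i₀ t B :=
  (biprod.inl_map _ _).trans (Linear.smul_comp _ _ _ _ _ _)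

@[simp] theorem i₁_diag : i₁ t A ≫ (diag t r u hu h hv).f =
    r • star t (u + B.len - A.len) (by linarith) (diag_finish h) ≫ i₁ t B :=
  (biprod.inr_map _ _).trans (Linear.smul_comp _ _ _ _ _ _)

end

section
variable (r : R) {u : ℝ} (hu : 0 ≤ u) (h : A.start + (u : Circ) = B.finish)
  (hv : A.len + B.len ≤ u + 2 * Real.pi)

@[simp] theorem i₀_counterDiag :
    i₀ t A ≫ (counterDiag t r u hu h hv).f = r • star t u hu h ≫ i₁ t B :=
  (biprod.inl_desc _ _).trans (Linear.smul_comp _ _ _ _ _ _)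

@[simp] theorem i₁_counterDiag : i₁ t A ≫ (counterDiag t r u hu h hv).f =
    r • star t (u - B.len + 2 * Real.pi - A.len) (by linarith) (counterDiag_finish h) ≫ i₀ t B :=
  (biprod.inr_desc _ _).trans (Linear.smul_comp _ _ _ _ _ _)

end

theorem diag_congr (r : R) {u u' : ℝ} (e : u = u') {hu : 0 ≤ u}
    {h : A.start + (u : Circ) = B.start} {hv : A.len ≤ u + B.len} {hu' : 0 ≤ u'}
    {h' : A.start + (u' : Circ) = B.start} {hv' : A.len ≤ u' + B.len} :
    diag t r u hu h hv = diag t r u' hu' h' hv' := by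
  subst e; rfl

theorem diag_add (r s : R) {u : ℝ} (hu : 0 ≤ u) (h : A.start + (u : Circ) = B.start)
    (hv : A.len ≤ u + B.len) :
    diag t (r + s) u hu h hv = diag t r u hu h hv + diag t s u hu h hv := by
  apply FPi.hom_ext
  apply hom_ext' <;> simp [add_smul]

theorem counterDiag_add (r s : R) {u : ℝ} (hu : 0 ≤ u) (h : A.start + (u : Circ) = B.finish)
    (hv : A.len + B.len ≤ u + 2 * Real.pi) :
    counterDiag t (r + s) u hu h hv = counterDiag t r u hu h hv + counterDiag t s u hu h hv := by
  apply FPi.hom_ext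
  apply hom_ext' <;> simp [add_smul]

theorem diag_one_zero : diag t 1 0 le_rfl (by simp) (by simp) = 𝟙 (E t A) := by
  refine FPi.hom_ext (hom_ext' ?_ ?_)
  · rw [i₀_diag, star_zero rfl]; simp
  · rw [i₁_diag, star_zero (by ring)]; simp

theorem smul_star_comp_smul_star (r s : R) {x y z : Circ} {α β γ : ℝ} {hα : 0 ≤ α} {hβ : 0 ≤ β}
    {hγ : 0 ≤ γ} {hxy : x + (α : Circ) = y} {hyz : y + (β : Circ) = z} {hxz : x + (γ : Circ) = z}
    (e : α + β = γ) {V W : PS1 t} {i : P t y ⟶ V} {j : P t z ⟶ W} {k : V ⟶ W}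
    (hk : i ≫ k = s • star t β hβ hyz ≫ j) :
    (r • star t α hα hxy ≫ i) ≫ k = (r * s) • star t γ hγ hxz ≫ j := by
  subst e
  rw [Linear.smul_comp, Category.assoc, hk, Linear.comp_smul, star_comp_star_assoc, smul_smul]

theorem diag_comp_diag (r s : R) {u v w : ℝ} {hu : 0 ≤ u} {h : A.start + (u : Circ) = B.start}
    {hu' : A.len ≤ u + B.len} {hv : 0 ≤ v} {h' : B.start + (v : Circ) = C.start}
    {hv' : B.len ≤ v + C.len} {hw : 0 ≤ w} {h'' : A.start + (w : Circ) = C.start}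
    {hw' : A.len ≤ w + C.len} (e : u + v = w) :
    diag t r u hu h hu' ≫ diag t s v hv h' hv' = diag t (r * s) w hw h'' hw' := by
  refine FPi.hom_ext (hom_ext' ?_ ?_)
  · rw [comp_f, ← Category.assoc, i₀_diag, i₀_diag]
    exact smul_star_comp_smul_star r s e (i₀_diag _ _ _ _)
  · rw [comp_f, ← Category.assoc, i₁_diag, i₁_diag]
    exact smul_star_comp_smul_star r s (by rw [← e]; ring) (i₁_diag _ _ _ _)

theorem diag_comp_counterDiag (r s : R) {u v w : ℝ} {hu : 0 ≤ u}
    {h : A.start + (u : Circ) = B.start} {hu' : A.len ≤ u + B.len} {hv : 0 ≤ v}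
    {h' : B.start + (v : Circ) = C.finish} {hv' : B.len + C.len ≤ v + 2 * Real.pi} {hw : 0 ≤ w}
    {h'' : A.start + (w : Circ) = C.finish} {hw' : A.len + C.len ≤ w + 2 * Real.pi}
    (e : u + v = w) :
    diag t r u hu h hu' ≫ counterDiag t s v hv h' hv' = counterDiag t (r * s) w hw h'' hw' := by
  refine FPi.hom_ext (hom_ext' ?_ ?_)
  · rw [comp_f, ← Category.assoc, i₀_diag, i₀_counterDiag]
    exact smul_star_comp_smul_star r s e (i₀_counterDiag _ _ _ _)
  · rw [comp_f, ← Category.assoc, i₁_diag, i₁_counterDiag]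
    exact smul_star_comp_smul_star r s (by rw [← e]; ring) (i₁_counterDiag _ _ _ _)

theorem counterDiag_comp_diag (r s : R) {u v w : ℝ} {hu : 0 ≤ u}
    {h : A.start + (u : Circ) = B.finish} {hu' : A.len + B.len ≤ u + 2 * Real.pi} {hv : 0 ≤ v}
    {h' : B.start + (v : Circ) = C.start} {hv' : B.len ≤ v + C.len} {hw : 0 ≤ w}
    {h'' : A.start + (w : Circ) = C.finish} {hw' : A.len + C.len ≤ w + 2 * Real.pi}
    (e : u + (v + C.len - B.len) = w) :
    counterDiag t r u hu h hu' ≫ diag t s v hv h' hv' = counterDiag t (r * s) w hw h'' hw' := by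
  refine FPi.hom_ext (hom_ext' ?_ ?_)
  · rw [comp_f, ← Category.assoc, i₀_counterDiag, i₀_counterDiag]
    exact smul_star_comp_smul_star r s e (i₁_diag _ _ _ _)
  · rw [comp_f, ← Category.assoc, i₁_counterDiag, i₁_counterDiag]
    exact smul_star_comp_smul_star r s (by rw [← e]; ring) (i₀_diag _ _ _ _)

theorem counterDiag_comp_counterDiag (r s : R) {u v w : ℝ} {hu : 0 ≤ u}
    {h : A.start + (u : Circ) = B.finish} {hu' : A.len + B.len ≤ u + 2 * Real.pi} {hv : 0 ≤ v}
    {h' : B.start + (v : Circ) = C.finish} {hv' : B.len + C.len ≤ v + 2 * Real.pi} {hw : 0 ≤ w}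
    {h'' : A.start + (w : Circ) = C.start} {hw' : A.len ≤ w + C.len}
    (e : u + (v - C.len + 2 * Real.pi - B.len) = w) :
    counterDiag t r u hu h hu' ≫ counterDiag t s v hv h' hv' = diag t (r * s) w hw h'' hw' := by
  refine FPi.hom_ext (hom_ext' ?_ ?_)
  · rw [comp_f, ← Category.assoc, i₀_counterDiag, i₀_diag]
    exact smul_star_comp_smul_star r s e (i₁_counterDiag _ _ _ _)
  · rw [comp_f, ← Category.assoc, i₁_counterDiag, i₁_diag]
    exact smul_star_comp_smul_star r s (by rw [← e]; ring) (i₀_counterDiag _ _ _ _)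

theorem stab_map_diag_eq_zero_of_len_le (r : R) {u : ℝ} (hu : 0 ≤ u)
    (h : A.start + (u : Circ) = B.start) (hv : A.len ≤ u + B.len) (hA : A.len ≤ u) :
    (stab t).map (diag t r u hu h hv) = 0 := by
  have h' : A.finish + ((u - A.len : ℝ) : Circ) = B.start := by
    rw [Arc.finish, ← h, AddCircle.coe_sub]; abel
  refine stab_map_eq_zero_iff.2
    ⟨p₁ t A ≫ (r • star t (u - A.len) (by linarith) h') ≫ i₀ t B, hom_ext' ?_ ?_⟩
  · simp only [i₀_diag, Preadditive.comp_add, Category.assoc, i₀_p₁_assoc, zero_add]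
    rw [reassoc_of% i₀_d (t := t) (A := A), i₁_p₁_assoc, Linear.smul_comp, Linear.comp_smul,
      star_comp_star_assoc]
    exact congrArg (r • · ≫ i₀ t B) (star_congr (by ring))
  · simp only [i₁_diag, Preadditive.comp_add, Category.assoc, i₁_p₁_assoc, Linear.smul_comp, i₀_d]
    rw [reassoc_of% i₁_d (t := t) (A := A), i₀_p₁_assoc, comp_zero, star_comp_star_assoc]
    refine Eq.trans ?_ (add_zero _).symm
    exact congrArg (r • · ≫ i₁ t B) (star_congr (by ring))

theorem stab_map_diag_eq_zero_of_le_add_len (r : R) {u : ℝ} (hu : 0 ≤ u)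
    (h : A.start + (u : Circ) = B.start) (hv : A.len ≤ u + B.len)
    (hB : 2 * Real.pi ≤ u + B.len) : (stab t).map (diag t r u hu h hv) = 0 := by
  have h' : A.start + ((u + B.len - 2 * Real.pi : ℝ) : Circ) = B.finish := by
    rw [Arc.finish, ← h, AddCircle.coe_sub, AddCircle.coe_add, AddCircle.coe_period]; abel
  refine stab_map_eq_zero_iff.2
    ⟨p₀ t A ≫ (r • star t (u + B.len - 2 * Real.pi) (by linarith) h') ≫ i₁ t B, hom_ext' ?_ ?_⟩
  · simp only [i₀_diag, Preadditive.comp_add, Category.assoc, i₀_p₀_assoc, Linear.smul_comp, i₁_d]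
    rw [reassoc_of% i₀_d (t := t) (A := A), i₁_p₀_assoc, comp_zero, add_zero,
      star_comp_star_assoc]
    exact congrArg (r • · ≫ i₀ t B) (star_congr (by ring))
  · simp only [i₁_diag, Preadditive.comp_add, Category.assoc, i₁_p₀_assoc, zero_add]
    rw [reassoc_of% i₁_d (t := t) (A := A), i₀_p₀_assoc, Linear.smul_comp, Linear.comp_smul,
      star_comp_star_assoc]
    exact congrArg (r • · ≫ i₁ t B) (star_congr (by ring))

theorem diag_mul_eq_diag_add_two_pi (r : R) {u : ℝ} (hu : 0 ≤ u)
    (h : A.start + (u : Circ) = B.start) (hv : A.len ≤ u + B.len) :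
    diag t (r * t) u hu h hv = diag t r (u + 2 * Real.pi) (by positivity)
      (by rw [AddCircle.coe_add, AddCircle.coe_period, add_zero, h])
      (by linarith [Real.two_pi_pos]) := by
  refine FPi.hom_ext (hom_ext' ?_ ?_)
  · rw [i₀_diag, i₀_diag, star_add_two_pi hu h, Linear.smul_comp, smul_smul]
  · rw [i₁_diag, i₁_diag, star_congr (show u + 2 * Real.pi + B.len - A.len =
      u + B.len - A.len + 2 * Real.pi by ring)
      (hβ := by linarith [Real.two_pi_pos])
      (h' := by rw [AddCircle.coe_add, AddCircle.coe_period, add_zero, diag_finish h]),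
      star_add_two_pi (by linarith) (diag_finish h), Linear.smul_comp, smul_smul]

theorem stab_map_diag_mul_eq_zero (r : R) {u : ℝ} (hu : 0 ≤ u)
    (h : A.start + (u : Circ) = B.start) (hv : A.len ≤ u + B.len) :
    (stab t).map (diag t (r * t) u hu h hv) = 0 := by
  rw [diag_mul_eq_diag_add_two_pi]
  exact stab_map_diag_eq_zero_of_len_le _ _ _ _ (by linarith [A.le])

theorem dvd_of_stab_map_diag_eq_zero [IsDomain R] (ht : t ≠ 0) {r : R} {u : ℝ} {hu : 0 ≤ u}
    {h : A.start + (u : Circ) = B.start} {hv : A.len ≤ u + B.len} (hA : u < A.len)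
    (hB : u + B.len < 2 * Real.pi) (hr : (stab t).map (diag t r u hu h hv) = 0) : t ∣ r := by
  obtain ⟨s, hs⟩ := stab_map_eq_zero_iff.1 hr
  have h01 : A.start + ((u + B.len : ℝ) : Circ) = B.finish := by
    rw [Arc.finish, ← h, AddCircle.coe_add]; abel
  have h10 : A.finish + ((u + 2 * Real.pi - A.len : ℝ) : Circ) = B.start := by
    rw [Arc.finish, ← h]
    simp only [AddCircle.coe_sub, AddCircle.coe_add, AddCircle.coe_period]; abel
  have h00 : A.start + ((u + 2 * Real.pi : ℝ) : Circ) = B.start := by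
    rw [AddCircle.coe_add, AddCircle.coe_period, add_zero, h]
  obtain ⟨k, hk⟩ := exists_eq_smul_star (i₀ t A ≫ s ≫ p₁ t B) (by linarith [B.nonneg]) hB h01
  obtain ⟨l, hl⟩ := exists_eq_smul_star (i₁ t A ≫ s ≫ p₀ t B) (by linarith [A.le]) (by linarith) h10
  have e := congrArg (fun k => i₀ t A ≫ k ≫ p₀ t B) hs
  simp only [Preadditive.comp_add, Preadditive.add_comp, Category.assoc, d_p₀] at e
  rw [reassoc_of% i₀_diag r hu h hv, Linear.smul_comp, Category.assoc, i₀_p₀, Category.comp_id,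
    reassoc_of% i₀_d (t := t) (A := A), hl, ← Category.assoc s, ← Category.assoc, hk,
    Linear.smul_comp, Linear.comp_smul, star_comp_star, star_comp_star,
    star_congr (show u + B.len + (2 * Real.pi - B.len) = u + 2 * Real.pi by ring)
      (hβ := by linarith) (h' := h00),
    star_congr (show A.len + (u + 2 * Real.pi - A.len) = u + 2 * Real.pi by ring)
      (hβ := by linarith) (h' := h00), star_add_two_pi hu h, ← add_smul, smul_smul] at e
  exact ⟨k + l, (smul_star_inj ht e).trans (mul_comm _ _)⟩

/- Each matrix entry of `f` is a multiple of a `star`; since `f` commutes with `d`, the two diagonal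
entries share a coefficient, and so do the two counter-diagonal ones. -/
theorem exists_eq_diag_add_counterDiag [IsDomain R] (ht : t ≠ 0) (f : E t A ⟶ E t B) :
    ∃ (r : R) (u : ℝ) (hu : 0 ≤ u) (h : A.start + (u : Circ) = B.start) (hv : A.len ≤ u + B.len)
      (r' : R) (u' : ℝ) (hu' : 0 ≤ u') (h' : A.start + (u' : Circ) = B.finish)
      (hv' : A.len + B.len ≤ u' + 2 * Real.pi),
      (u < 2 * Real.pi ∨ u + B.len - A.len < 2 * Real.pi) ∧
      (u' < 2 * Real.pi ∨ u' - B.len + 2 * Real.pi - A.len < 2 * Real.pi) ∧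
      f = diag t r u hu h hv + counterDiag t r' u' hu' h' hv' := by
  have comm_diag := congrArg (fun k => i₀ t A ≫ k ≫ p₁ t B) f.comm
  have comm_counter := congrArg (fun k => i₀ t A ≫ k ≫ p₀ t B) f.comm
  simp only [Category.assoc, d_p₁, d_p₀] at comm_diag comm_counter
  rw [reassoc_of% i₀_d (t := t) (A := A), ← Category.assoc f.f, ← Category.assoc (i₀ t A)]
    at comm_diag comm_counter
  obtain ⟨r, u, v, hu, hv, h, k, e, hb, h₀₀, h₁₁⟩ := exists_eq_smul_star_of_comm ht comm_diag
  obtain ⟨r', u', v', hu', hv', h', k', e', hb', h₀₁, h₁₀⟩ :=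
    exists_eq_smul_star_of_comm ht comm_counter
  obtain rfl : v = u + B.len - A.len := by linarith
  obtain rfl : v' = u' - B.len + 2 * Real.pi - A.len := by linarith
  refine ⟨r, u, hu, h, by linarith, r', u', hu', h', by linarith, hb, hb', ?_⟩
  have f_eq : f.f = (f.f ≫ p₀ t B) ≫ i₀ t B + (f.f ≫ p₁ t B) ≫ i₁ t B := by
    rw [Category.assoc, Category.assoc, ← Preadditive.comp_add, E.total, Category.comp_id]
  refine FPi.hom_ext (hom_ext' ?_ ?_)
  · rw [f_eq, Preadditive.comp_add, ← Category.assoc, h₀₀, ← Category.assoc, h₀₁]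
    simp
  · rw [f_eq, Preadditive.comp_add, ← Category.assoc, h₁₀, ← Category.assoc, h₁₁, add_f,
      Preadditive.comp_add, i₁_diag, i₁_counterDiag, Linear.smul_comp, Linear.smul_comp]
    exact add_comm _ _

end Basic

end FPi

namespace IndC

variable {K : Type*} {X Y : IndC K}

theorem swap_arc_len (X : IndC K) : X.swap.arc.len = 2 * Real.pi - X.arc.len := by
  linarith [X.arc_len_add]

theorem swap_arc_start (X : IndC K) : X.swap.arc.start = X.arc.finish := X.arc_finish.symm

theorem start_add_dep (X Y : IndC K) : X.arc.start + (dep Y.fst X.fst : Circ) = Y.arc.start := by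
  rw [coe_dep]; simp [arc]

theorem Linked.dep_lt_len (h : Linked X Y) : dep Y.fst X.fst < X.arc.len := by
  obtain ⟨x₀, x₁, y₀, y₁, hx₀, hx₁, hy₀, _, h1, h2, h3, h4⟩ := h
  have len_eq : X.arc.len = x₁ - x₀ :=
    dep_eq (by linarith) (by linarith) (by rw [AddCircle.coe_sub, hx₀, hx₁])
  have dep_eq : dep Y.fst X.fst = y₀ - x₀ :=
    dep_eq (by linarith) (by linarith) (by rw [AddCircle.coe_sub, hy₀, hx₀])
  linarith

theorem Linked.dep_add_len_lt (h : Linked X Y) :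
    dep Y.fst X.fst + Y.arc.len < 2 * Real.pi := by
  obtain ⟨x₀, x₁, y₀, y₁, hx₀, _, hy₀, hy₁, h1, h2, h3, h4⟩ := h
  have len_eq : Y.arc.len = y₁ - y₀ :=
    dep_eq (by linarith) (by linarith) (by rw [AddCircle.coe_sub, hy₀, hy₁])
  have dep_eq : dep Y.fst X.fst = y₀ - x₀ :=
    dep_eq (by linarith) (by linarith) (by rw [AddCircle.coe_sub, hy₀, hx₀])
  linarith

theorem linked_of_lt {u : ℝ} (hu : 0 ≤ u) (h : X.arc.start + (u : Circ) = Y.arc.start)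
    (hv : X.arc.len ≤ u + Y.arc.len) (hX : u < X.arc.len) (hY : u + Y.arc.len < 2 * Real.pi) :
    Linked X Y := by
  obtain ⟨x, hx⟩ : ∃ x : ℝ, (x : Circ) = X.fst := ⟨_, AddCircle.coe_equivIco (a := 0)⟩
  refine ⟨x, x + X.arc.len, x + u, x + u + Y.arc.len, hx, ?_, ?_, ?_, by linarith, by linarith,
    by linarith, by linarith⟩
  · rw [AddCircle.coe_add, hx, ← X.arc_finish]; rfl
  · rw [AddCircle.coe_add, hx]; exact h
  · rw [AddCircle.coe_add, AddCircle.coe_add, hx, ← Y.arc_finish, Arc.finish, ← h]; rfl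

theorem CounterLinked.not_linked (h : CounterLinked X Y) : ¬ Linked X Y :=
  fun h' => not_linked_and_counter h' (counterLinked_iff.1 h)

theorem sgn_eq_one_iff : sgn X Y = 1 ↔ Linked X Y := sgn_eq_iff (s := 1) (by decide)

theorem sgn_eq_neg_one_iff : sgn X Y = -1 ↔ CounterLinked X Y := by
  rw [counterLinked_iff, sgn_eq_iff (s := -1) (by decide)]
  simp [orient]

theorem sgn_swap_right (X Y : IndC K) : sgn X Y.swap = -sgn X Y := by
  classical
  have linked_iff : Linked X Y ↔ CounterLinked X Y.swap :=
    (counterLinked_iff (X := X) (Y := Y.swap)).symm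
  simp only [sgn, counterLinked_iff (Y := Y), ← linked_iff]
  by_cases h : Linked X Y
  · simp [h, (linked_iff.1 h).not_linked]
  · split_ifs <;> rfl

theorem sgn_swap_left (X Y : IndC K) : sgn X.swap Y = -sgn X Y := by
  classical
  have linked_iff : Linked X.swap Y ↔ Linked X Y.swap := linked_swap_iff (X := X) (Y := Y.swap)
  have counterLinked_iff' : CounterLinked X.swap Y ↔ CounterLinked X Y.swap := by
    rw [counterLinked_iff, counterLinked_iff, linked_swap_iff]
    rfl
  rw [← sgn_swap_right]
  simp only [sgn, linked_iff, counterLinked_iff']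

end IndC

namespace FPi

open PS1 E IndC

section Basic

variable {R : Type u} [CommRing R] {t : R} {K : Type*} {X Y Z : IndC K}

variable (t X) in
/-- The isomorphism `E(y, x + 2π) ⟶ E(x, y)` that exchanges the two summands. It reduces
counter-diagonal morphisms to diagonal ones. -/
noncomputable def swapHom : E t X.swap.arc ⟶ E t X.arc :=
  counterDiag t 1 0 le_rfl (by rw [X.swap_arc_start, AddCircle.coe_zero, add_zero])
    (by rw [swap_arc_len]; linarith)

theorem swapHom_swap_comp_swapHom : swapHom t X.swap ≫ swapHom t X = 𝟙 (E t X.arc) := by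
  rw [← diag_one_zero, swapHom, swapHom, counterDiag_comp_counterDiag 1 1 (w := 0)
    (by rw [swap_arc_len]; ring) (hw := le_rfl) (h'' := by rw [AddCircle.coe_zero, add_zero]; rfl)
    (hw' := by rw [zero_add]; rfl), mul_one]
  rfl

theorem counterDiag_eq_diag_comp_swapHom (r : R) {u : ℝ} (hu : 0 ≤ u)
    (h : X.arc.start + (u : Circ) = Y.arc.finish) (hv : X.arc.len + Y.arc.len ≤ u + 2 * Real.pi) :
    counterDiag t r u hu h hv =
      diag t r u hu (h.trans Y.swap_arc_start.symm) (by rw [swap_arc_len]; linarith) ≫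
        swapHom t Y := by
  rw [swapHom, diag_comp_counterDiag (w := u) r 1 (add_zero u) (hw := hu) (h'' := h) (hw' := hv),
    mul_one]

theorem basic_of_linked (hl : Linked X Y) (r : R) {u : ℝ} (hu : 0 ≤ u)
    (h : X.arc.start + (u : Circ) = Y.arc.start) (hv : X.arc.len ≤ u + Y.arc.len)
    (hb : u < 2 * Real.pi ∨ u + Y.arc.len - X.arc.len < 2 * Real.pi) :
    basic t r X Y = diag t r u hu h hv := by
  rw [basic, dif_pos hl]
  apply diag_congr
  refine Circ.eq_of_close (add_left_cancel (a := X.arc.start) ?_) ?_ ?_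
  · rw [start_add_dep, h]
  · linarith [dep_lt Y.fst X.fst]
  · have dep_nonneg := dep_nonneg Y.fst X.fst
    have len_le := hl.arc_len_le
    rcases hb with hb | hb <;> linarith

theorem basic_of_counterLinked (hl : CounterLinked X Y) (r : R) :
    basic t r X Y = basic t r X Y.swap ≫ swapHom t Y := by
  rw [basic, dif_neg hl.not_linked, dif_pos hl, basic, dif_pos (counterLinked_iff.1 hl),
    counterDiag_eq_diag_comp_swapHom]
  rfl

theorem basic_of_sgn_eq_zero (h : sgn X Y = 0) (r : R) : basic t r X Y = 0 := by
  rw [basic, dif_neg fun hl => by simp [sgn_eq_one_iff.2 hl] at h,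
    dif_neg fun hl => by simp [sgn_eq_neg_one_iff.2 hl] at h]

theorem basic_eq_basic_swap_comp_swapHom (r : R) :
    basic t r X Y = basic t r X Y.swap ≫ swapHom t Y := by
  by_cases hl' : CounterLinked X Y
  · exact basic_of_counterLinked hl' r
  by_cases hl : Linked X Y
  · have basic_swap : basic t r X Y.swap = basic t r X Y ≫ swapHom t Y.swap :=
      basic_of_counterLinked (counterLinked_iff.2 hl) r
    rw [basic_swap]
    exact (Category.comp_id _).symm.trans
      ((congrArg _ swapHom_swap_comp_swapHom.symm).trans (Category.assoc _ _ _).symm)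
  have sgn_eq : sgn X Y = 0 := by simp [sgn, hl, hl']
  rw [basic_of_sgn_eq_zero sgn_eq, basic_of_sgn_eq_zero (by rw [sgn_swap_right, sgn_eq, neg_zero]),
    zero_comp]

theorem swapHom_comp_basic_of_linked (hl : Linked X Y) (r : R) :
    swapHom t X ≫ basic t r X Y = basic t r X.swap Y.swap ≫ swapHom t Y := by
  have start_add : X.swap.arc.start + ((dep Y.fst X.fst + Y.arc.len - X.arc.len : ℝ) : Circ) =
      Y.arc.finish := by
    rw [swap_arc_start, diag_finish (start_add_dep X Y)]
  rw [basic, dif_pos hl, swapHom, counterDiag_comp_diag 1 r (zero_add _)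
    (hw := by linarith [hl.arc_len_le]) (h'' := start_add) (hw' := by
      rw [swap_arc_len]; linarith [dep_nonneg Y.fst X.fst]), one_mul,
    basic_of_linked (linked_swap_iff.2 hl) r (by linarith [hl.arc_len_le])
      (start_add.trans Y.swap_arc_start.symm)
      (by rw [swap_arc_len, swap_arc_len]; linarith [dep_nonneg Y.fst X.fst])
      (.inr (by rw [swap_arc_len, swap_arc_len]; linarith [dep_lt Y.fst X.fst])),
    counterDiag_eq_diag_comp_swapHom]

theorem swapHom_comp_basic (r : R) :
    swapHom t X ≫ basic t r X Y = basic t r X.swap Y := by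
  by_cases hl : Linked X Y
  · rw [swapHom_comp_basic_of_linked hl, ← basic_eq_basic_swap_comp_swapHom]
  by_cases hl' : CounterLinked X Y
  · rw [basic_eq_basic_swap_comp_swapHom, ← Category.assoc,
      swapHom_comp_basic_of_linked (counterLinked_iff.1 hl'), ← basic_eq_basic_swap_comp_swapHom,
      ← basic_eq_basic_swap_comp_swapHom]
  have sgn_eq : sgn X Y = 0 := by simp [sgn, hl, hl']
  rw [basic_of_sgn_eq_zero sgn_eq, basic_of_sgn_eq_zero (by rw [sgn_swap_left, sgn_eq, neg_zero]),
    comp_zero]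

theorem basic_add (r s : R) : basic t (r + s) X Y = basic t r X Y + basic t s X Y := by
  unfold basic
  split_ifs
  · exact diag_add _ _ _ _ _
  · exact counterDiag_add _ _ _ _ _
  · simp

theorem basic_zero : basic t 0 X Y = 0 := by
  simpa using basic_add (t := t) (X := X) (Y := Y) 0 0

theorem basic_sub (r s : R) : basic t (r - s) X Y = basic t r X Y - basic t s X Y := by
  rw [eq_sub_iff_add_eq, ← basic_add, sub_add_cancel]

theorem basic_one : basic t 1 X X = 𝟙 (E t X.arc) := by
  rw [← diag_one_zero]
  exact basic_of_linked (Linked.refl X) 1 le_rfl _ _ (.inl Real.two_pi_pos)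

theorem stab_map_diag_eq_zero_of_not_linked (hl : ¬ Linked X Y) (r : R) {u : ℝ} (hu : 0 ≤ u)
    (h : X.arc.start + (u : Circ) = Y.arc.start) (hv : X.arc.len ≤ u + Y.arc.len) :
    (stab t).map (diag t r u hu h hv) = 0 := by
  by_cases hX : X.arc.len ≤ u
  · exact stab_map_diag_eq_zero_of_len_le r hu h hv hX
  by_cases hY : 2 * Real.pi ≤ u + Y.arc.len
  · exact stab_map_diag_eq_zero_of_le_add_len r hu h hv hY
  exact absurd (linked_of_lt hu h hv (not_le.1 hX) (not_le.1 hY)) hl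

theorem stab_map_diag (r : R) {u : ℝ} (hu : 0 ≤ u)
    (h : X.arc.start + (u : Circ) = Y.arc.start) (hv : X.arc.len ≤ u + Y.arc.len)
    (hb : u < 2 * Real.pi ∨ u + Y.arc.len - X.arc.len < 2 * Real.pi) :
    (stab t).map (diag t r u hu h hv) =
      (stab t).map (basic t (if sgn X Y = 1 then r else 0) X Y) := by
  split_ifs with hl
  · rw [basic_of_linked (sgn_eq_one_iff.1 hl) r hu h hv hb]
  · rw [stab_map_diag_eq_zero_of_not_linked fun hl' => hl (sgn_eq_one_iff.2 hl'), basic_zero,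
      Functor.map_zero]

theorem stab_map_basic_mul_eq_zero (r : R) : (stab t).map (basic t (r * t) X Y) = 0 := by
  unfold basic
  split_ifs
  · exact stab_map_diag_mul_eq_zero _ _ _ _
  · rw [counterDiag_eq_diag_comp_swapHom, Functor.map_comp, stab_map_diag_mul_eq_zero, zero_comp]
  · exact Functor.map_zero _ _ _

theorem dvd_of_stab_map_basic_eq_zero [IsDomain R] (ht : t ≠ 0) {r : R} (h : sgn X Y ≠ 0)
    (hr : (stab t).map (basic t r X Y) = 0) : t ∣ r := by
  have dvd_of_linked {Y : IndC K} (hl : Linked X Y) (hr : (stab t).map (basic t r X Y) = 0) :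
      t ∣ r := by
    rw [basic, dif_pos hl] at hr
    exact dvd_of_stab_map_diag_eq_zero ht hl.dep_lt_len hl.dep_add_len_lt hr
  by_cases hl : Linked X Y
  · exact dvd_of_linked hl hr
  have hl' : CounterLinked X Y := by
    by_contra hl'
    exact h (by simp [sgn, hl, hl'])
  have basic_swap : basic t r X Y.swap = basic t r X Y ≫ swapHom t Y.swap :=
    basic_eq_basic_swap_comp_swapHom r
  exact dvd_of_linked (counterLinked_iff.1 hl') <| (congrArg _ basic_swap).trans <|
    ((stab t).map_comp _ _).trans <| (congrArg (· ≫ _) hr).trans zero_comp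

theorem exists_stab_map_basic_eq [IsDomain R] (ht : t ≠ 0) (f : E t X.arc ⟶ E t Y.arc) :
    ∃ r : R, (stab t).map (basic t r X Y) = (stab t).map f := by
  obtain ⟨r, u, hu, h, hv, r', u', hu', h', hv', hb, hb', rfl⟩ :=
    exists_eq_diag_add_counterDiag ht f
  rw [Functor.map_add, counterDiag_eq_diag_comp_swapHom, Functor.map_comp,
    stab_map_diag r hu h hv hb, stab_map_diag r' hu' _ _ (hb'.imp_right fun hb' => by
      rw [swap_arc_len]; linarith)]
  by_cases hl : CounterLinked X Y
  · refine ⟨r', ?_⟩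
    rw [if_neg (mt sgn_eq_one_iff.1 hl.not_linked),
      if_pos (sgn_eq_one_iff.2 (counterLinked_iff.1 hl)), basic_zero, Functor.map_zero, zero_add,
      basic_eq_basic_swap_comp_swapHom, Functor.map_comp]
  · refine ⟨if sgn X Y = 1 then r else 0, ?_⟩
    rw [if_neg (mt sgn_eq_one_iff.1 (mt counterLinked_iff.2 hl)), basic_zero, Functor.map_zero,
      zero_comp, add_zero]

theorem stab_map_basic_comp_basic_of_linked (hXY : Linked X Y) (hYZ : Linked Y Z) (r s : R) :
    (stab t).map (basic t r X Y ≫ basic t s Y Z) =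
      (stab t).map (basic t (if sgn X Z = 1 then r * s else 0) X Z) := by
  have := dep_nonneg Y.fst X.fst
  have := dep_nonneg Z.fst Y.fst
  rw [basic, dif_pos hXY, basic, dif_pos hYZ,
    diag_comp_diag r s (w := dep Y.fst X.fst + dep Z.fst Y.fst) rfl (hw := by linarith)
      (h'' := by rw [AddCircle.coe_add, ← add_assoc, start_add_dep, start_add_dep])
      (hw' := by linarith [hXY.arc_len_le, hYZ.arc_len_le])]
  exact stab_map_diag _ _ _ _ (.inl (by linarith [hXY.dep_add_len_lt, hYZ.dep_lt_len]))

theorem stab_map_basic_comp_basic (r s : R) :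
    (stab t).map (basic t r X Y ≫ basic t s Y Z) =
      (stab t).map (basic t (if sgn X Y * sgn Y Z = sgn X Z then r * s else 0) X Z) := by
  wlog hXY : sgn X Y ≠ -1 generalizing Y
  · have := this (Y := Y.swap) (by rw [sgn_swap_right, not_not.1 hXY]; decide)
    rwa [← swapHom_comp_basic, ← Category.assoc, ← basic_eq_basic_swap_comp_swapHom,
      sgn_swap_right, sgn_swap_left, neg_mul_neg] at this
  wlog hYZ : sgn Y Z ≠ -1 generalizing Z
  · have := congrArg (· ≫ (stab t).map (swapHom t Z))
      (this (Z := Z.swap) (by rw [sgn_swap_right, not_not.1 hYZ]; decide))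
    simpa only [← Functor.map_comp, Category.assoc, ← basic_eq_basic_swap_comp_swapHom,
      sgn_swap_right, mul_neg, neg_inj] using this
  by_cases hXY' : sgn X Y = 1
  · by_cases hYZ' : sgn Y Z = 1
    · rw [stab_map_basic_comp_basic_of_linked (sgn_eq_one_iff.1 hXY') (sgn_eq_one_iff.1 hYZ'), hXY',
        hYZ', one_mul]
      simp only [eq_comm]
    · have sgn_eq : sgn Y Z = 0 := by revert hYZ hYZ'; cases sgn Y Z <;> decide
      rw [basic_of_sgn_eq_zero sgn_eq, comp_zero, sgn_eq, mul_zero]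
      split_ifs with h
      · rw [basic_of_sgn_eq_zero h.symm]
      · rw [basic_zero]
  · have sgn_eq : sgn X Y = 0 := by revert hXY hXY'; cases sgn X Y <;> decide
    rw [basic_of_sgn_eq_zero sgn_eq, zero_comp, sgn_eq, zero_mul]
    split_ifs with h
    · rw [basic_of_sgn_eq_zero h.symm]
    · rw [basic_zero]

end Basic

end FPi

/-! ### The embedding of `C_π` into the stable category -/

namespace FPi

open IsLocalRing

section Summands

variable {R : Type u} [CommRing R] [IsLocalRing R] {t : R} {X Y : CPi (ResidueField R)}

namespace ofCPi

variable (t X) in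
/-- The inclusion of a summand `E(x, y)` into the object of `F_π` corresponding to `X`. -/
noncomputable def ι (i : X.ι) : E t (X.X i).arc ⟶ ofCPi t X :=
  biproduct.ι (fun i => E t (X.X i).arc) i

variable (t X) in
/-- The projection onto a summand `E(x, y)` of the object of `F_π` corresponding to `X`. -/
noncomputable def π (i : X.ι) : ofCPi t X ⟶ E t (X.X i).arc :=
  biproduct.π (fun i => E t (X.X i).arc) i

theorem ι_π_self (i : X.ι) : ι t X i ≫ π t X i = 𝟙 _ := biproduct.ι_π_self _ i

theorem ι_π_of_ne {i j : X.ι} (h : i ≠ j) : ι t X i ≫ π t X j = 0 := biproduct.ι_π_ne _ h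

variable (t X) in
theorem sum_π_ι : ∑ i, π t X i ≫ ι t X i = 𝟙 (ofCPi t X) := biproduct.total

theorem stab_map_ext {f g : ofCPi t X ⟶ ofCPi t Y}
    (h : ∀ i j, (stab t).map (ι t X i ≫ f ≫ π t Y j) = (stab t).map (ι t X i ≫ g ≫ π t Y j)) :
    (stab t).map f = (stab t).map g := by
  have expand (k : ofCPi t X ⟶ ofCPi t Y) :
      k = ∑ i, ∑ j, π t X i ≫ (ι t X i ≫ k ≫ π t Y j) ≫ ι t Y j := by
    conv_lhs => rw [← Category.comp_id k, ← Category.id_comp k, ← sum_π_ι t X, ← sum_π_ι t Y]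
    simp only [Preadditive.comp_sum, Preadditive.sum_comp, Category.assoc]
    exact Finset.sum_comm
  rw [expand f, expand g]
  simp only [Functor.map_sum, Functor.map_comp (stab t) (π t X _),
    Functor.map_comp (stab t) (_ ≫ _ ≫ π t Y _), h]

end ofCPi

end Summands

section Realization

variable {R : Type u} [CommRing R] [IsLocalRing R] {t : R}

section Indecomposables

variable {X Y Z : IndC (ResidueField R)} (ht : maximalIdeal R = Ideal.span {t})
include ht

theorem residue_eq_zero_iff_dvd {r : R} : residue R r = 0 ↔ t ∣ r := by
  rw [residue_eq_zero_iff, ht, Ideal.mem_span_singleton]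

theorem stab_map_basic_congr {r s : R} (h : residue R r = residue R s) :
    (stab t).map (basic t r X Y) = (stab t).map (basic t s X Y) := by
  obtain ⟨c, hc⟩ : t ∣ r - s := by rw [← residue_eq_zero_iff_dvd ht, map_sub, h, sub_self]
  rw [← sub_eq_zero, ← Functor.map_sub, ← basic_sub, hc, mul_comm, stab_map_basic_mul_eq_zero]

theorem residue_eq_of_stab_map_basic_eq [IsDomain R] (ht₀ : t ≠ 0) {r s : R}
    (hXY : IndC.sgn X Y ≠ 0) (h : (stab t).map (basic t r X Y) = (stab t).map (basic t s X Y)) :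
    residue R r = residue R s := by
  rw [← sub_eq_zero, ← map_sub, residue_eq_zero_iff_dvd ht]
  apply dvd_of_stab_map_basic_eq_zero ht₀ hXY
  rw [basic_sub, Functor.map_sub, h, sub_self]

variable (t) in
omit ht in
/-- A morphism of `F_π` that represents the morphism `f = k b_ε` of `C_π`: the multiple of the basic
morphism by a chosen element of `R` with residue class `k`. -/
noncomputable def lift (f : X ⟶ Y) : E t X.arc ⟶ E t Y.arc :=
  basic t (Function.surjInv residue_surjective f.coeff) X Y

theorem stab_map_lift {f : X ⟶ Y} {r : R} (hr : residue R r = f.coeff) :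
    (stab t).map (lift t f) = (stab t).map (basic t r X Y) :=
  stab_map_basic_congr ht ((Function.surjInv_eq residue_surjective _).trans hr.symm)

theorem stab_map_lift_id : (stab t).map (lift t (𝟙 X)) = 𝟙 ((stab t).obj (E t X.arc)) := by
  rw [stab_map_lift ht (map_one _), basic_one, CategoryTheory.Functor.map_id]

theorem stab_map_lift_comp (f : X ⟶ Y) (g : Y ⟶ Z) :
    (stab t).map (lift t (f ≫ g)) = (stab t).map (lift t f) ≫ (stab t).map (lift t g) := by
  unfold lift
  rw [← Functor.map_comp, stab_map_basic_comp_basic]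
  apply stab_map_basic_congr ht
  simp only [apply_ite (residue R), map_mul, Function.surjInv_eq residue_surjective, map_zero]
  rfl

theorem stab_map_lift_add (f g : X ⟶ Y) :
    (stab t).map (lift t (f + g)) = (stab t).map (lift t f) + (stab t).map (lift t g) := by
  unfold lift
  rw [← Functor.map_add, ← basic_add]
  apply stab_map_basic_congr ht
  simp only [map_add, Function.surjInv_eq residue_surjective]
  rfl

theorem stab_map_lift_zero : (stab t).map (lift t (0 : X ⟶ Y)) = 0 := by
  rw [stab_map_lift ht (map_zero _), basic_zero, Functor.map_zero]

theorem stab_map_lift_sum {J : Type*} (s : Finset J) (f : J → (X ⟶ Y)) :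
    (stab t).map (lift t (∑ j ∈ s, f j)) = ∑ j ∈ s, (stab t).map (lift t (f j)) :=
  map_sum (AddMonoidHom.mk' (fun f : X ⟶ Y => (stab t).map (lift t f)) (stab_map_lift_add ht)) f s

theorem stab_map_lift_injective [IsDomain R] (ht₀ : t ≠ 0) :
    Function.Injective fun f : X ⟶ Y => (stab t).map (lift t f) := by
  intro f g h
  apply IndC.hom_ext
  by_cases hXY : IndC.sgn X Y = 0
  · rw [f.zero hXY, g.zero hXY]
  · simpa only [Function.surjInv_eq] using residue_eq_of_stab_map_basic_eq ht ht₀ hXY h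

theorem exists_stab_map_lift_eq [IsDomain R] (ht₀ : t ≠ 0) (f : E t X.arc ⟶ E t Y.arc) :
    ∃ k : X ⟶ Y, (stab t).map (lift t k) = (stab t).map f := by
  obtain ⟨r, hr⟩ := exists_stab_map_basic_eq ht₀ f
  by_cases hXY : IndC.sgn X Y = 0
  · refine ⟨0, ?_⟩
    rw [lift, ← hr, basic_of_sgn_eq_zero hXY, basic_of_sgn_eq_zero hXY]
  · exact ⟨⟨residue R r, fun h => absurd h hXY⟩, (stab_map_lift ht rfl).trans hr⟩

end Indecomposables

section Objects

variable {X Y : CPi (ResidueField R)}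

variable (t) in
/-- A morphism of `F_π` that represents the matrix `f`. -/
noncomputable def matrixLift (f : X ⟶ Y) : ofCPi t X ⟶ ofCPi t Y :=
  biproduct.matrix fun i j => lift t (f i j)

theorem ι_matrixLift_π (f : X ⟶ Y) (i : X.ι) (j : Y.ι) :
    ofCPi.ι t X i ≫ matrixLift t f ≫ ofCPi.π t Y j = lift t (f i j) := by
  have matrixLift_π : matrixLift t f ≫ ofCPi.π t Y j = biproduct.desc fun i => lift t (f i j) :=
    biproduct.matrix_π _ _
  rw [matrixLift_π]
  exact biproduct.ι_desc _ _

theorem ι_comp_comp_π {Z : CPi (ResidueField R)} (f : ofCPi t X ⟶ ofCPi t Y)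
    (g : ofCPi t Y ⟶ ofCPi t Z) (i : X.ι) (k : Z.ι) :
    ofCPi.ι t X i ≫ (f ≫ g) ≫ ofCPi.π t Z k =
      ∑ j, (ofCPi.ι t X i ≫ f ≫ ofCPi.π t Y j) ≫ (ofCPi.ι t Y j ≫ g ≫ ofCPi.π t Z k) := by
  conv_lhs => rw [← Category.comp_id f, ← ofCPi.sum_π_ι t Y]
  simp only [Preadditive.comp_sum, Preadditive.sum_comp, Category.assoc]

variable (ht : maximalIdeal R = Ideal.span {t})

/-- The functor from `C_π` to the stable category of `F_π` that sends `⨁ (xᵢ, yᵢ)` to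
`⨁ E(xᵢ, yᵢ)` and the basic morphisms to the classes of the basic morphisms of `F_π`. -/
noncomputable def realization : CPi (ResidueField R) ⥤ Stable t where
  obj X := (stab t).obj (ofCPi t X)
  map f := (stab t).map (matrixLift t f)
  map_id X := by
    rw [← CategoryTheory.Functor.map_id]
    refine ofCPi.stab_map_ext fun i j => ?_
    rw [ι_matrixLift_π, Category.id_comp]
    obtain rfl | hij := eq_or_ne i j
    · rw [Mat_.id_apply_self, stab_map_lift_id ht, ofCPi.ι_π_self,
        CategoryTheory.Functor.map_id]
    · rw [Mat_.id_apply_of_ne _ _ _ hij, stab_map_lift_zero ht, ofCPi.ι_π_of_ne hij,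
        Functor.map_zero]
  map_comp {X Y Z} f g := by
    rw [← Functor.map_comp]
    refine ofCPi.stab_map_ext fun i k => ?_
    rw [ι_comp_comp_π, Functor.map_sum, ι_matrixLift_π, Mat_.comp_apply, stab_map_lift_sum ht]
    simp only [stab_map_lift_comp ht, ι_matrixLift_π, Functor.map_comp]

theorem represents_iff {f' : ofCPi t X ⟶ ofCPi t Y} {f : X ⟶ Y} :
    Represents t f' f ↔ (stab t).map f' = (realization ht).map f := by
  trans ∀ i j, (stab t).map (ofCPi.ι t X i ≫ f' ≫ ofCPi.π t Y j) = (stab t).map (lift t (f i j))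
  · refine forall₂_congr fun i j => ⟨?_, fun h => ?_⟩
    · rintro ⟨r, hr, h⟩
      rw [stab_map_lift ht hr]
      exact h
    · exact ⟨_, Function.surjInv_eq residue_surjective _, h⟩
  · refine ⟨fun h => ofCPi.stab_map_ext fun i j => ?_, fun h i j => ?_⟩
    · rw [ι_matrixLift_π, h]
    · rw [← ι_matrixLift_π, Functor.map_comp, Functor.map_comp, h, Functor.map_comp,
        Functor.map_comp]
      rfl

theorem realization_map_injective [IsDomain R] (ht₀ : t ≠ 0) :
    Function.Injective ((realization ht).map : (X ⟶ Y) → _) := by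
  intro f g h
  ext i j
  apply stab_map_lift_injective ht ht₀
  have h' := congrArg (fun k => (stab t).map (ofCPi.ι t X i) ≫ k ≫ (stab t).map (ofCPi.π t Y j)) h
  simpa only [realization, ← Functor.map_comp, ι_matrixLift_π] using h'

theorem realization_map_surjective [IsDomain R] (ht₀ : t ≠ 0) :
    Function.Surjective ((realization ht).map : (X ⟶ Y) → _) := by
  intro f
  obtain ⟨f, rfl⟩ := (stab t).map_surjective f
  obtain ⟨k, hk⟩ : ∃ k : X ⟶ Y, ∀ i j, (stab t).map (lift t (k i j)) =
      (stab t).map (ofCPi.ι t X i ≫ f ≫ ofCPi.π t Y j) := by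
    choose k hk using fun i j =>
      exists_stab_map_lift_eq ht ht₀ (ofCPi.ι t X i ≫ f ≫ ofCPi.π t Y j)
    exact ⟨k, hk⟩
  exact ⟨k, ofCPi.stab_map_ext fun i j => by rw [ι_matrixLift_π, hk]⟩

end Objects

end Realization

end FPi

/-! ### Pushouts from splittings -/

section Preadditive

variable {C : Type*} [Category C] [Preadditive C] {X Q Y P : C} {i : X ⟶ Q} {f : X ⟶ Y}
  {u : Q ⟶ P} {m : Y ⟶ P}

theorem isPushout_of_sub_eq_comp (hP : IsPushout i f u m) {f' : X ⟶ Y} {k : Q ⟶ Y}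
    (hk : f - f' = i ≫ k) : IsPushout i f' (u - k ≫ m) m := by
  obtain rfl : f' = f - i ≫ k := by rw [← hk, sub_sub_cancel]
  have w : i ≫ (u - k ≫ m) = (f - i ≫ k) ≫ m := by
    rw [Preadditive.comp_sub, Preadditive.sub_comp, hP.w, Category.assoc]
  have w' (s : PushoutCocone i (f - i ≫ k)) : i ≫ (s.inl + k ≫ s.inr) = f ≫ s.inr := by
    rw [Preadditive.comp_add, s.condition, Preadditive.sub_comp, Category.assoc, sub_add_cancel]
  refine ⟨⟨w⟩, ⟨PushoutCocone.IsColimit.mk w (fun s => hP.desc _ _ (w' s)) (fun s => ?_)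
    (fun s => hP.inr_desc _ _ _) (fun s l hl hr => hP.hom_ext ?_ ?_)⟩⟩
  · rw [Preadditive.sub_comp, Category.assoc, hP.inl_desc, hP.inr_desc, add_sub_cancel_right]
  · rw [hP.inl_desc, ← hl, ← hr, Preadditive.sub_comp, Category.assoc, sub_add_cancel]
  · rw [hP.inr_desc, hr]

theorem isPushout_of_exists_desc (w : i ≫ u = f ≫ m)
    (exists_desc : ∀ {W : C} (a : Q ⟶ W) (b : Y ⟶ W), i ≫ a = f ≫ b →
      ∃ l : P ⟶ W, u ≫ l = a ∧ m ≫ l = b)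
    (eq_zero : ∀ {W : C} (l : P ⟶ W), u ≫ l = 0 → m ≫ l = 0 → l = 0) : IsPushout i f u m := by
  choose desc inl_desc inr_desc using
    fun s : PushoutCocone i f => exists_desc s.inl s.inr s.condition
  refine ⟨⟨w⟩, ⟨PushoutCocone.IsColimit.mk w desc inl_desc inr_desc fun s l hl hr => ?_⟩⟩
  rw [← sub_eq_zero]
  apply eq_zero
  · rw [Preadditive.comp_sub, hl, inl_desc, sub_self]
  · rw [Preadditive.comp_sub, hr, inr_desc, sub_self]

theorem isPushout_of_splittings {S : C} {o : Q ⟶ S} {q : P ⟶ S} (w : i ≫ u = f ≫ m)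
    (huq : u ≫ q = o) (hmq : m ≫ q = 0) {ρ : Q ⟶ X} {σ : S ⟶ Q} (σ_o : σ ≫ o = 𝟙 S)
    (total_Q : ρ ≫ i + o ≫ σ = 𝟙 Q) {r : P ⟶ Y} {s : S ⟶ P} (m_r : m ≫ r = 𝟙 Y)
    (total_P : r ≫ m + q ≫ s = 𝟙 P) : IsPushout i f u m := by
  refine isPushout_of_exists_desc w (fun a b hab => ?_) fun l hu hm => ?_
  · have hi : i ≫ (a - u ≫ r ≫ b) = 0 := by
      rw [Preadditive.comp_sub, hab, reassoc_of% w, reassoc_of% m_r, sub_self]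
    have ho : o ≫ σ ≫ (a - u ≫ r ≫ b) = a - u ≫ r ≫ b := by
      conv_rhs => rw [← Category.id_comp (a - u ≫ r ≫ b), ← total_Q]
      rw [Preadditive.add_comp, Category.assoc, Category.assoc, hi, comp_zero, zero_add]
    refine ⟨r ≫ b + q ≫ σ ≫ (a - u ≫ r ≫ b), ?_, ?_⟩
    · rw [Preadditive.comp_add, reassoc_of% huq, ho, add_sub_cancel]
    · rw [Preadditive.comp_add, reassoc_of% m_r, reassoc_of% hmq, zero_comp, add_zero]
  · have hl : l = q ≫ s ≫ l := by
      conv_lhs => rw [← Category.id_comp l, ← total_P]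
      rw [Preadditive.add_comp, Category.assoc, Category.assoc, hm, comp_zero, zero_add]
    have hs : s ≫ l = 0 := by
      rw [← Category.id_comp (s ≫ l), ← σ_o, ← huq, Category.assoc, Category.assoc, ← hl, hu,
        comp_zero]
    rw [hl, hs, comp_zero]

end Preadditive

/-! ### The chosen exact sequences -/

namespace FPi

open PS1 E

section Hull

variable {R : Type u} [CommRing R] {t : R}

theorem isPushout_of_isPushout_f {X Q Y P : FPi t} {i : X ⟶ Q} {f : X ⟶ Y} {u : Q ⟶ P}
    {m : Y ⟶ P} (hP : IsPushout i.f f.f u.f m.f) : IsPushout i f u m := by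
  refine isPushout_of_exists_desc (hom_ext hP.w) (fun {W} a b hab => ?_) fun l hu hm =>
    hom_ext (hP.hom_ext ?_ ?_)
  · have w : i.f ≫ a.f = f.f ≫ b.f := congrArg Hom.f hab
    refine ⟨⟨hP.desc a.f b.f w, hP.hom_ext ?_ ?_⟩, hom_ext (hP.inl_desc _ _ w),
      hom_ext (hP.inr_desc _ _ w)⟩
    · rw [← reassoc_of% u.comm, hP.inl_desc, hP.inl_desc_assoc, a.comm]
    · rw [← reassoc_of% m.comm, hP.inr_desc, hP.inr_desc_assoc, b.comm]
  · rw [zero_f, comp_zero]; exact congrArg Hom.f hu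
  · rw [zero_f, comp_zero]; exact congrArg Hom.f hm

theorem exists_extension_of_stab_map_eq_zero {A B Y : FPi t} {i : A ⟶ B} {ρ : B.V ⟶ A.V}
    (hρ : i.f ≫ ρ = 𝟙 _) {f : A ⟶ Y} (hf : (stab t).map f = 0) : ∃ k : B ⟶ Y, f = i ≫ k := by
  obtain ⟨s, hs⟩ := stab_map_eq_zero_iff.1 hf
  refine ⟨boundary B Y (ρ ≫ s), hom_ext ?_⟩
  rw [comp_boundary, reassoc_of% hρ, boundary_f, hs]

namespace hull

variable (t) {K : Type*} (X : IndC K)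

/-- The inclusion of the summand `E(y, y)` of the hull of `(x, y)`; retyped, like `E.i₀`. -/
noncomputable def inl : E t X.finishArc ⟶ hull t X :=
  (biprod.inl : E t X.finishArc ⟶ E t X.finishArc ⊞ E t X.fullArc)

/-- The inclusion of the summand `E(x, x + 2π)` of the hull of `(x, y)`. -/
noncomputable def inr : E t X.fullArc ⟶ hull t X :=
  (biprod.inr : E t X.fullArc ⟶ E t X.finishArc ⊞ E t X.fullArc)

/-- The projection of the hull of `(x, y)` to `E(y, y)`. -/
noncomputable def fst : hull t X ⟶ E t X.finishArc :=
  (biprod.fst : E t X.finishArc ⊞ E t X.fullArc ⟶ E t X.finishArc)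

/-- The projection of the hull of `(x, y)` to `E(x, x + 2π)`. -/
noncomputable def snd : hull t X ⟶ E t X.fullArc :=
  (biprod.snd : E t X.finishArc ⊞ E t X.fullArc ⟶ E t X.fullArc)

variable {t X}

theorem inl_fst_f : (inl t X).f ≫ (fst t X).f = 𝟙 _ := by
  have inl_fst : inl t X ≫ fst t X = 𝟙 _ := biprod.inl_fst
  exact congrArg Hom.f inl_fst

theorem inl_snd_f : (inl t X).f ≫ (snd t X).f = 0 := by
  have inl_snd : inl t X ≫ snd t X = 0 := biprod.inl_snd
  exact congrArg Hom.f inl_snd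

theorem inr_fst_f : (inr t X).f ≫ (fst t X).f = 0 := by
  have inr_fst : inr t X ≫ fst t X = 0 := biprod.inr_fst
  exact congrArg Hom.f inr_fst

theorem inr_snd_f : (inr t X).f ≫ (snd t X).f = 𝟙 _ := by
  have inr_snd : inr t X ≫ snd t X = 𝟙 _ := biprod.inr_snd
  exact congrArg Hom.f inr_snd

theorem total_f : (fst t X).f ≫ (inl t X).f + (snd t X).f ≫ (inr t X).f = 𝟙 _ := by
  have total : fst t X ≫ inl t X + snd t X ≫ inr t X = 𝟙 _ :=
    biprod.total (X := E t X.finishArc) (Y := E t X.fullArc)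
  exact congrArg Hom.f total

end hull

end Hull

end FPi

namespace PS1

variable {R : Type u} [CommRing R] {t : R} {p q o : Circ} {x y z : ℝ}

open Classical in
/-- The morphism `e_x ↦ e_y^(y - x)` for real numbers `x ≤ y` that lift the points `p` and `q` of
the circle, and the junk value `0` if `y < x`. -/
noncomputable def up (t : R) (hp : (x : Circ) = p) (hq : (y : Circ) = q) : P t p ⟶ P t q :=
  if h : x ≤ y then star t (y - x) (sub_nonneg.2 h) (by rw [AddCircle.coe_sub, hp, hq]; abel)
  else 0

variable {hp : (x : Circ) = p} {hq : (y : Circ) = q} {ho : (z : Circ) = o}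

theorem star_eq_up {α : ℝ} {hα : 0 ≤ α} {h : p + (α : Circ) = q} (e : x + α = y) :
    star t α hα h = up t hp hq := by
  rw [up, dif_pos (by linarith)]
  exact star_congr (by linarith)

theorem up_self : up t hp hp = 𝟙 (P t p) := by
  rw [up, dif_pos le_rfl]
  exact star_zero (sub_self x) _ _

theorem up_comp_up (hxy : x ≤ y) (hyz : y ≤ z) : up t hp hq ≫ up t hq ho = up t hp ho := by
  rw [up, up, dif_pos hxy, dif_pos hyz, star_comp_star]
  exact star_eq_up (by ring)

theorem smul_up_comp_smul_up {r s : R} (hxy : r ≠ 0 → x ≤ y) (hyz : s ≠ 0 → y ≤ z) :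
    (r • up t hp hq) ≫ (s • up t hq ho) = (r * s) • up t hp ho := by
  obtain rfl | hr := eq_or_ne r 0
  · rw [zero_smul, zero_comp, zero_mul, zero_smul]
  obtain rfl | hs := eq_or_ne s 0
  · rw [zero_smul, comp_zero, mul_zero, zero_smul]
  rw [Linear.smul_comp, Linear.comp_smul, up_comp_up (hxy hr) (hyz hs), smul_smul]

end PS1

namespace FPi

open PS1 E hull

section Block

variable {R : Type u} [CommRing R] {t : R} {A B C : Arc} {a b c : ℝ}

theorem _root_.Arc.coe_add_len (hA : (a : Circ) = A.start) :
    ((a + A.len : ℝ) : Circ) = A.finish := by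
  rw [AddCircle.coe_add, hA, Arc.finish]

/-- For arcs that start at (the classes of) the real numbers `a` and `b`, the morphism of
representations that is `r` times `e_x ↦ e_y^(y - x)` on the starting points, and `s` times it on
the end points. It commutes with `d` for `r = s`, and projections are obtained otherwise. -/
noncomputable def block (t : R) (hA : (a : Circ) = A.start) (hB : (b : Circ) = B.start)
    (r s : R) : (E t A).V ⟶ (E t B).V :=
  p₀ t A ≫ (r • up t hA hB) ≫ i₀ t B +
    p₁ t A ≫ (s • up t (Arc.coe_add_len hA) (Arc.coe_add_len hB)) ≫ i₁ t B

variable {hA : (a : Circ) = A.start} {hB : (b : Circ) = B.start} {hC : (c : Circ) = C.start}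

theorem i₀_block (r s : R) : i₀ t A ≫ block t hA hB r s = (r • up t hA hB) ≫ i₀ t B := by
  simp [block]

theorem i₁_block (r s : R) : i₁ t A ≫ block t hA hB r s =
    (s • up t (Arc.coe_add_len hA) (Arc.coe_add_len hB)) ≫ i₁ t B := by
  simp [block]

theorem block_one : block t hA hA 1 1 = 𝟙 (E t A).V := by
  apply hom_ext'
  · rw [i₀_block, up_self, one_smul, Category.id_comp, Category.comp_id]
  · rw [i₁_block, up_self, one_smul, Category.id_comp, Category.comp_id]

theorem block_zero : block t hA hB 0 0 = 0 := by
  simp [block]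

theorem block_add (r r' s s' : R) :
    block t hA hB (r + r') (s + s') = block t hA hB r s + block t hA hB r' s' := by
  apply hom_ext' <;> simp [i₀_block, i₁_block, add_smul]

theorem block_sum {J : Type*} (I : Finset J) (r s : J → R) :
    block t hA hB (∑ j ∈ I, r j) (∑ j ∈ I, s j) = ∑ j ∈ I, block t hA hB (r j) (s j) := by
  classical
  induction I using Finset.induction_on with
  | empty => simp [block]
  | insert j I hj ih => rw [Finset.sum_insert hj, Finset.sum_insert hj, Finset.sum_insert hj,
      block_add, ih]

theorem block_comp_block {r r' s s' : R} (hr : r ≠ 0 → a ≤ b) (hr' : r' ≠ 0 → b ≤ c)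
    (hs : s ≠ 0 → a + A.len ≤ b + B.len) (hs' : s' ≠ 0 → b + B.len ≤ c + C.len) :
    block t hA hB r s ≫ block t hB hC r' s' = block t hA hC (r * r') (s * s') := by
  apply hom_ext'
  · rw [reassoc_of% i₀_block, i₀_block, i₀_block, ← smul_up_comp_smul_up hr hr', Category.assoc]
  · rw [reassoc_of% i₁_block, i₁_block, i₁_block, ← smul_up_comp_smul_up hs hs', Category.assoc]

theorem diag_f {r : R} {u : ℝ} {hu : 0 ≤ u} {h : A.start + (u : Circ) = B.start}
    {hv : A.len ≤ u + B.len} (e : a + u = b) :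
    (diag t r u hu h hv).f = block t hA hB r r := by
  apply hom_ext'
  · rw [i₀_diag, i₀_block, Linear.smul_comp, star_eq_up e]
  · have e' : a + A.len + (u + B.len - A.len) = b + B.len := by linarith
    rw [i₁_diag, i₁_block, Linear.smul_comp, star_eq_up e']

end Block

section HullSplitting

variable {R : Type u} [CommRing R] {t : R} {K : Type*} {X : IndC K} {x y : ℝ}

namespace hull

theorem hom_ext {V : PS1 t} {k l : V ⟶ (hull t X).V}
    (h₀ : k ≫ (fst t X).f = l ≫ (fst t X).f) (h₁ : k ≫ (snd t X).f = l ≫ (snd t X).f) :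
    k = l := by
  rw [← Category.comp_id k, ← Category.comp_id l, ← total_f]
  simp only [Preadditive.comp_add, reassoc_of% h₀, reassoc_of% h₁]

theorem comp_eq_add {V W : PS1 t} (k : V ⟶ (hull t X).V) (l : (hull t X).V ⟶ W) :
    k ≫ l = (k ≫ (fst t X).f) ≫ (inl t X).f ≫ l + (k ≫ (snd t X).f) ≫ (inr t X).f ≫ l := by
  conv_lhs => rw [← Category.id_comp l, ← total_f]
  simp only [Preadditive.add_comp, Preadditive.comp_add, Category.assoc]

theorem hom_ext' {W : PS1 t} {k l : (hull t X).V ⟶ W}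
    (h₀ : (inl t X).f ≫ k = (inl t X).f ≫ l) (h₁ : (inr t X).f ≫ k = (inr t X).f ≫ l) :
    k = l := by
  rw [← Category.id_comp k, ← Category.id_comp l, ← total_f]
  simp only [Preadditive.add_comp, Category.assoc, h₀, h₁]

end hull

section

variable {hX : (x : Circ) = X.arc.start} {hF : (y : Circ) = X.finishArc.start}
  {hI : (x : Circ) = X.fullArc.start} {hS : (y : Circ) = X.swap.arc.start}

theorem hullIn_fst_f (e : x + X.arc.len = y) :
    (hullIn t X).f ≫ (hull.fst t X).f = block t hX hF 1 1 := by
  have hullIn_fst : hullIn t X ≫ hull.fst t X =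
      diag t 1 X.arc.len X.arc.nonneg _ _ := biprod.lift_fst _ _
  exact (congrArg Hom.f hullIn_fst).trans (diag_f e)

theorem hullIn_snd_f : (hullIn t X).f ≫ (hull.snd t X).f = block t hX hI (-1) (-1) := by
  have hullIn_snd : hullIn t X ≫ hull.snd t X = diag t (-1) 0 le_rfl _ _ := biprod.lift_snd _ _
  exact (congrArg Hom.f hullIn_snd).trans (diag_f (add_zero x))

theorem inl_hullOut_f : (hull.inl t X).f ≫ (hullOut t X).f = block t hF hS 1 1 := by
  have inl_hullOut : hull.inl t X ≫ hullOut t X = diag t 1 0 le_rfl _ _ := biprod.inl_desc _ _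
  exact (congrArg Hom.f inl_hullOut).trans (diag_f (add_zero y))

theorem inr_hullOut_f (e : x + X.arc.len = y) :
    (hull.inr t X).f ≫ (hullOut t X).f = block t hI hS 1 1 := by
  have inr_hullOut : hull.inr t X ≫ hullOut t X =
      diag t 1 X.arc.len X.arc.nonneg _ _ := biprod.inr_desc _ _
  exact (congrArg Hom.f inr_hullOut).trans (diag_f e)

end

theorem exists_splitting_hull : ∃ (ρ : (hull t X).V ⟶ (E t X.arc).V)
    (σ : (E t X.swap.arc).V ⟶ (hull t X).V), (hullIn t X).f ≫ ρ = 𝟙 _ ∧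
    σ ≫ (hullOut t X).f = 𝟙 _ ∧ ρ ≫ (hullIn t X).f + (hullOut t X).f ≫ σ = 𝟙 _ := by
  obtain ⟨x, hX : (x : Circ) = X.arc.start⟩ := QuotientAddGroup.mk_surjective X.fst
  obtain ⟨y, e⟩ : ∃ y, x + X.arc.len = y := ⟨_, rfl⟩
  have hI : (x : Circ) = X.fullArc.start := hX
  have hF : (y : Circ) = X.finishArc.start := by
    rw [← e, Arc.coe_add_len hX, X.arc_finish, IndC.finishArc]
  have hS : (y : Circ) = X.swap.arc.start := hF
  let ρ := (hull.fst t X).f ≫ block t hF hX 0 1 + (hull.snd t X).f ≫ block t hI hX (-1) 0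
  let σ := block t hS hF 1 0 ≫ (hull.inl t X).f + block t hS hI 0 1 ≫ (hull.inr t X).f
  have hXI : X.arc.len ≤ X.fullArc.len := X.arc.le
  have hFS : X.finishArc.len ≤ X.swap.arc.len := X.swap.arc.nonneg
  have hF_len : X.finishArc.len = 0 := rfl
  have hS_len : y + X.swap.arc.len = x + X.fullArc.len := by
    rw [← e, add_assoc, X.arc_len_add]; rfl
  have hX_len : 0 ≤ X.arc.len := X.arc.nonneg
  have in_fst := hullIn_fst_f (t := t) (hX := hX) (hF := hF) e
  have in_snd := hullIn_snd_f (t := t) (hX := hX) (hI := hI)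
  have inl_out := inl_hullOut_f (t := t) (hF := hF) (hS := hS)
  have inr_out := inr_hullOut_f (t := t) (hI := hI) (hS := hS) e
  refine ⟨ρ, σ, ?_, ?_, hull.hom_ext' (hull.hom_ext ?_ ?_) (hull.hom_ext ?_ ?_)⟩
  all_goals
    simp only [ρ, σ, Preadditive.comp_add, Preadditive.add_comp, Category.assoc, in_fst, in_snd,
      inl_fst_f, inl_snd_f, inr_fst_f, inr_snd_f, inl_out, inr_out, reassoc_of% inl_fst_f,
      reassoc_of% inl_snd_f, reassoc_of% inr_fst_f, reassoc_of% inr_snd_f, reassoc_of% in_fst,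
      reassoc_of% in_snd, reassoc_of% inl_out, reassoc_of% inr_out, Category.comp_id, comp_zero,
      zero_comp, add_zero, zero_add]
    rw [block_comp_block, block_comp_block, ← block_add]
    · norm_num [block_one, block_zero]
    all_goals grind

end HullSplitting

end FPi

namespace FPi

open PS1 E hull IsLocalRing

section Biproduct

variable {R : Type u} [CommRing R] {t : R} {J : Type} [Finite J] {A B C : J → FPi t} {W : PS1 t}

/-- The biproduct of objects of `F_π`, seen as a biproduct of representations. -/
noncomputable def forgetIsBilimit (A : J → FPi t) :
    (forget.mapBicone (biproduct.bicone A)).IsBilimit :=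
  isBilimitOfPreserves forget (biproduct.isBilimit A)

theorem biproduct_hom_ext_f {k l : (⨁ A).V ⟶ W}
    (h : ∀ i, (biproduct.ι A i).f ≫ k = (biproduct.ι A i).f ≫ l) : k = l :=
  (forgetIsBilimit A).isColimit.hom_ext fun ⟨i⟩ => h i

/-- The morphism of representations that is given by `k i` on the summand `i`, where `k i` need
not commute with `d`. -/
noncomputable def descV (k : ∀ i, (A i).V ⟶ W) : (⨁ A).V ⟶ W :=
  (forgetIsBilimit A).isColimit.desc (Cofan.mk W k)

theorem ι_descV (k : ∀ i, (A i).V ⟶ W) (i : J) : (biproduct.ι A i).f ≫ descV k = k i :=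
  (forgetIsBilimit A).isColimit.fac (Cofan.mk W k) ⟨i⟩

theorem biproduct_ι_map_f (k : ∀ j, A j ⟶ B j) (j : J) :
    (biproduct.ι A j).f ≫ (biproduct.map k).f = (k j).f ≫ (biproduct.ι B j).f :=
  congrArg Hom.f (biproduct.ι_map k j)

theorem exists_splitting_biproduct_map {i : ∀ j, A j ⟶ B j} {o : ∀ j, B j ⟶ C j}
    (h : ∀ j, ∃ (ρ : (B j).V ⟶ (A j).V) (σ : (C j).V ⟶ (B j).V), (i j).f ≫ ρ = 𝟙 _ ∧
      σ ≫ (o j).f = 𝟙 _ ∧ ρ ≫ (i j).f + (o j).f ≫ σ = 𝟙 _) :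
    ∃ (ρ : (⨁ B).V ⟶ (⨁ A).V) (σ : (⨁ C).V ⟶ (⨁ B).V), (biproduct.map i).f ≫ ρ = 𝟙 _ ∧
      σ ≫ (biproduct.map o).f = 𝟙 _ ∧
      ρ ≫ (biproduct.map i).f + (biproduct.map o).f ≫ σ = 𝟙 _ := by
  choose ρ σ hρ hσ total using h
  refine ⟨descV fun j => ρ j ≫ (biproduct.ι A j).f, descV fun j => σ j ≫ (biproduct.ι B j).f,
    biproduct_hom_ext_f fun j => ?_, biproduct_hom_ext_f fun j => ?_,
    biproduct_hom_ext_f fun j => ?_⟩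
  · rw [reassoc_of% biproduct_ι_map_f i j, ι_descV, reassoc_of% hρ, Category.comp_id]
  · rw [reassoc_of% ι_descV, Category.assoc, biproduct_ι_map_f, reassoc_of% hσ, Category.comp_id]
  · rw [Preadditive.comp_add, reassoc_of% ι_descV, reassoc_of% biproduct_ι_map_f o j, ι_descV,
      Category.assoc, biproduct_ι_map_f, ← Category.assoc, ← Category.assoc,
      ← Preadditive.add_comp, total, Category.id_comp, Category.comp_id]

end Biproduct

section SumHull

variable {R : Type u} [CommRing R] [IsLocalRing R] {t : R} {X : CPi (ResidueField R)}

theorem exists_splitting_sumHull : ∃ (ρ : (sumHull t X).V ⟶ (ofCPi t X).V)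
    (σ : (ofCPi t X.shift).V ⟶ (sumHull t X).V), (sumHullIn t X).f ≫ ρ = 𝟙 _ ∧
    σ ≫ (sumHullOut t X).f = 𝟙 _ ∧ ρ ≫ (sumHullIn t X).f + (sumHullOut t X).f ≫ σ = 𝟙 _ :=
  exists_splitting_biproduct_map (i := fun j => hullIn t (X.X j)) (o := fun j => hullOut t (X.X j))
    fun _ => exists_splitting_hull

end SumHull

/-! ### Uniqueness of distinguished triangles -/

section Uniqueness

variable {R : Type u} [CommRing R] [IsLocalRing R] {t : R} {X Y Z Z₀ : CPi (ResidueField R)}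
  (ht : maximalIdeal R = Ideal.span {t})
include ht

theorem stab_map_sub_eq_zero {f : X ⟶ Y} {f' f₀ : ofCPi t X ⟶ ofCPi t Y}
    (hf' : Represents t f' f) (hf₀ : Represents t f₀ f) : (stab t).map (f' - f₀) = 0 :=
  (stab t).map_sub.trans <|
    sub_eq_zero.2 (((represents_iff ht).1 hf').trans ((represents_iff ht).1 hf₀).symm)

variable {f : X ⟶ Y} {g₀ : Y ⟶ Z₀} {h₀ : Z₀ ⟶ X.shift} {f₀ : ofCPi t X ⟶ ofCPi t Y}
  {m₀ : ofCPi t Y ⟶ ofCPi t Z₀} {u₀ : sumHull t X ⟶ ofCPi t Z₀}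
  {q₀ : ofCPi t Z₀ ⟶ ofCPi t X.shift} (hf₀ : Represents t f₀ f) (hm₀ : Represents t m₀ g₀)
  (hq₀ : Represents t q₀ h₀) (hP : IsPushout (sumHullIn t X) f₀ u₀ m₀)
  (huq : u₀ ≫ q₀ = sumHullOut t X) (hmq : m₀ ≫ q₀ = 0) {g : Y ⟶ Z} {h : Z ⟶ X.shift}
include hf₀ hm₀ hq₀ hP huq hmq

theorem isDistinguished_of_iso (α : Z ≅ Z₀) (hg : g ≫ α.hom = g₀) (hh : α.hom ≫ h₀ = h) :
    IsDistinguished t f g h := by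
  refine ⟨f₀, matrixLift t g, matrixLift t h, hf₀, (represents_iff ht).2 rfl,
    (represents_iff ht).2 rfl, ofCPi t Z₀, m₀, u₀, q₀, (realization ht).mapIso α, hP, huq, hmq,
    ?_, ?_⟩
  · rw [(represents_iff ht).1 hm₀, ← hg, Functor.map_comp]; rfl
  · rw [(represents_iff ht).1 hq₀]
    exact ((realization ht).map_comp _ _).symm.trans (congrArg _ hh)

theorem exists_iso_of_isDistinguished [IsDomain R] (ht₀ : t ≠ 0) (hfgh : IsDistinguished t f g h) :
    ∃ α : Z ≅ Z₀, g ≫ α.hom = g₀ ∧ α.hom ≫ h₀ = h := by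
  obtain ⟨f', g', h', hf', hg', hh', C, m, u, q, φ, hC, huq', hmq', hφm, hφq⟩ := hfgh
  rw [represents_iff ht] at hg' hh' hm₀ hq₀
  obtain ⟨ρ, σ, hρ, -⟩ := exists_splitting_sumHull (t := t) (X := X)
  obtain ⟨k, hk⟩ := exists_extension_of_stab_map_eq_zero hρ (stab_map_sub_eq_zero ht hf' hf₀)
  have hC' := isPushout_of_sub_eq_comp hC hk
  let e : ofCPi t Z₀ ≅ C := hP.isoIsPushout _ _ hC'
  have u_e : u₀ ≫ e.hom = u - k ≫ m := hP.inl_isoIsPushout_hom _ _ _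
  have m_e : m₀ ≫ e.hom = m := hP.inr_isoIsPushout_hom _ _ _
  have e_q : e.hom ≫ q = q₀ := by
    apply hP.hom_ext
    · rw [reassoc_of% u_e, Preadditive.sub_comp, Category.assoc, hmq', huq', comp_zero, sub_zero,
        huq]
    · rw [reassoc_of% m_e, hmq', hmq]
  have g_φ_e : (stab t).map g' ≫ φ.hom ≫ (stab t).map e.inv = (stab t).map m₀ := by
    rw [reassoc_of% hφm, ← Functor.map_comp, ← m_e, Category.assoc, e.hom_inv_id,
      Category.comp_id]
  have φ_e_q : (φ.hom ≫ (stab t).map e.inv) ≫ (stab t).map q₀ = (stab t).map h' := by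
    rw [← hφq, Category.assoc, ← Functor.map_comp, ← e_q, e.inv_hom_id_assoc]
  have : (realization ht).Faithful := ⟨fun h => realization_map_injective ht ht₀ h⟩
  have : (realization ht).Full := ⟨realization_map_surjective ht ht₀⟩
  let α := (realization ht).preimageIso (φ ≪≫ (stab t).mapIso e.symm)
  have hα : (realization ht).map α.hom = φ.hom ≫ (stab t).map e.inv :=
    (realization ht).map_preimage _
  refine ⟨α, (realization ht).map_injective ?_, (realization ht).map_injective ?_⟩
  · rw [Functor.map_comp, hα, ← hg', ← hm₀]
    exact g_φ_e
  · rw [Functor.map_comp, hα, ← hh', ← hq₀]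
    exact φ_e_q

theorem isDistinguished_iff_exists_iso [IsDomain R] (ht₀ : t ≠ 0) :
    IsDistinguished t f g h ↔ ∃ α : Z ≅ Z₀, g ≫ α.hom = g₀ ∧ α.hom ≫ h₀ = h :=
  ⟨exists_iso_of_isDistinguished ht hf₀ hm₀ hq₀ hP huq hmq ht₀,
    fun ⟨α, hg, hh⟩ => isDistinguished_of_iso ht hf₀ hm₀ hq₀ hP huq hmq α hg hh⟩

end Uniqueness

end FPi

namespace IndC

variable {K : Type*} {X Y : IndC K} {x₀ x₁ y₀ y₁ : ℝ}

/-- The real numbers `x₀ < x₁ < x₀ + 2π` label the object `X`. -/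
structure IsLift (X : IndC K) (x₀ x₁ : ℝ) : Prop where
  fst : (x₀ : Circ) = X.fst
  snd : (x₁ : Circ) = X.snd
  lt : x₀ < x₁
  lt_add : x₁ < x₀ + 2 * Real.pi

theorem isLift_mk' (h : x₀ < x₁) (h' : x₁ < x₀ + 2 * Real.pi) :
    (mk' x₀ x₁ h h' : IndC K).IsLift x₀ x₁ :=
  ⟨rfl, rfl, h, h'⟩

theorem IsLift.swap (hX : X.IsLift x₀ x₁) : X.swap.IsLift x₁ (x₀ + 2 * Real.pi) :=
  ⟨hX.snd, (Circ.coe_add_two_pi x₀).trans hX.fst, hX.lt_add, by linarith [hX.lt]⟩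

theorem IsLift.arc_start (hX : X.IsLift x₀ x₁) : (x₀ : Circ) = X.arc.start := hX.fst

theorem IsLift.finishArc_start (hX : X.IsLift x₀ x₁) : (x₁ : Circ) = X.finishArc.start := hX.snd

theorem IsLift.fullArc_start (hX : X.IsLift x₀ x₁) : (x₀ : Circ) = X.fullArc.start := hX.fst

theorem IsLift.add_arc_len (hX : X.IsLift x₀ x₁) : x₀ + X.arc.len = x₁ := by
  have arc_len : X.arc.len = x₁ - x₀ := dep_eq (by linarith [hX.lt]) (by linarith [hX.lt_add])
    (by rw [AddCircle.coe_sub, hX.fst, hX.snd])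
  rw [arc_len, add_sub_cancel]

theorem IsLift.linked (hX : X.IsLift x₀ x₁) (hY : Y.IsLift y₀ y₁) (h₀ : x₀ ≤ y₀) (h₀' : y₀ < x₁)
    (h₁ : x₁ ≤ y₁) (h₁' : y₁ < x₀ + 2 * Real.pi) : Linked X Y :=
  ⟨x₀, x₁, y₀, y₁, hX.fst, hX.snd, hY.fst, hY.snd, h₀, h₀', h₁, h₁'⟩

theorem IsLift.sgn_eq_zero_of_lt (hX : X.IsLift x₀ x₁) (hY : Y.IsLift y₀ y₁) (h₀ : x₀ < y₀)
    (h₁ : y₁ < x₁) : sgn X Y = 0 := by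
  have := hX.lt_add
  have := hY.lt
  have := hX.lt
  have not_linked : ¬ Linked X Y := by
    rw [linked_iff_of_lift hX.fst hX.snd hY.fst ((Circ.coe_add_two_pi y₁).trans hY.snd)] <;> grind
  have not_counterLinked : ¬ CounterLinked X Y := by
    rw [counterLinked_iff, linked_iff_of_lift hX.fst hX.snd hY.swap.fst hY.swap.snd] <;> grind
  rw [sgn, if_neg not_linked, if_neg not_counterLinked]

theorem IsLift.sgn_eq_zero_of_gt (hX : X.IsLift x₀ x₁) (hY : Y.IsLift y₀ y₁) (h₀ : x₀ < y₀)
    (h₁ : y₁ < x₁) : sgn Y X = 0 := by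
  have h := hY.swap.sgn_eq_zero_of_lt hX.swap h₁ (add_lt_add_left h₀ _)
  rwa [sgn_swap_left, sgn_swap_right, neg_neg] at h

end IndC

namespace FPi

open PS1 E IndC IsLocalRing

section Basic

variable {R : Type u} [CommRing R] {t : R} {K : Type*} {X Y : IndC K} {x₀ x₁ y₀ y₁ : ℝ}

theorem basic_f_of_isLift (hX : X.IsLift x₀ x₁) (hY : Y.IsLift y₀ y₁) (h₀ : x₀ ≤ y₀)
    (h₀' : y₀ < x₁) (h₁ : x₁ ≤ y₁) (h₁' : y₁ < x₀ + 2 * Real.pi) (r : R) :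
    (basic t r X Y).f = block t hX.arc_start hY.arc_start r r := by
  have := hX.add_arc_len
  have := hY.add_arc_len
  have := hY.lt
  have start_add : X.arc.start + ((y₀ - x₀ : ℝ) : Circ) = Y.arc.start := by
    rw [AddCircle.coe_sub, hX.arc_start, hY.arc_start, add_sub_cancel]
  rw [basic_of_linked (hX.linked hY h₀ h₀' h₁ h₁') r (sub_nonneg.2 h₀) start_add (by linarith)
    (by grind)]
  exact diag_f (add_sub_cancel _ _)

end Basic

/-! ### Matrices of basic morphisms -/

section OfMatrix

variable {R : Type u} [CommRing R] {t : R} {K : Type*} {ι κ ν : Type} [Fintype ι] [Fintype κ]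
  [Fintype ν] {A : ι → IndC K} {B : κ → IndC K} {C : ν → IndC K} {a₀ a₁ : ι → ℝ} {b₀ b₁ : κ → ℝ}
  {c₀ c₁ : ν → ℝ}

/-- The morphism of representations whose components are the blocks with coefficients `ρ i j` on
the starting points and `σ i j` on the end points. -/
noncomputable def ofMatrix (t : R) (hA : ∀ i, (A i).IsLift (a₀ i) (a₁ i))
    (hB : ∀ j, (B j).IsLift (b₀ j) (b₁ j)) (ρ σ : Matrix ι κ R) :
    (⨁ fun i => E t (A i).arc).V ⟶ (⨁ fun j => E t (B j).arc).V :=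
  descV fun i => ∑ j, block t (hA i).arc_start (hB j).arc_start (ρ i j) (σ i j) ≫
    (biproduct.ι (fun j => E t (B j).arc) j).f

variable {hA : ∀ i, (A i).IsLift (a₀ i) (a₁ i)} {hB : ∀ j, (B j).IsLift (b₀ j) (b₁ j)}
  {hC : ∀ k, (C k).IsLift (c₀ k) (c₁ k)}

theorem ι_ofMatrix (ρ σ : Matrix ι κ R) (i : ι) :
    (biproduct.ι (fun i => E t (A i).arc) i).f ≫ ofMatrix t hA hB ρ σ =
      ∑ j, block t (hA i).arc_start (hB j).arc_start (ρ i j) (σ i j) ≫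
        (biproduct.ι (fun j => E t (B j).arc) j).f :=
  ι_descV _ i

theorem ofMatrix_comp_ofMatrix {ρ σ : Matrix ι κ R} {ρ' σ' : Matrix κ ν R}
    (hρ : ∀ i j, ρ i j ≠ 0 → a₀ i ≤ b₀ j) (hρ' : ∀ j k, ρ' j k ≠ 0 → b₀ j ≤ c₀ k)
    (hσ : ∀ i j, σ i j ≠ 0 → a₁ i ≤ b₁ j)
    (hσ' : ∀ j k, σ' j k ≠ 0 → b₁ j ≤ c₁ k) :
    ofMatrix t hA hB ρ σ ≫ ofMatrix t hB hC ρ' σ' = ofMatrix t hA hC (ρ * ρ') (σ * σ') := by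
  simp only [← (hA _).add_arc_len, ← (hB _).add_arc_len, ← (hC _).add_arc_len] at hσ hσ'
  refine biproduct_hom_ext_f fun i => ?_
  rw [reassoc_of% ι_ofMatrix, ι_ofMatrix, Preadditive.sum_comp]
  simp only [Category.assoc, ι_ofMatrix, Preadditive.comp_sum]
  rw [Finset.sum_comm]
  refine Finset.sum_congr rfl fun k _ => ?_
  rw [Matrix.mul_apply, Matrix.mul_apply, block_sum, Preadditive.sum_comp]
  refine Finset.sum_congr rfl fun j _ => ?_
  rw [← block_comp_block (hρ i j) (hρ' j k) (hσ i j) (hσ' j k), Category.assoc]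

theorem ofMatrix_add (ρ ρ' σ σ' : Matrix ι κ R) : ofMatrix t hA hB (ρ + ρ') (σ + σ') =
    ofMatrix t hA hB ρ σ + ofMatrix t hA hB ρ' σ' := by
  refine biproduct_hom_ext_f fun i => ?_
  simp only [ι_ofMatrix, Preadditive.comp_add, Matrix.add_apply, block_add, Preadditive.add_comp,
    Finset.sum_add_distrib]

theorem ofMatrix_zero : ofMatrix t hA hB 0 0 = 0 := by
  refine biproduct_hom_ext_f fun i => ?_
  simp only [ι_ofMatrix, Matrix.zero_apply, block_zero, zero_comp, Finset.sum_const_zero, comp_zero]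

theorem ofMatrix_one [DecidableEq ι] : ofMatrix t hA hA 1 1 = 𝟙 _ := by
  refine biproduct_hom_ext_f fun i => ?_
  rw [ι_ofMatrix, Finset.sum_eq_single i, Matrix.one_apply_eq, block_one, Category.id_comp,
    Category.comp_id]
  · intro j _ hj
    rw [Matrix.one_apply_ne hj.symm, block_zero, zero_comp]
  · simp

/-- The matrix of the multiples `ρ i j` of the basic morphisms. -/
noncomputable def basicMatrix (t : R) (A : ι → IndC K) (B : κ → IndC K) (ρ : Matrix ι κ R) :
    (⨁ fun i => E t (A i).arc) ⟶ (⨁ fun j => E t (B j).arc) :=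
  biproduct.matrix fun i j => basic t (ρ i j) (A i) (B j)

theorem basicMatrix_f {ρ : Matrix ι κ R} (h : ∀ i j, ρ i j ≠ 0 → a₀ i ≤ b₀ j ∧ b₀ j < a₁ i ∧
    a₁ i ≤ b₁ j ∧ b₁ j < a₀ i + 2 * Real.pi) :
    (basicMatrix t A B ρ).f = ofMatrix t hA hB ρ ρ := by
  refine biproduct_hom_ext_f fun i => ?_
  have ι_basicMatrix : biproduct.ι (fun i => E t (A i).arc) i ≫ basicMatrix t A B ρ =
      ∑ j, basic t (ρ i j) (A i) (B j) ≫ biproduct.ι (fun j => E t (B j).arc) j := by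
    rw [basicMatrix, biproduct.ι_matrix, biproduct.lift_eq]
  refine (congrArg Hom.f ι_basicMatrix).trans ?_
  rw [ι_ofMatrix]
  refine (forget.map_sum _ _).trans (Finset.sum_congr rfl fun j _ => ?_)
  refine (forget.map_comp _ _).trans (congrArg (· ≫ _) ?_)
  change (basic t (ρ i j) (A i) (B j)).f = _
  by_cases hij : ρ i j = 0
  · rw [hij, basic_zero, block_zero]
    rfl
  · obtain ⟨h₀, h₀', h₁, h₁'⟩ := h i j hij
    exact basic_f_of_isLift (hA i) (hB j) h₀ h₀' h₁ h₁' _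

end OfMatrix

theorem represents_basicMatrix {R : Type u} [CommRing R] [IsLocalRing R] {t : R} {m n : ℕ}
    {A : Fin m → IndC (ResidueField R)} {B : Fin n → IndC (ResidueField R)}
    {f : CPi.sum A ⟶ CPi.sum B} {ρ : Matrix (Fin m) (Fin n) R}
    (h : ∀ i j, residue R (ρ i j) = (f i j).coeff) :
    Represents (X := CPi.sum A) (Y := CPi.sum B) t (basicMatrix t A B ρ) f := by
  refine fun i j => ⟨ρ i j, h i j, congrArg (stab t).map ?_⟩
  exact biproduct.matrix_components _ i j

end FPi

/-! ### The standard triangle -/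

namespace FPi

open PS1 E hull IndC

section Cone

variable {R : Type u} [CommRing R] {t : R} {K : Type*} {X : Fin 1 → IndC K} {Y : Fin 2 → IndC K}
  {Z : Fin 3 → IndC K} {a b c x y z : ℝ}

/-- The position of the summands of the objects in a standard triangle `X ⟶ Y ⟶ Z ⟶ ΣX`. -/
structure IsConeConfiguration (X : Fin 1 → IndC K) (Y : Fin 2 → IndC K) (Z : Fin 3 → IndC K)
    (a b c x y z : ℝ) : Prop where
  isLift_X : ∀ i, (X i).IsLift a x
  isLift_Y : ∀ j, (Y j).IsLift (![b, c] j) (![z, y] j)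
  isLift_Z : ∀ k, (Z k).IsLift (![b, c, x] k) (![a + 2 * Real.pi, z, y] k)
  a_lt_b : a < b
  b_lt_c : b < c
  c_lt_x : c < x
  x_lt_y : x < y
  y_lt_z : y < z
  z_lt : z < a + 2 * Real.pi

/-- The coefficients of the morphism `X ⟶ Y` of a standard triangle. -/
def coneBase (r₁ r₂ : Rˣ) : Matrix (Fin 1) (Fin 2) R := !![↑r₁, ↑r₂]

/-- The coefficients of the morphism `Y ⟶ Z` of a standard triangle. -/
def coneIn (r₁ r₂ : Rˣ) : Matrix (Fin 2) (Fin 3) R :=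
  !![-↑r₁⁻¹, ↑r₁⁻¹, 0; 0, -↑r₂⁻¹, ↑r₂⁻¹]

/-- The coefficients of the morphism `Z ⟶ ΣX` of a standard triangle. -/
def coneOut : Matrix (Fin 3) (Fin 1) R := !![1; 1; 1]

namespace IsConeConfiguration

variable (H : IsConeConfiguration X Y Z a b c x y z)

include H

theorem isLift_shift : ∀ i, (X i).swap.IsLift x (a + 2 * Real.pi) := fun i => (H.isLift_X i).swap

theorem le_of_coneBase (j) :
    a ≤ ![b, c] j ∧ ![b, c] j < x ∧ x ≤ ![z, y] j ∧ ![z, y] j < a + 2 * Real.pi := by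
  obtain ⟨-, -, -, _, _, _, _, _, _⟩ := H
  fin_cases j <;> simp <;> grind

theorem le_of_coneIn_ne_zero (r₁ r₂ : Rˣ) (i j) (h : coneIn r₁ r₂ i j ≠ 0) :
    ![b, c] i ≤ ![b, c, x] j ∧ ![b, c, x] j < ![z, y] i ∧
      ![z, y] i ≤ ![a + 2 * Real.pi, z, y] j ∧
      ![a + 2 * Real.pi, z, y] j < ![b, c] i + 2 * Real.pi := by
  obtain ⟨-, -, -, _, _, _, _, _, _⟩ := H
  fin_cases i <;> fin_cases j <;> simp [coneIn] at h ⊢ <;> grind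

theorem le_of_coneOut (i) :
    ![b, c, x] i ≤ x ∧ x < ![a + 2 * Real.pi, z, y] i ∧
      ![a + 2 * Real.pi, z, y] i ≤ a + 2 * Real.pi ∧
      a + 2 * Real.pi < ![b, c, x] i + 2 * Real.pi := by
  obtain ⟨-, -, -, _, _, _, _, _, _⟩ := H
  fin_cases i <;> simp <;> grind

theorem basicMatrix_coneBase_f (r₁ r₂ : Rˣ) : (basicMatrix t X Y (coneBase r₁ r₂)).f =
    ofMatrix t H.isLift_X H.isLift_Y (coneBase r₁ r₂) (coneBase r₁ r₂) :=
  basicMatrix_f fun _ j _ => H.le_of_coneBase j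

theorem basicMatrix_coneIn_f (r₁ r₂ : Rˣ) : (basicMatrix t Y Z (coneIn r₁ r₂)).f =
    ofMatrix t H.isLift_Y H.isLift_Z (coneIn r₁ r₂) (coneIn r₁ r₂) :=
  basicMatrix_f (H.le_of_coneIn_ne_zero r₁ r₂)

theorem basicMatrix_coneOut_f : (basicMatrix t Z (fun i => (X i).swap) coneOut).f =
    ofMatrix t H.isLift_Z H.isLift_shift coneOut coneOut :=
  basicMatrix_f fun i _ _ => H.le_of_coneOut i

theorem coneIn_comp_coneOut (r₁ r₂ : Rˣ) :
    basicMatrix t Y Z (coneIn r₁ r₂) ≫ basicMatrix t Z (fun i => (X i).swap) coneOut = 0 := by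
  have coneIn_mul_coneOut : coneIn r₁ r₂ * (coneOut : Matrix _ _ R) = 0 := by
    ext i j
    fin_cases i <;> simp [coneIn, coneOut, Matrix.mul_apply, Fin.sum_univ_succ]
  refine hom_ext ?_
  change (basicMatrix t Y Z (coneIn r₁ r₂)).f ≫ (basicMatrix t Z _ coneOut).f = 0
  rw [H.basicMatrix_coneIn_f, H.basicMatrix_coneOut_f, ofMatrix_comp_ofMatrix, coneIn_mul_coneOut,
    ofMatrix_zero]
  exacts [fun j k h => (H.le_of_coneIn_ne_zero r₁ r₂ j k h).1, fun k _ _ => (H.le_of_coneOut k).1,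
    fun j k h => (H.le_of_coneIn_ne_zero r₁ r₂ j k h).2.2.1,
    fun k _ _ => (H.le_of_coneOut k).2.2.1]

theorem exists_splitting_cone (r₁ r₂ : Rˣ) :
    ∃ (r : (⨁ fun k => E t (Z k).arc).V ⟶ (⨁ fun j => E t (Y j).arc).V)
      (s : (⨁ fun i => E t (X i).swap.arc).V ⟶ (⨁ fun k => E t (Z k).arc).V),
      (basicMatrix t Y Z (coneIn r₁ r₂)).f ≫ r = 𝟙 _ ∧
      r ≫ (basicMatrix t Y Z (coneIn r₁ r₂)).f +
        (basicMatrix t Z (fun i => (X i).swap) coneOut).f ≫ s = 𝟙 _ := by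
  refine ⟨ofMatrix t H.isLift_Z H.isLift_Y
      !![-↑r₁, -↑r₂; 0, -↑r₂; 0, 0] !![0, 0; ↑r₁, 0; ↑r₁, ↑r₂],
    ofMatrix t H.isLift_shift H.isLift_Z !![0, 0, 1] !![1, 0, 0], ?_, ?_⟩
  · rw [H.basicMatrix_coneIn_f, ofMatrix_comp_ofMatrix, ← ofMatrix_one (hA := H.isLift_Y)]
    · congr 1 <;> ext i j <;> fin_cases i <;> fin_cases j <;>
        simp [coneIn, Matrix.mul_apply, Fin.sum_univ_succ]
    all_goals
      obtain ⟨-, -, -, _, _, _, _, _, _⟩ := H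
      intro i j
      fin_cases i <;> fin_cases j <;> simp [coneIn] <;> grind
  · rw [H.basicMatrix_coneIn_f, H.basicMatrix_coneOut_f, ofMatrix_comp_ofMatrix,
      ofMatrix_comp_ofMatrix, ← ofMatrix_add, ← ofMatrix_one (hA := H.isLift_Z)]
    · congr 1 <;> ext i j <;> fin_cases i <;> fin_cases j <;> simp [coneIn, coneOut]
    all_goals
      obtain ⟨-, -, -, _, _, _, _, _, _⟩ := H
      intro i j
      fin_cases i <;> fin_cases j <;> simp [coneIn] <;> grind

theorem finishArc_add_zero (i) :
    (X i).finishArc.start + ((0 : ℝ) : Circ) = (Z 2).arc.start := by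
  rw [AddCircle.coe_zero, add_zero, ← (H.isLift_X i).finishArc_start]
  exact (H.isLift_Z 2).arc_start

theorem fullArc_add_sub (i) :
    (X i).fullArc.start + ((b - a : ℝ) : Circ) = (Z 0).arc.start := by
  rw [AddCircle.coe_sub, ← (H.isLift_X i).fullArc_start, add_sub_cancel]
  exact (H.isLift_Z 0).arc_start

theorem fullArc_len_le (i) : (X i).fullArc.len ≤ b - a + (Z 0).arc.len := by
  have len_Z₀ : b + (Z 0).arc.len = a + 2 * Real.pi := (H.isLift_Z 0).add_arc_len
  change 2 * Real.pi ≤ _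
  linarith

/-- The morphism from the middle term of the chosen exact sequence of `X` to `Z` in a standard
triangle: `E(x, x)` is mapped to the summand `E(x, y)`, and `E(a, a + 2π)` to `E(b, a + 2π)`. -/
noncomputable def hullToCone (t : R) :
    (⨁ fun i => hull t (X i)) ⟶ ⨁ fun k => E t (Z k).arc :=
  biproduct.desc fun i => biprod.desc
    (diag t 1 0 le_rfl (H.finishArc_add_zero i) ((Z 2).arc.nonneg.trans_eq (zero_add _).symm) ≫
      biproduct.ι (fun k => E t (Z k).arc) 2)
    (diag t 1 (b - a) (sub_nonneg.2 H.a_lt_b.le) (H.fullArc_add_sub i) (H.fullArc_len_le i) ≫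
      biproduct.ι (fun k => E t (Z k).arc) 0)

theorem inl_hullToCone_f (i) :
    (inl t (X i)).f ≫ (biproduct.ι (fun i => hull t (X i)) i).f ≫ (H.hullToCone t).f =
      block t (H.isLift_X i).finishArc_start (H.isLift_Z 2).arc_start 1 1 ≫
        (biproduct.ι (fun k => E t (Z k).arc) 2).f := by
  have inl_hullToCone : inl t (X i) ≫ biproduct.ι (fun i => hull t (X i)) i ≫ H.hullToCone t =
      diag t 1 0 _ _ _ ≫ biproduct.ι (fun k => E t (Z k).arc) 2 :=
    (congrArg (inl t (X i) ≫ ·) (biproduct.ι_desc (f := fun i => hull t (X i)) _ i)).trans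
      (biprod.inl_desc _ _)
  exact (congrArg Hom.f inl_hullToCone).trans (congrArg (· ≫ _) (diag_f (add_zero x)))

theorem inr_hullToCone_f (i) :
    (inr t (X i)).f ≫ (biproduct.ι (fun i => hull t (X i)) i).f ≫ (H.hullToCone t).f =
      block t (H.isLift_X i).fullArc_start (H.isLift_Z 0).arc_start 1 1 ≫
        (biproduct.ι (fun k => E t (Z k).arc) 0).f := by
  have inr_hullToCone : inr t (X i) ≫ biproduct.ι (fun i => hull t (X i)) i ≫ H.hullToCone t =
      diag t 1 (b - a) _ _ _ ≫ biproduct.ι (fun k => E t (Z k).arc) 0 :=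
    (congrArg (inr t (X i) ≫ ·) (biproduct.ι_desc (f := fun i => hull t (X i)) _ i)).trans
      (biprod.inr_desc _ _)
  exact (congrArg Hom.f inr_hullToCone).trans (congrArg (· ≫ _) (diag_f (add_sub_cancel a b)))

theorem ι_coneOut_f (k) : (biproduct.ι (fun k => E t (Z k).arc) k).f ≫
    (basicMatrix t Z (fun i => (X i).swap) coneOut).f =
      block t (H.isLift_Z k).arc_start (H.isLift_shift 0).arc_start 1 1 ≫
        (biproduct.ι (fun i => E t (X i).swap.arc) 0).f := by
  rw [H.basicMatrix_coneOut_f, ι_ofMatrix, Fin.sum_univ_one]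
  fin_cases k <;> rfl

theorem hullToCone_comp_coneOut_f :
    (H.hullToCone t).f ≫ (basicMatrix t Z (fun i => (X i).swap) coneOut).f =
      (biproduct.map fun i => hullOut t (X i)).f := by
  have len_X := (H.isLift_X 0).add_arc_len
  have len_Z₀ : b + (Z 0).arc.len = a + 2 * Real.pi := (H.isLift_Z 0).add_arc_len
  have len_Z₂ : x + (Z 2).arc.len = y := (H.isLift_Z 2).add_arc_len
  have len_shift := (H.isLift_shift 0).add_arc_len
  have len_finish : (X 0).finishArc.len = 0 := rfl
  have len_full : (X 0).fullArc.len = 2 * Real.pi := rfl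
  refine biproduct_hom_ext_f fun i => ?_
  obtain rfl := Subsingleton.elim i 0
  refine hull.hom_ext' ?_ ?_
  · rw [reassoc_of% H.inl_hullToCone_f, H.ι_coneOut_f, biproduct_ι_map_f,
      reassoc_of% inl_hullOut_f (hF := (H.isLift_X 0).finishArc_start)
        (hS := (H.isLift_shift 0).arc_start), reassoc_of% block_comp_block, mul_one]
    all_goals
      obtain ⟨-, -, -, _, _, _, _, _, _⟩ := H
      simp [len_finish] <;> grind
  · rw [reassoc_of% H.inr_hullToCone_f, H.ι_coneOut_f, biproduct_ι_map_f,
      reassoc_of% inr_hullOut_f (hI := (H.isLift_X 0).fullArc_start)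
        (hS := (H.isLift_shift 0).arc_start) len_X, reassoc_of% block_comp_block, mul_one]
    all_goals
      obtain ⟨-, -, -, _, _, _, _, _, _⟩ := H
      simp [len_full]
      grind

theorem hullIn_comp_hullToCone_f :
    (biproduct.map fun i => hullIn t (X i)).f ≫ (H.hullToCone t).f =
      ofMatrix t H.isLift_X H.isLift_Z !![-1, 0, 1] !![-1, 0, 1] := by
  have len_X := (H.isLift_X 0).add_arc_len
  have len_Z₀ : b + (Z 0).arc.len = a + 2 * Real.pi := (H.isLift_Z 0).add_arc_len
  have len_Z₂ : x + (Z 2).arc.len = y := (H.isLift_Z 2).add_arc_len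
  have len_finish : (X 0).finishArc.len = 0 := rfl
  have len_full : (X 0).fullArc.len = 2 * Real.pi := rfl
  refine biproduct_hom_ext_f fun i => ?_
  obtain rfl := Subsingleton.elim i 0
  rw [reassoc_of% biproduct_ι_map_f, ι_ofMatrix, Fin.sum_univ_three, hull.comp_eq_add,
    H.inl_hullToCone_f, H.inr_hullToCone_f,
    hullIn_fst_f (hX := (H.isLift_X 0).arc_start) (hF := (H.isLift_X 0).finishArc_start) len_X,
    hullIn_snd_f (hX := (H.isLift_X 0).arc_start) (hI := (H.isLift_X 0).fullArc_start),
    reassoc_of% block_comp_block,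
    reassoc_of% block_comp_block, mul_one, mul_one, add_comm]
  · simp [block_zero]
  all_goals
    obtain ⟨-, -, -, _, _, _, _, _, _⟩ := H
    simp -failIfUnchanged [len_finish, len_full] <;> grind

omit H in
theorem coneBase_mul_coneIn (r₁ r₂ : Rˣ) : coneBase r₁ r₂ * coneIn r₁ r₂ = !![-1, 0, 1] := by
  ext i j
  fin_cases i
  fin_cases j <;> simp [coneBase, coneIn]

theorem coneBase_comp_coneIn_f (r₁ r₂ : Rˣ) :
    (basicMatrix t X Y (coneBase r₁ r₂)).f ≫ (basicMatrix t Y Z (coneIn r₁ r₂)).f =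
      ofMatrix t H.isLift_X H.isLift_Z !![-1, 0, 1] !![-1, 0, 1] := by
  rw [H.basicMatrix_coneBase_f, H.basicMatrix_coneIn_f, ofMatrix_comp_ofMatrix,
    coneBase_mul_coneIn]
  exacts [fun _ j _ => (H.le_of_coneBase j).1,
    fun j k h => (H.le_of_coneIn_ne_zero r₁ r₂ j k h).1, fun _ j _ => (H.le_of_coneBase j).2.2.1,
    fun j k h => (H.le_of_coneIn_ne_zero r₁ r₂ j k h).2.2.1]

theorem isPushout_cone (r₁ r₂ : Rˣ) :
    IsPushout (biproduct.map fun i => hullIn t (X i)) (basicMatrix t X Y (coneBase r₁ r₂))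
      (H.hullToCone t) (basicMatrix t Y Z (coneIn r₁ r₂)) := by
  obtain ⟨ρ, σ, -, σ_out, total⟩ := exists_splitting_biproduct_map
    (fun i => exists_splitting_hull (t := t) (X := X i))
  obtain ⟨r, s, in_r, total'⟩ := H.exists_splitting_cone (t := t) r₁ r₂
  exact isPushout_of_isPushout_f <| isPushout_of_splittings
    (H.hullIn_comp_hullToCone_f.trans (H.coneBase_comp_coneIn_f r₁ r₂).symm)
    H.hullToCone_comp_coneOut_f (congrArg Hom.f (H.coneIn_comp_coneOut r₁ r₂)) σ_out total in_r
    total'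

end IsConeConfiguration

end Cone

end FPi

namespace IndC

variable {K : Type*} [Field K] {X Y : IndC K}

theorem comp_end_coeff (f : X ⟶ Y) (g : Y ⟶ Y) : (f ≫ g).coeff = f.coeff * g.coeff :=
  if_pos (by rw [sgn_self, mul_one])

theorem end_comp_coeff (f : X ⟶ X) (g : X ⟶ Y) : (f ≫ g).coeff = f.coeff * g.coeff :=
  if_pos (by rw [sgn_self, one_mul])

end IndC

/-! ### Rescalings -/

namespace CPi

open IndC

variable {K : Type*} [Field K]

section Diagonal

variable {X Y Z : CPi K}

open Classical in
/-- The endomorphism of `Z` that multiplies each summand by the given scalar. -/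
noncomputable def diagonal (Z : CPi K) (c : Z.ι → K) : Z ⟶ Z := fun i j =>
  ⟨if i = j then c i else 0, fun h => if_neg fun e => by simp [e, sgn_self] at h⟩

theorem diagonal_apply_self_coeff (c : Z.ι → K) (i) : (Z.diagonal c i i).coeff = c i :=
  if_pos rfl

theorem diagonal_apply_of_ne (c : Z.ι → K) {i j} (h : i ≠ j) : Z.diagonal c i j = 0 :=
  hom_ext (if_neg h)

theorem comp_diagonal_coeff (g : Y ⟶ Z) (c : Z.ι → K) (i j) :
    ((g ≫ Z.diagonal c) i j).coeff = (g i j).coeff * c j := by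
  rw [Mat_.comp_apply, Finset.sum_eq_single j, comp_end_coeff, diagonal_apply_self_coeff]
  · intro k _ hk
    rw [diagonal_apply_of_ne c hk, comp_zero]
  · simp

theorem diagonal_comp_coeff (c : Z.ι → K) (h : Z ⟶ X) (i j) :
    ((Z.diagonal c ≫ h) i j).coeff = c i * (h i j).coeff := by
  rw [Mat_.comp_apply, Finset.sum_eq_single i, end_comp_coeff, diagonal_apply_self_coeff]
  · intro k _ hk
    rw [diagonal_apply_of_ne c hk.symm, zero_comp]
  · simp

theorem id_apply_self_coeff (i) : ((𝟙 Z : Z ⟶ Z) i i).coeff = 1 := by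
  classical
  exact congrArg Hom.coeff (Mat_.id_apply_self Z i)

theorem diagonal_comp_diagonal_of_mul_eq_one {c d : Z.ι → K} (h : ∀ i, c i * d i = 1) :
    Z.diagonal c ≫ Z.diagonal d = 𝟙 Z := by
  classical
  refine funext fun i => funext fun j => hom_ext ?_
  rw [comp_diagonal_coeff]
  by_cases hij : i = j
  · subst hij
    rw [diagonal_apply_self_coeff, h, id_apply_self_coeff]
  · rw [diagonal_apply_of_ne c hij, Mat_.id_apply_of_ne _ _ _ hij]
    exact zero_mul _

theorem eq_diagonal_of_sgn_eq_zero (hZ : ∀ i j, i ≠ j → sgn (Z.X i) (Z.X j) = 0) (α : Z ⟶ Z) :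
    α = Z.diagonal fun i => (α i i).coeff := by
  refine funext fun i => funext fun j => hom_ext ?_
  by_cases hij : i = j
  · subst hij
    rw [diagonal_apply_self_coeff]
  · rw [diagonal_apply_of_ne _ hij]
    exact (α i j).zero (hZ i j hij)

theorem exists_iso_iff_of_sgn_eq_zero (hZ : ∀ i j, i ≠ j → sgn (Z.X i) (Z.X j) = 0)
    {g g₀ : Y ⟶ Z} {h h₀ : Z ⟶ X} : (∃ α : Z ≅ Z, g ≫ α.hom = g₀ ∧ α.hom ≫ h₀ = h) ↔
      ∃ c : Z.ι → K, (∀ i, c i ≠ 0) ∧ (∀ i j, (g i j).coeff * c j = (g₀ i j).coeff) ∧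
        ∀ i j, c i * (h₀ i j).coeff = (h i j).coeff := by
  constructor
  · rintro ⟨α, rfl, rfl⟩
    have hα := eq_diagonal_of_sgn_eq_zero hZ α.hom
    refine ⟨fun i => (α.hom i i).coeff, fun i => ?_, fun i j => ?_, fun i j => ?_⟩
    · have hom_inv : (α.hom i i).coeff * (α.inv i i).coeff = 1 := by
        rw [← diagonal_comp_coeff (fun i => (α.hom i i).coeff), ← hα, α.hom_inv_id,
          id_apply_self_coeff]
      exact left_ne_zero_of_mul_eq_one hom_inv
    · rw [← comp_diagonal_coeff g (fun i => (α.hom i i).coeff), ← hα]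
    · rw [← diagonal_comp_coeff (fun i => (α.hom i i).coeff), ← hα]
  · rintro ⟨c, hc, hg, hh⟩
    let α : Z ≅ Z :=
      ⟨Z.diagonal c, Z.diagonal fun i => (c i)⁻¹,
        diagonal_comp_diagonal_of_mul_eq_one fun i => mul_inv_cancel₀ (hc i),
        diagonal_comp_diagonal_of_mul_eq_one fun i => inv_mul_cancel₀ (hc i)⟩
    refine ⟨α, ?_, ?_⟩
    · exact funext fun i => funext fun j => hom_ext ((comp_diagonal_coeff g c i j).trans (hg i j))
    · exact funext fun i => funext fun j => hom_ext ((diagonal_comp_coeff c h₀ i j).trans (hh i j))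

end Diagonal

/-- The morphism between two direct sums with given coefficients. -/
def homOfMatrix {m n : ℕ} {A : Fin m → IndC K} {B : Fin n → IndC K} (ρ : Matrix (Fin m) (Fin n) K)
    (h : ∀ i j, sgn (A i) (B j) = 0 → ρ i j = 0) : CPi.sum A ⟶ CPi.sum B :=
  fun i j => ⟨ρ i j, h i j⟩

end CPi

namespace FPi

open IndC IsLocalRing

theorem exists_rescaling_iff {K : Type*} [Field K] {g : Matrix (Fin 2) (Fin 3) K}
    {h : Matrix (Fin 3) (Fin 1) K} {c₁ c₂ : Kˣ} :
    (∃ d : Fin 3 → K, (∀ i, d i ≠ 0) ∧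
        (∀ i j, g i j * d j = coneIn c₁ c₂ i j) ∧ ∀ i j, d i * coneOut i j = h i j) ↔
      h 0 0 * g 0 0 * c₁ = -1 ∧ h 1 0 * g 0 1 * c₁ = 1 ∧ h 1 0 * g 1 1 * c₂ = -1 ∧
        h 2 0 * g 1 2 * c₂ = 1 ∧ g 1 0 = 0 ∧ g 0 2 = 0 := by
  have h₁ : (c₁ : K) ≠ 0 := c₁.ne_zero
  have h₂ : (c₂ : K) ≠ 0 := c₂.ne_zero
  constructor
  · rintro ⟨d, hd, hg, hh⟩
    simp only [Fin.forall_fin_succ, IsEmpty.forall_iff, and_true, Fin.succ_zero_eq_one,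
      Fin.succ_one_eq_two, coneIn, coneOut, Units.val_inv_eq_inv_val, Matrix.of_apply,
      Matrix.cons_val', Matrix.cons_val_fin_one, Matrix.cons_val_zero, Matrix.cons_val_succ,
      mul_one] at hd hg hh
    grind
  · rintro ⟨e₁, e₂, e₃, e₄, e₅, e₆⟩
    refine ⟨fun i => h i 0, ?_, ?_, ?_⟩ <;>
      simp [Fin.forall_fin_succ, coneIn, coneOut] <;> grind

namespace IsConeConfiguration

section StandardTriangle

variable {K : Type*} {X : Fin 1 → IndC K} {Y : Fin 2 → IndC K} {Z : Fin 3 → IndC K}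
  {a b c x y z : ℝ} (H : IsConeConfiguration X Y Z a b c x y z)

include H

theorem nested_Z {k l : Fin 3} (hkl : k < l) : ![b, c, x] k < ![b, c, x] l ∧
    ![a + 2 * Real.pi, z, y] l < ![a + 2 * Real.pi, z, y] k := by
  obtain ⟨-, -, -, _, _, _, _, _, _⟩ := H
  fin_cases k <;> fin_cases l <;> simp at hkl ⊢ <;> grind

theorem sgn_Z_eq_zero {k l} (hkl : k ≠ l) : sgn (Z k) (Z l) = 0 := by
  rcases hkl.lt_or_gt with hkl | hlk
  · have nested := H.nested_Z hkl
    exact (H.isLift_Z k).sgn_eq_zero_of_lt (H.isLift_Z l) nested.1 nested.2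
  · have nested := H.nested_Z hlk
    exact (H.isLift_Z l).sgn_eq_zero_of_gt (H.isLift_Z k) nested.1 nested.2

theorem sgn_shift_ne_zero (k i) : sgn (Z k) (X i).swap ≠ 0 := by
  obtain ⟨h₀, h₀', h₁, h₁'⟩ := H.le_of_coneOut k
  rw [sgn_eq_one_iff.2 ((H.isLift_Z k).linked (H.isLift_shift i) h₀ h₀' h₁ h₁')]
  exact one_ne_zero

variable [Field K]

theorem coneIn_eq_zero (c₁ c₂ : Kˣ) (j k) (h : sgn (Y j) (Z k) = 0) : coneIn c₁ c₂ j k = 0 := by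
  by_contra coneIn_ne_zero
  obtain ⟨h₀, h₀', h₁, h₁'⟩ := H.le_of_coneIn_ne_zero c₁ c₂ j k coneIn_ne_zero
  rw [sgn_eq_one_iff.2 ((H.isLift_Y j).linked (H.isLift_Z k) h₀ h₀' h₁ h₁')] at h
  exact one_ne_zero h

/-- The morphism `Y ⟶ Z` of the standard triangle over the morphism `X ⟶ Y` with coefficients `c₁`
and `c₂`. -/
def standardIn (c₁ c₂ : Kˣ) : CPi.sum Y ⟶ CPi.sum Z :=
  CPi.homOfMatrix (coneIn c₁ c₂) (H.coneIn_eq_zero c₁ c₂)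

/-- The morphism `Z ⟶ ΣX` of a standard triangle. -/
def standardOut : CPi.sum Z ⟶ (CPi.sum X).shift :=
  CPi.homOfMatrix coneOut fun k i h => absurd h (H.sgn_shift_ne_zero k i)

end StandardTriangle

section Distinguished

variable {R : Type u} [CommRing R] [IsLocalRing R] {t : R} {X : Fin 1 → IndC (ResidueField R)}
  {Y : Fin 2 → IndC (ResidueField R)} {Z : Fin 3 → IndC (ResidueField R)} {a b c x y z : ℝ}
  (H : IsConeConfiguration X Y Z a b c x y z)

include H

theorem represents_coneIn (r₁ r₂ : Rˣ) : Represents (X := CPi.sum Y) (Y := CPi.sum Z) t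
    (basicMatrix t Y Z (coneIn r₁ r₂))
    (H.standardIn (Units.map (residue R) r₁) (Units.map (residue R) r₂)) := by
  refine represents_basicMatrix fun j k => ?_
  change _ = coneIn _ _ j k
  fin_cases j <;> fin_cases k <;> simp [coneIn]

theorem represents_coneOut : Represents (X := CPi.sum Z) (Y := (CPi.sum X).shift) t
    (basicMatrix t Z (fun i => (X i).swap) coneOut) H.standardOut := by
  refine represents_basicMatrix (A := Z) (B := fun i => (X i).swap) fun k i => ?_
  change _ = coneOut k i
  fin_cases k <;> simp [coneOut]

variable [IsDomain R]

theorem isDistinguished_iff_exists_iso (ht : maximalIdeal R = Ideal.span {t}) (ht₀ : t ≠ 0)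
    {c₁ c₂ : (ResidueField R)ˣ} {f : CPi.sum X ⟶ CPi.sum Y}
    (hf₁ : (f (0 : Fin 1) (0 : Fin 2)).coeff = c₁)
    (hf₂ : (f (0 : Fin 1) (1 : Fin 2)).coeff = c₂) {W : CPi (ResidueField R)}
    {g : CPi.sum Y ⟶ W} {h : W ⟶ (CPi.sum X).shift} :
    IsDistinguished t f g h ↔
      ∃ α : W ≅ CPi.sum Z, g ≫ α.hom = H.standardIn c₁ c₂ ∧ α.hom ≫ H.standardOut = h := by
  obtain ⟨r₁, rfl⟩ := surjective_units_map_of_local_ringHom (residue R) residue_surjective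
    inferInstance c₁
  obtain ⟨r₂, rfl⟩ := surjective_units_map_of_local_ringHom (residue R) residue_surjective
    inferInstance c₂
  have represents_f : Represents (X := CPi.sum X) (Y := CPi.sum Y) t
      (basicMatrix t X Y (coneBase r₁ r₂)) f := by
    refine represents_basicMatrix fun i j => ?_
    obtain rfl := Subsingleton.elim i 0
    fin_cases j
    exacts [hf₁.symm, hf₂.symm]
  exact FPi.isDistinguished_iff_exists_iso ht represents_f (H.represents_coneIn r₁ r₂)
    H.represents_coneOut (H.isPushout_cone r₁ r₂) (hom_ext H.hullToCone_comp_coneOut_f)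
    (H.coneIn_comp_coneOut r₁ r₂) ht₀

theorem isDistinguished_iff_coeff (ht : maximalIdeal R = Ideal.span {t}) (ht₀ : t ≠ 0)
    {c₁ c₂ : (ResidueField R)ˣ} {f : CPi.sum X ⟶ CPi.sum Y}
    (hf₁ : (f (0 : Fin 1) (0 : Fin 2)).coeff = c₁)
    (hf₂ : (f (0 : Fin 1) (1 : Fin 2)).coeff = c₂)
    {g : CPi.sum Y ⟶ CPi.sum Z} {h : CPi.sum Z ⟶ (CPi.sum X).shift} :
    IsDistinguished t f g h ↔
      (h (0 : Fin 3) (0 : Fin 1)).coeff * (g (0 : Fin 2) (0 : Fin 3)).coeff * c₁ = -1 ∧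
      (h (1 : Fin 3) (0 : Fin 1)).coeff * (g (0 : Fin 2) (1 : Fin 3)).coeff * c₁ = 1 ∧
      (h (1 : Fin 3) (0 : Fin 1)).coeff * (g (1 : Fin 2) (1 : Fin 3)).coeff * c₂ = -1 ∧
      (h (2 : Fin 3) (0 : Fin 1)).coeff * (g (1 : Fin 2) (2 : Fin 3)).coeff * c₂ = 1 ∧
      (g (1 : Fin 2) (0 : Fin 3)).coeff = 0 ∧ (g (0 : Fin 2) (2 : Fin 3)).coeff = 0 :=
  (H.isDistinguished_iff_exists_iso ht ht₀ hf₁ hf₂).trans <|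
    (CPi.exists_iso_iff_of_sgn_eq_zero fun _ _ => H.sgn_Z_eq_zero).trans
      (exists_rescaling_iff (g := fun j k => (g j k).coeff) (h := fun k i => (h k i).coeff))

end Distinguished

end IsConeConfiguration

theorem isConeConfiguration_mk' (K : Type*) {a b c x y z : ℝ} (hab : a < b) (hbc : b < c)
    (hcx : c < x) (hxy : x < y) (hyz : y < z) (hza : z < a + 2 * Real.pi) :
    IsConeConfiguration (K := K) ![mk' a x (by linarith) (by linarith)]
      ![mk' b z (by linarith) (by linarith), mk' c y (by linarith) (by linarith)]
      ![mk' b (a + 2 * Real.pi) (by linarith) (by linarith),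
        mk' c z (by linarith) (by linarith), mk' x y (by linarith) (by linarith)] a b c x y z where
  isLift_X i := by fin_cases i; exact isLift_mk' (by linarith) (by linarith)
  isLift_Y j := by fin_cases j <;> exact isLift_mk' (by linarith) (by linarith)
  isLift_Z k := by fin_cases k <;> exact isLift_mk' (by linarith) (by linarith)
  a_lt_b := hab
  b_lt_c := hbc
  c_lt_x := hcx
  x_lt_y := hxy
  y_lt_z := hyz
  z_lt := hza

end FPi

theorem mainTheorem10_general {R : Type u} [CommRing R] [IsDomain R] [IsLocalRing R] (t : R)
    (ht : IsLocalRing.maximalIdeal R = Ideal.span {t}) (ht₀ : t ≠ 0) (a b c x y z : ℝ)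
    (hab : a < b) (hbc : b < c) (hcx : c < x) (hxy : x < y) (hyz : y < z)
    (hza : z < a + 2 * Real.pi) :
    let X : CPi (IsLocalRing.ResidueField R) :=
      CPi.sum ![IndC.mk' a x (by linarith) (by linarith)]
    let Y : CPi (IsLocalRing.ResidueField R) :=
      CPi.sum ![IndC.mk' b z (by linarith) (by linarith), IndC.mk' c y (by linarith) (by linarith)]
    let Z₀ : CPi (IsLocalRing.ResidueField R) :=
      CPi.sum ![IndC.mk' b (a + 2 * Real.pi) (by linarith) (by linarith),
        IndC.mk' c z (by linarith) (by linarith), IndC.mk' x y (by linarith) (by linarith)]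
    ∀ f : X ⟶ Y, f (0 : Fin 1) (0 : Fin 2) ≠ 0 → f (0 : Fin 1) (1 : Fin 2) ≠ 0 →
      (∀ Z : CPi (IsLocalRing.ResidueField R),
        (∃ (g : Y ⟶ Z) (h : Z ⟶ X.shift), IsDistinguished t f g h) ↔ Nonempty (Z ≅ Z₀)) ∧
      ∀ (g : Y ⟶ Z₀) (h : Z₀ ⟶ X.shift), IsDistinguished t f g h ↔
        (h (0 : Fin 3) (0 : Fin 1)).coeff * (g (0 : Fin 2) (0 : Fin 3)).coeff *
            (f (0 : Fin 1) (0 : Fin 2)).coeff = -1 ∧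
        (h (1 : Fin 3) (0 : Fin 1)).coeff * (g (0 : Fin 2) (1 : Fin 3)).coeff *
            (f (0 : Fin 1) (0 : Fin 2)).coeff = 1 ∧
        (h (1 : Fin 3) (0 : Fin 1)).coeff * (g (1 : Fin 2) (1 : Fin 3)).coeff *
            (f (0 : Fin 1) (1 : Fin 2)).coeff = -1 ∧
        (h (2 : Fin 3) (0 : Fin 1)).coeff * (g (1 : Fin 2) (2 : Fin 3)).coeff *
            (f (0 : Fin 1) (1 : Fin 2)).coeff = 1 ∧
        (g (1 : Fin 2) (0 : Fin 3)).coeff = 0 ∧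
        (g (0 : Fin 2) (2 : Fin 3)).coeff = 0 := by
  intro X Y Z₀ f hf₁ hf₂
  have H := FPi.isConeConfiguration_mk' (IsLocalRing.ResidueField R) hab hbc hcx hxy hyz hza
  let c₁ := Units.mk0 (f (0 : Fin 1) (0 : Fin 2)).coeff fun h => hf₁ (IndC.hom_ext h)
  let c₂ := Units.mk0 (f (0 : Fin 1) (1 : Fin 2)).coeff fun h => hf₂ (IndC.hom_ext h)
  have hf : (f (0 : Fin 1) (0 : Fin 2)).coeff = c₁ ∧ (f (0 : Fin 1) (1 : Fin 2)).coeff = c₂ :=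
    ⟨rfl, rfl⟩
  refine ⟨fun Z => ⟨fun ⟨g, h, hgh⟩ => ?_, fun ⟨α⟩ => ?_⟩, fun g h => ?_⟩
  · obtain ⟨α, -, -⟩ := (H.isDistinguished_iff_exists_iso ht ht₀ hf.1 hf.2).1 hgh
    exact ⟨α⟩
  · exact ⟨H.standardIn c₁ c₂ ≫ α.inv, α.hom ≫ H.standardOut,
      (H.isDistinguished_iff_exists_iso ht ht₀ hf.1 hf.2).2
        ⟨α, (Category.assoc _ _ _).trans (Iso.inv_hom_id α ▸ Category.comp_id _), rfl⟩⟩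
  · exact H.isDistinguished_iff_coeff ht ht₀ hf.1 hf.2

theorem mainTheorem10 {R : Type u} [CommRing R] [IsDomain R] [IsDiscreteValuationRing R]
    (t : R) (ht : Irreducible t) (a b c x y z : ℝ)
    (hab : a < b) (hbc : b < c) (hcx : c < x) (hxy : x < y) (hyz : y < z)
    (hza : z < a + 2 * Real.pi) :
    let X : CPi (IsLocalRing.ResidueField R) :=
      CPi.sum ![IndC.mk' a x (by linarith) (by linarith)]
    let Y : CPi (IsLocalRing.ResidueField R) :=
      CPi.sum ![IndC.mk' b z (by linarith) (by linarith), IndC.mk' c y (by linarith) (by linarith)]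
    let Z₀ : CPi (IsLocalRing.ResidueField R) :=
      CPi.sum ![IndC.mk' b (a + 2 * Real.pi) (by linarith) (by linarith),
        IndC.mk' c z (by linarith) (by linarith), IndC.mk' x y (by linarith) (by linarith)]
    ∀ f : X ⟶ Y, f (0 : Fin 1) (0 : Fin 2) ≠ 0 → f (0 : Fin 1) (1 : Fin 2) ≠ 0 →
      (∀ Z : CPi (IsLocalRing.ResidueField R),
        (∃ (g : Y ⟶ Z) (h : Z ⟶ X.shift), IsDistinguished t f g h) ↔ Nonempty (Z ≅ Z₀)) ∧
      ∀ (g : Y ⟶ Z₀) (h : Z₀ ⟶ X.shift), IsDistinguished t f g h ↔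
        (h (0 : Fin 3) (0 : Fin 1)).coeff * (g (0 : Fin 2) (0 : Fin 3)).coeff *
            (f (0 : Fin 1) (0 : Fin 2)).coeff = -1 ∧
        (h (1 : Fin 3) (0 : Fin 1)).coeff * (g (0 : Fin 2) (1 : Fin 3)).coeff *
            (f (0 : Fin 1) (0 : Fin 2)).coeff = 1 ∧
        (h (1 : Fin 3) (0 : Fin 1)).coeff * (g (1 : Fin 2) (1 : Fin 3)).coeff *
            (f (0 : Fin 1) (1 : Fin 2)).coeff = -1 ∧
        (h (2 : Fin 3) (0 : Fin 1)).coeff * (g (1 : Fin 2) (2 : Fin 3)).coeff *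
            (f (0 : Fin 1) (1 : Fin 2)).coeff = 1 ∧
        (g (1 : Fin 2) (0 : Fin 3)).coeff = 0 ∧
        (g (0 : Fin 2) (2 : Fin 3)).coeff = 0 :=
  mainTheorem10_general t ht.maximalIdeal_eq ht.ne_zero a b c x y z hab hbc hcx hxy hyz hza
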